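/- **Theorem (existence of an almost quadratic time algorithm for FlowAR).** *Layers.* Token maps $\mathsf X\in\mathbb R^{h\times w\times c}$ are flattened to matrices $X\in\mathbb R^{hw\times c}$, and $\|\cdot\|_\infty$ is the maximum norm. Attention: $\mathsf{Attn}(X)=D^{-1}AXW_V$ with $A_{ij}=\exp(S_{ij})$, scores $S=XW_QW_K^\top X^\top$, $D=\mathrm{diag}(A\mathbf 1)$. A layer $N(\cdot)$ is an approximate attention computation ($\mathsf{AAttC}$) with tolerance $\delta$ if $\|N(X)-\mathsf{Attn}(X)\|_\infty\le\delta$ for all $X$. On every token, $\mathsf{MLP}(x)=xW+b$, $\mathsf{FFN}(x)=x+\mathrm{ReLU}(xW_1+b_1)W_2+b_2$ and $\mathsf{LN}(x)=(x-\mu)/\sqrt{\sigma^2}$ with $\mu,\sigma^2$ the mean and the variance of the channels. Upsampling with kernel $W:\mathbb R\to[0,1]$: $\phi_{\rm up}(\mathsf X,a)_{i,j,l}=\sum_{s,t=-1}^{2}W(s)W(t)\,\mathsf X_{\lfloor i/a\rfloor+s,\lfloor j/a\rfloor+t,l}$, where indices outside the grid are replaced by the nearest index of the grid. *FlowAR inference.*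 Let $K,a\ge1$ be constants, $h=w=n$ with $a^{K-1}\mid n$, $r_i=a^{K-i}$ and $c=d$ channels. Given $\mathsf Z_{\rm init}\in\mathbb R^{(n/r_1)\times(n/r_1)\times d}$, noise tensors $\mathsf F_i^0\in\mathbb R^{(n/r_i)\times(n/r_i)\times d}$ and times $t_i\in[0,1]$, put for $i=1,\dots,K$ (each scale and layer with its own weights) $$\mathsf Z_i=\mathsf{Concat}(\mathsf Z_{\rm init},\phi_{\rm up}(\widetilde{\mathsf Y}_1,a),\dots,\phi_{\rm up}(\widetilde{\mathsf Y}_{i-1},a)),\qquad \widehat{\mathsf Y}_i=\text{last-scale part of }\mathsf{FFN}_i(\mathsf{Attn}_i(\mathsf Z_i)),$$ $$\mathsf F_i=t_i\widehat{\mathsf Y}_i+(1-t_i)\mathsf F_i^0,\qquad (\alpha_1,\alpha_2,\beta_1,\beta_2,\gamma_1,\gamma_2)=\mathsf{MLP}_i(\widehat{\mathsf Y}_i+t_i\mathbf 1,d,6d),$$ $$\mathsf F_i'=\mathsf{Attn}'_i(\gamma_1\circ\mathsf{LN}(\mathsf F_i)+\beta_1)\circ\alpha_1,\qquad \widetilde{\mathsf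 Y}_i=\mathsf{MLP}_i'(\gamma_2\circ\mathsf{LN}(\mathsf F_i')+\beta_2,d,d)\circ\alpha_2 .$$ The output is $\widetilde{\mathsf Y}_K\in\mathbb R^{n\times n\times d}$. The *fast FlowAR* architecture with tolerance $\delta$ is the same with every attention layer replaced by an $\mathsf{AAttC}$ layer with tolerance $\delta$. *Assumptions.* For a real number $R$ and an exponent $q\in\mathbb N$, call a model together with its input *admissible* if (i) all weights, biases and entries of $\mathsf Z_{\rm init}$ are bounded by $R$ in absolute value; (ii) in the exact run, all entries of the score matrices $S$ of all attention layers are bounded by $R^2$ in absolute value; (iii) layer normalization propagates errors at most polynomially: for each input $U$ of a layer normalization in the exact run ($U=\mathsf F_i$ and $U=\mathsf F'_i$), $\|U'-U\|_\infty\le\varepsilon\le n^{-q}$ implies $\|\mathsf{LN}(U')-\mathsf{LN}(U)\|_\infty\le n^{q}\varepsilon$. *Machine.* Algorithms are programs of a real random access machine (arrays of naturals and of reals; $+,-,\cdot,/,\sqrt{\ }$ and comparison on reals at unit cost; operations on naturals charged by bit length; no conversion from reals to naturals; no exponential). The input consists of $n$, $d$, $R$, the weights, biases, kernel values $W(-1),W(0),W(1),W(2)$,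 $\mathsf Z_{\rm init}$, the $\mathsf F_i^0$ and the $t_i$. *Statement.* For all constants $K,a\ge1$ and $p,q\in\mathbb N$ there is an algorithm such that, whenever $d=d(n)=O(\log n)$ and $R=R(n)=o(\sqrt{\log n})$, there is a sequence $\tau(n)\to0$ for which the following holds for all sufficiently large $n$ with $a^{K-1}\mid n$ and for all admissible models and inputs: the algorithm runs in at most $n^{2+\tau(n)}$ steps, and its output $\widetilde{\mathsf Y}'_K$ is an output of the fast FlowAR architecture with tolerance $n^{-p}$ and satisfies $$\|\widetilde{\mathsf Y}'_K-\widetilde{\mathsf Y}_K\|_\infty\le n^{-p}.$$ -/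

import Mathlib

open Filter Topology Asymptotics

namespace FlowAR

/-! ## The layers

A tensor `X ∈ ℝ^{h × w × c}` is used in its flattened form: a matrix whose rows (tokens) are
indexed by a finite type `ι` (for example `Fin h × Fin w`) and whose columns are the channels. -/

section Layers

variable {ι : Type*} {c : ℕ}

/-- Query, key and value projections of an attention layer. -/
structure AttnWeights (c : ℕ) where
  WQ : Matrix (Fin c) (Fin c) ℝ
  WK : Matrix (Fin c) (Fin c) ℝ
  WV : Matrix (Fin c) (Fin c) ℝ

/-- The score matrix `X W_Q W_Kᵀ Xᵀ` of an attention layer. -/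
def scores (W : AttnWeights c) (X : Matrix ι (Fin c) ℝ) : Matrix ι ι ℝ :=
  X * W.WQ * W.WK.transpose * X.transpose

/-- The attention matrix `A`, the entrywise exponential of the scores. -/
noncomputable def attnMatrix (W : AttnWeights c) (X : Matrix ι (Fin c) ℝ) : Matrix ι ι ℝ :=
  fun i j => Real.exp (scores W X i j)

/-- The attention layer `D⁻¹ A X W_V` with `D = diag(A 1)`. -/
noncomputable def attn [Fintype ι] [DecidableEq ι] (W : AttnWeights c)
    (X : Matrix ι (Fin c) ℝ) : Matrix ι (Fin c) ℝ :=
  Matrix.diagonal (fun i => (∑ j, attnMatrix W X i j)⁻¹) * attnMatrix W X * X * W.WV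

/-- The layer `A` is an approximate attention computation for `attn W` with tolerance `δ`:
on every input its output is within `δ` of the attention output in the maximum norm. -/
def IsAAttC [Fintype ι] [DecidableEq ι] (W : AttnWeights c) (δ : ℝ)
    (A : Matrix ι (Fin c) ℝ → Matrix ι (Fin c) ℝ) : Prop :=
  ∀ X i l, |A X i l - attn W X i l| ≤ δ

/-- The MLP layer: the affine map `X_{j,*} ↦ X_{j,*} W + b` on every token. -/
def mlp {κ : Type*} (W : Matrix (Fin c) κ ℝ) (b : κ → ℝ) (X : Matrix ι (Fin c) ℝ) :
    Matrix ι κ ℝ :=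
  fun j k => (X * W) j k + b k

/-- The feed-forward layer `X_{j,*} ↦ X_{j,*} + ReLU(X_{j,*} W₁ + b₁) W₂ + b₂`. -/
noncomputable def ffn (W₁ : Matrix (Fin c) (Fin c) ℝ) (b₁ : Fin c → ℝ)
    (W₂ : Matrix (Fin c) (Fin c) ℝ) (b₂ : Fin c → ℝ) (X : Matrix ι (Fin c) ℝ) :
    Matrix ι (Fin c) ℝ :=
  fun j l => X j l + mlp W₂ b₂ (fun s k => max 0 (mlp W₁ b₁ X s k)) j l

/-- Mean of the channels of token `j`. -/
noncomputable def rowMean (X : Matrix ι (Fin c) ℝ) (j : ι) : ℝ :=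
  (∑ k, X j k) / c

/-- Variance of the channels of token `j`. -/
noncomputable def rowVar (X : Matrix ι (Fin c) ℝ) (j : ι) : ℝ :=
  (∑ k, (X j k - rowMean X j) ^ 2) / c

/-- Layer normalization. -/
noncomputable def layerNorm (X : Matrix ι (Fin c) ℝ) : Matrix ι (Fin c) ℝ :=
  fun j l => (X j l - rowMean X j) / Real.sqrt (rowVar X j)

/-- Layer normalization propagates errors in a controlled way at `U`: a perturbation of `U` of
size `ε ≤ η` changes its layer normalization by at most `L * ε` (maximum norm). -/
def LNStable (L η : ℝ) (U : Matrix ι (Fin c) ℝ) : Prop :=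
  ∀ (U' : Matrix ι (Fin c) ℝ) (ε : ℝ), ε ≤ η → (∀ j l, |U' j l - U j l| ≤ ε) →
    ∀ j l, |layerNorm U' j l - layerNorm U j l| ≤ L * ε

/-- Square token maps of side `m` with `c` channels. -/
abbrev Grid (m c : ℕ) := Matrix (Fin m × Fin m) (Fin c) ℝ

/-- The entry of `X` at the (1-based, integer) position `(i, j)`; positions outside the grid are
replaced by the nearest position of the grid. -/
def readClamped {m : ℕ} (X : Grid m c) (i j : ℤ) (l : Fin c) : ℝ :=
  let i₀ := (max 1 (min (m : ℤ) i) - 1).toNat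
  let j₀ := (max 1 (min (m : ℤ) j) - 1).toNat
  if h : i₀ < m ∧ j₀ < m then X (⟨i₀, h.1⟩, ⟨j₀, h.2⟩) l else 0

/-- Bicubic upsampling by the factor `r` with kernel `W`. The output position with 1-based
coordinates `(i, j)` gets `∑_{s,t = -1}^{2} W(s) W(t) X_{⌊i/r⌋+s, ⌊j/r⌋+t}`. The side `m'` of the
output is `r * m` wherever this is used. -/
noncomputable def upsample (W : ℝ → unitInterval) (r : ℕ) {m m' : ℕ} (X : Grid m c) :
    Grid m' c :=
  fun p l => ∑ s ∈ Finset.Icc (-1 : ℤ) 2, ∑ t ∈ Finset.Icc (-1 : ℤ) 2,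
    (W (s : ℝ) : ℝ) * (W (t : ℝ) : ℝ) *
      readClamped X ((((p.1 : ℕ) + 1) / r : ℕ) + s) ((((p.2 : ℕ) + 1) / r : ℕ) + t) l

end Layers

/-! ## The FlowAR inference architecture

There are `K` scales, numbered `0, …, K - 1`. Families indexed by the scale are functions on `ℕ`
of which only the values at `0, …, K - 1` are used. -/

/-- The side `n / r_i` of the token map of scale `i`, where `r_i = a ^ (K - 1 - i)`. -/
def side (n a K i : ℕ) : ℕ := n / a ^ (K - 1 - i)

/-- The tokens of the sequence processed by the transformer at scale `i`: all the positions of the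
token maps of the scales `0, …, i`. -/
abbrev SeqIdx (n a K i : ℕ) :=
  Σ j : Fin (i + 1), Fin (side n a K j) × Fin (side n a K j)

/-- The weights used at one scale: attention and feed-forward layer of the transformer, attention
layer and the two MLP layers (`c → 6c` and `c → c`) of the flow-matching layer. -/
structure ScaleParams (c : ℕ) where
  ar : AttnWeights c
  W₁ : Matrix (Fin c) (Fin c) ℝ
  b₁ : Fin c → ℝ
  W₂ : Matrix (Fin c) (Fin c) ℝ
  b₂ : Fin c → ℝ
  fm : AttnWeights c
  modW : Matrix (Fin c) (Fin 6 × Fin c) ℝ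
  modB : Fin 6 × Fin c → ℝ
  outW : Matrix (Fin c) (Fin c) ℝ
  outB : Fin c → ℝ

/-- A FlowAR model: the upsampling kernel and the weights of every scale. -/
structure Model (c : ℕ) where
  kernel : ℝ → unitInterval
  scale : ℕ → ScaleParams c

/-- What inference starts from: initial token map, noise tensors, time steps. -/
structure Input (n a K c : ℕ) where
  zInit : Grid (side n a K 0) c
  noise : (i : ℕ) → Grid (side n a K i) c
  time : ℕ → unitInterval

/-- The layers that take the place of attention in the transformer (`ar`) and in the
flow-matching layer (`fm`) of every scale. -/
structure AttnLayers (n a K c : ℕ) where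
  ar : (i : ℕ) → Matrix (SeqIdx n a K i) (Fin c) ℝ → Matrix (SeqIdx n a K i) (Fin c) ℝ
  fm : (i : ℕ) → Grid (side n a K i) c → Grid (side n a K i) c

section Pipeline

variable {n a K c : ℕ}

/-- The exact attention layers of a model. -/
noncomputable def exactLayers (n a K : ℕ) {c : ℕ} (M : Model c) : AttnLayers n a K c where
  ar i := attn (M.scale i).ar
  fm i := attn (M.scale i).fm

/-- Approximate attention layers for a model: every attention layer is replaced by an approximate
attention computation with tolerance `δ`. -/
def IsApproxLayers (K : ℕ) (M : Model c) (δ : ℝ) (A : AttnLayers n a K c) : Prop :=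
  ∀ i < K, IsAAttC (M.scale i).ar δ (A.ar i) ∧ IsAAttC (M.scale i).fm δ (A.fm i)

/-- `Concat(Z_init, up(Y 0), …, up(Y (i - 1)))`, where `Y j` is the output of scale `j`. -/
noncomputable def concat (M : Model c) (I : Input n a K c) (i : ℕ)
    (Y : (j : ℕ) → j < i → Grid (side n a K j) c) : Matrix (SeqIdx n a K i) (Fin c) ℝ
  | ⟨⟨0, _⟩, p⟩ => I.zInit p
  | ⟨⟨j + 1, h⟩, p⟩ => upsample M.kernel a (Y j (Nat.lt_of_succ_lt_succ h)) p

/-- The transformer block at scale `i`, of whose output the part of the last scale is kept. -/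
noncomputable def transformer (M : Model c) (A : AttnLayers n a K c) (i : ℕ)
    (Z : Matrix (SeqIdx n a K i) (Fin c) ℝ) : Grid (side n a K i) c :=
  fun p => ffn (M.scale i).W₁ (M.scale i).b₁ (M.scale i).W₂ (M.scale i).b₂ (A.ar i Z)
    ⟨Fin.last i, p⟩

/-- The interpolation `F_i^t = t Ŷ_i + (1 - t) F_i^0` at the time step of scale `i`. -/
def interpolate (I : Input n a K c) (i : ℕ) (Yhat : Grid (side n a K i) c) :
    Grid (side n a K i) c :=
  fun p l => (I.time i : ℝ) * Yhat p l + (1 - (I.time i : ℝ)) * I.noise i p l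

/-- The time-conditioned parameters `α₁, α₂, β₁, β₂, γ₁, γ₂` of the flow-matching layer, for
`b = 0, 1, 2, 3, 4, 5` in this order. -/
def modulation (M : Model c) (I : Input n a K c) (i : ℕ) (Yhat : Grid (side n a K i) c)
    (b : Fin 6) : Grid (side n a K i) c :=
  fun p l => mlp (M.scale i).modW (M.scale i).modB (fun s k => Yhat s k + (I.time i : ℝ)) p (b, l)

/-- The input `γ₁ ∘ LN(F) + β₁` of the attention layer inside the flow-matching layer. -/
noncomputable def flowAttnIn (M : Model c) (I : Input n a K c) (i : ℕ)
    (Yhat F : Grid (side n a K i) c) : Grid (side n a K i) c :=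
  fun p l => modulation M I i Yhat 4 p l * layerNorm F p l + modulation M I i Yhat 2 p l

/-- The intermediate variable `F' = Attn(γ₁ ∘ LN(F) + β₁) ∘ α₁` of the flow-matching layer. -/
noncomputable def flowMid (M : Model c) (I : Input n a K c) (A : AttnLayers n a K c) (i : ℕ)
    (Yhat F : Grid (side n a K i) c) : Grid (side n a K i) c :=
  fun p l => A.fm i (flowAttnIn M I i Yhat F) p l * modulation M I i Yhat 0 p l

/-- The flow-matching layer, with output `F'' = MLP(γ₂ ∘ LN(F') + β₂) ∘ α₂`. -/
noncomputable def flowMatch (M : Model c) (I : Input n a K c) (A : AttnLayers n a K c) (i : ℕ)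
    (Yhat F : Grid (side n a K i) c) : Grid (side n a K i) c :=
  fun p l => mlp (M.scale i).outW (M.scale i).outB
      (fun s k => modulation M I i Yhat 5 s k * layerNorm (flowMid M I A i Yhat F) s k
        + modulation M I i Yhat 3 s k) p l
    * modulation M I i Yhat 1 p l

/-- The output `Ỹ_i` of scale `i`, computed from the outputs of the previous scales. -/
noncomputable def scaleOut (M : Model c) (I : Input n a K c) (A : AttnLayers n a K c) (i : ℕ)
    (Y : (j : ℕ) → j < i → Grid (side n a K j) c) : Grid (side n a K i) c :=
  flowMatch M I A i (transformer M A i (concat M I i Y))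
    (interpolate I i (transformer M A i (concat M I i Y)))

/-- The token maps `Ỹ_0, Ỹ_1, …` of the inference pipeline that uses the layers `A` for
attention. -/
noncomputable def yTilde (M : Model c) (I : Input n a K c) (A : AttnLayers n a K c) (i : ℕ) :
    Grid (side n a K i) c :=
  scaleOut M I A i (fun j _ => yTilde M I A j)
termination_by i

/-- The sequence `Z_i` that enters the transformer at scale `i`. -/
noncomputable def zSeq (M : Model c) (I : Input n a K c) (A : AttnLayers n a K c) (i : ℕ) :
    Matrix (SeqIdx n a K i) (Fin c) ℝ :=
  concat M I i (fun j _ => yTilde M I A j)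

/-- The transformer output `Ŷ_i` of scale `i`. -/
noncomputable def yHat (M : Model c) (I : Input n a K c) (A : AttnLayers n a K c) (i : ℕ) :
    Grid (side n a K i) c :=
  transformer M A i (zSeq M I A i)

/-- The output `Ỹ_{K-1}` (last scale) of the pipeline that uses the layers `A` for attention. -/
noncomputable def output (M : Model c) (I : Input n a K c) (A : AttnLayers n a K c) :
    Grid (side n a K (K - 1)) c :=
  yTilde M I A (K - 1)

/-- The output of the FlowAR model (exact attention). -/
noncomputable def flowAR (M : Model c) (I : Input n a K c) : Grid (side n a K (K - 1)) c :=
  output M I (exactLayers n a K M)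

/-- All entries of a weight matrix are bounded by `R`. -/
def EntriesLE {ι κ : Type*} (X : Matrix ι κ ℝ) (R : ℝ) : Prop := ∀ i j, |X i j| ≤ R

/-- All weight matrices and biases of a scale have entries bounded by `R`. -/
structure ScaleParams.BoundedBy (S : ScaleParams c) (R : ℝ) : Prop where
  arQ : EntriesLE S.ar.WQ R
  arK : EntriesLE S.ar.WK R
  arV : EntriesLE S.ar.WV R
  W₁ : EntriesLE S.W₁ R
  b₁ : ∀ l, |S.b₁ l| ≤ R
  W₂ : EntriesLE S.W₂ R
  b₂ : ∀ l, |S.b₂ l| ≤ R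
  fmQ : EntriesLE S.fm.WQ R
  fmK : EntriesLE S.fm.WK R
  fmV : EntriesLE S.fm.WV R
  modW : EntriesLE S.modW R
  modB : ∀ l, |S.modB l| ≤ R
  outW : EntriesLE S.outW R
  outB : ∀ l, |S.outB l| ≤ R

/-- The standing assumptions on a model and its input, with entry bound `R` and error propagation
factor `L` of the layer normalizations: weights, biases and initial token map are bounded by `R`;
in the exact FlowAR run, the scores of every attention layer are bounded by `R ^ 2`, and a
perturbation of size `ε ≤ 1 / L` of the input of a layer normalization changes its output by
at most `L * ε`. The noise tensors are arbitrary. -/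
structure Admissible (M : Model c) (I : Input n a K c) (R L : ℝ) : Prop where
  weights : ∀ i < K, (M.scale i).BoundedBy R
  init : EntriesLE I.zInit R
  scores_ar : ∀ i < K,
    EntriesLE (scores (M.scale i).ar (zSeq M I (exactLayers n a K M) i)) (R ^ 2)
  scores_fm : ∀ i < K,
    EntriesLE (scores (M.scale i).fm (flowAttnIn M I i (yHat M I (exactLayers n a K M) i)
      (interpolate I i (yHat M I (exactLayers n a K M) i)))) (R ^ 2)
  ln_in : ∀ i < K, LNStable L (1 / L) (interpolate I i (yHat M I (exactLayers n a K M) i))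
  ln_mid : ∀ i < K, LNStable L (1 / L) (flowMid M I (exactLayers n a K M) i
    (yHat M I (exactLayers n a K M) i) (interpolate I i (yHat M I (exactLayers n a K M) i)))

end Pipeline

/-! ## The machine model

Programs of a real random access machine. Memory consists of arrays of natural numbers and arrays
of real numbers; a program mentions finitely many arrays. The operations on reals are
`+, -, *, /, √` and comparison, at unit cost; there is no conversion from reals to naturals.
Operations on naturals are charged their bit length (logarithmic cost). All loops are counting
loops, so every program halts. -/

/-- The weight matrices and biases of one scale, as names of input arrays. -/
inductive WName
  | arQ | arK | arV | W₁ | b₁ | W₂ | b₂ | fmQ | fmK | fmV | modW | modB | outW | outB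
  deriving DecidableEq

/-- Names of arrays of natural numbers: the dimensions `n` and `c`, and working arrays. -/
inductive NName
  | dimN | dimC
  | tmp (k : ℕ)
  deriving DecidableEq

/-- Names of arrays of real numbers: the input arrays, the output array, and working arrays. -/
inductive RName
  | bound | kernel | zInit | time
  | noise (i : ℕ)
  | weight (i : ℕ) (w : WName)
  | out
  | tmp (k : ℕ)
  deriving DecidableEq

/-- Memory contents. -/
structure Mem where
  nat : NName → ℕ → ℕ
  real : RName → ℕ → ℝ

/-- Write a natural number. -/
def Mem.setNat (s : Mem) (x : NName) (k v : ℕ) : Mem :=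
  { s with nat := Function.update s.nat x (Function.update (s.nat x) k v) }

/-- Write a real number. -/
def Mem.setReal (s : Mem) (x : RName) (k : ℕ) (v : ℝ) : Mem :=
  { s with real := Function.update s.real x (Function.update (s.real x) k v) }

/-- Expressions for natural numbers (`sub` is truncated, `div` is the integer quotient). -/
inductive NExp
  | const (k : ℕ)
  | get (x : NName) (e : NExp)
  | add (e f : NExp)
  | sub (e f : NExp)
  | mul (e f : NExp)
  | div (e f : NExp)

def NExp.eval (s : Mem) : NExp → ℕ
  | const k => k
  | get x e => s.nat x (e.eval s)
  | add e f => e.eval s + f.eval s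
  | sub e f => e.eval s - f.eval s
  | mul e f => e.eval s * f.eval s
  | div e f => e.eval s / f.eval s

/-- Every operation costs one plus the bit length of its result. -/
def NExp.cost (s : Mem) : NExp → ℕ
  | const k => 1 + Nat.size k
  | get x e => e.cost s + (1 + Nat.size ((get x e).eval s))
  | add e f => e.cost s + f.cost s + (1 + Nat.size ((add e f).eval s))
  | sub e f => e.cost s + f.cost s + (1 + Nat.size ((sub e f).eval s))
  | mul e f => e.cost s + f.cost s + (1 + Nat.size ((mul e f).eval s))
  | div e f => e.cost s + f.cost s + (1 + Nat.size ((div e f).eval s))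

/-- Expressions for real numbers; `ofNat` reads a natural number as a real number. -/
inductive RExp
  | ofNat (e : NExp)
  | get (x : RName) (e : NExp)
  | add (e f : RExp)
  | sub (e f : RExp)
  | mul (e f : RExp)
  | div (e f : RExp)
  | sqrt (e : RExp)

noncomputable def RExp.eval (s : Mem) : RExp → ℝ
  | ofNat e => (e.eval s : ℝ)
  | get x e => s.real x (e.eval s)
  | add e f => e.eval s + f.eval s
  | sub e f => e.eval s - f.eval s
  | mul e f => e.eval s * f.eval s
  | div e f => e.eval s / f.eval s
  | sqrt e => Real.sqrt (e.eval s)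

def RExp.cost (s : Mem) : RExp → ℕ
  | ofNat e => e.cost s + 1
  | get _ e => e.cost s + 1
  | add e f => e.cost s + f.cost s + 1
  | sub e f => e.cost s + f.cost s + 1
  | mul e f => e.cost s + f.cost s + 1
  | div e f => e.cost s + f.cost s + 1
  | sqrt e => e.cost s + 1

/-- Programs. `loop x e p` evaluates `e` once, to `v` say, and runs `p` for the values
`0, …, v - 1` of the entry `0` of `x`. -/
inductive Prog
  | skip
  | setNat (x : NName) (k : NExp) (e : NExp)
  | setReal (x : RName) (k : NExp) (e : RExp)
  | seq (p q : Prog)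
  | ifNat (e f : NExp) (p q : Prog)
  | ifReal (e f : RExp) (p q : Prog)
  | loop (x : NName) (e : NExp) (p : Prog)

open Classical in
/-- Execution: the memory after the run and the number of steps. `ifNat e f` and `ifReal e f`
test whether `e ≤ f`. -/
noncomputable def Prog.exec : Prog → Mem → Mem × ℕ
  | skip, s => (s, 1)
  | setNat x k e, s => (s.setNat x (k.eval s) (e.eval s), k.cost s + e.cost s + 1)
  | setReal x k e, s => (s.setReal x (k.eval s) (e.eval s), k.cost s + e.cost s + 1)
  | seq p q, s => ((q.exec (p.exec s).1).1, (p.exec s).2 + (q.exec (p.exec s).1).2)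
  | ifNat e f p q, s =>
      let r := if e.eval s ≤ f.eval s then p.exec s else q.exec s
      (r.1, e.cost s + f.cost s + 1 + r.2)
  | ifReal e f p q, s =>
      let r := if e.eval s ≤ f.eval s then p.exec s else q.exec s
      (r.1, e.cost s + f.cost s + 1 + r.2)
  | loop x e p, s =>
      (List.range (e.eval s)).foldl
        (fun t k =>
          let r := p.exec (t.1.setNat x 0 k)
          (r.1, t.2 + (1 + Nat.size k) + r.2))
        (s, e.cost s + 1)

/-- The array `A` holds the square token map `X`, in row-major order. -/
def HoldsGrid {m c : ℕ} (A : ℕ → ℝ) (X : Grid m c) : Prop :=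
  ∀ (x y : Fin m) (l : Fin c), A (((x : ℕ) * m + y) * c + l) = X (x, y) l

/-- The array `A` holds the `c × c` matrix `X`, in row-major order. -/
def HoldsMat {c : ℕ} (A : ℕ → ℝ) (X : Matrix (Fin c) (Fin c) ℝ) : Prop :=
  ∀ i j : Fin c, A ((i : ℕ) * c + j) = X i j

/-- The array `A` holds the vector `v`. -/
def HoldsVec {c : ℕ} (A : ℕ → ℝ) (v : Fin c → ℝ) : Prop :=
  ∀ i : Fin c, A i = v i

/-- The arrays `A` hold the weights of one scale. -/
structure HoldsScale {c : ℕ} (A : WName → ℕ → ℝ) (S : ScaleParams c) : Prop where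
  arQ : HoldsMat (A .arQ) S.ar.WQ
  arK : HoldsMat (A .arK) S.ar.WK
  arV : HoldsMat (A .arV) S.ar.WV
  W₁ : HoldsMat (A .W₁) S.W₁
  b₁ : HoldsVec (A .b₁) S.b₁
  W₂ : HoldsMat (A .W₂) S.W₂
  b₂ : HoldsVec (A .b₂) S.b₂
  fmQ : HoldsMat (A .fmQ) S.fm.WQ
  fmK : HoldsMat (A .fmK) S.fm.WK
  fmV : HoldsMat (A .fmV) S.fm.WV
  modW : ∀ (i : Fin c) (b : Fin 6) (l : Fin c),
    A .modW ((i : ℕ) * (6 * c) + ((b : ℕ) * c + l)) = S.modW i (b, l)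
  modB : ∀ (b : Fin 6) (l : Fin c), A .modB ((b : ℕ) * c + l) = S.modB (b, l)
  outW : HoldsMat (A .outW) S.outW
  outB : HoldsVec (A .outB) S.outB

/-- The memory `s` holds the problem instance: the dimensions `n` and `c`, the bound `R`, the model
and its input. The rest of the memory is arbitrary. -/
structure Loaded {n a K c : ℕ} (s : Mem) (R : ℝ) (M : Model c) (I : Input n a K c) : Prop where
  dimN : s.nat .dimN 0 = n
  dimC : s.nat .dimC 0 = c
  bound : s.real .bound 0 = R
  kernel : ∀ k < 4, s.real .kernel k = M.kernel ((k : ℝ) - 1)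
  zInit : HoldsGrid (s.real .zInit) I.zInit
  time : ∀ i < K, s.real .time i = I.time i
  noise : ∀ i < K, HoldsGrid (s.real (.noise i)) (I.noise i)
  weights : ∀ i < K, HoldsScale (fun w => s.real (.weight i w)) (M.scale i)

/-- The token map found in the output array of the memory `s`. -/
def readOut (m c : ℕ) (s : Mem) : Grid m c :=
  fun p l => s.real .out (((p.1 : ℕ) * m + p.2) * c + l)

end FlowAR

/-!
The algorithm runs the pipeline with *polynomial attention*: every `exp` is replaced by its Taylor
polynomial of degree `g`, and everything else is computed exactly.

**Speed.** The Taylor polynomial of an inner product of two vectors with `c` entries is an inner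
product of vectors of monomials of degree at most `g` (`sum_feat_mul_feat`). The attention output of
a token therefore depends on the keys and values of all tokens only through their moments, `c + 1`
for each monomial, and no matrix of scores is ever formed. By the generating function
`(1 - x)^{-c}` the number of monomials is at most `x^{-g} (1 - x)^{-c}` for all `0 < x < 1`
(`length_table_le`), which is `n ^ o(1)` when `g = o(log n)` and `c = O(log n)` (`subPoly_length`).
The other layers cost `n ^ 2` times a polynomial in `c` and the bit length of `n`. The monomials are
enumerated by the program itself: every monomial is stored as a pointer to a previous one and a
variable (`table`, `tableProg`). The degree is the least `g` with
`(R ^ 2 + 1) ^ g / g! ≤ n ^ (-P)`, found by a search (`degProg`); it is `o(log n)` because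
`R ^ 2 = o(log n)` (`eventually_degOK`).

**Correctness of the program.** A run of the program computes *exactly* the pipeline with
polynomial attention, whatever the input (`pipelineProg_spec`). All its steps are tabulations
`A[i, j] := e₀ + ∑ₖ e` (`tab`), for which correctness and cost are proved once (`tab_runs`).

**Precision.** Where the scores are at most `B = R ^ 2 + 1`, the Taylor polynomial has relative
error at most `e^{2B} B ^ g / g! ≤ n ^ (2 - P)`, so polynomial attention is as close to attention as
desired (`isAAttC_guardedAttn`). It is not so on all inputs; but the *guarded* layers, which resort
to exact attention where a score or an entry is too large, are approximate attention layers in the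
sense of the fast architecture. In a run with such layers each operation multiplies errors by at
most a fixed power of `n`: for the layer normalizations this is assumed, for the others it is a
perturbation estimate (`exists_runBounds`). Hence the run stays so close to the exact one that its
scores exceed `R ^ 2` by at most `1`; the guards never fire, and the run coincides with the one with
polynomial attention (`exists_precision`).
-/

namespace FlowAR

/-! ### Cost of expressions and loops -/

/-- Number of nodes of an expression. -/
def NExp.nodes : NExp → ℕ
  | const _ => 1
  | get _ e => e.nodes + 1
  | add e f => e.nodes + f.nodes + 1
  | sub e f => e.nodes + f.nodes + 1
  | mul e f => e.nodes + f.nodes + 1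
  | div e f => e.nodes + f.nodes + 1

/-- All constants and all memory cells that occur in the evaluation are at most `V`. Then every
intermediate value is at most `V ^ nodes`, so the bit lengths are under control. -/
def NExp.Ok (V : ℕ) (s : Mem) : NExp → Prop
  | const k => k ≤ V
  | get x e => e.Ok V s ∧ s.nat x (e.eval s) ≤ V
  | add e f => e.Ok V s ∧ f.Ok V s
  | sub e f => e.Ok V s ∧ f.Ok V s
  | mul e f => e.Ok V s ∧ f.Ok V s
  | div e f => e.Ok V s ∧ f.Ok V s

theorem NExp.nodes_pos (e : NExp) : 1 ≤ e.nodes := by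
  cases e <;> simp [nodes]

theorem NExp.eval_le {V : ℕ} (hV : 2 ≤ V) {s : Mem} {e : NExp} (h : e.Ok V s) :
    e.eval s ≤ V ^ e.nodes := by
  have mono : ∀ {a b x : ℕ}, x ≤ V ^ a → a ≤ b → x ≤ V ^ b := fun h1 h2 =>
    h1.trans (Nat.pow_le_pow_right (by omega) h2)
  induction e with
  | const k => simpa [nodes, eval, Ok] using h
  | get x e ih =>
    exact (h.2.trans (by simp)).trans (Nat.pow_le_pow_right (by omega) (Nat.le_add_left 1 e.nodes))
  | add e f ihe ihf =>
    have h1 := mono (ihe h.1) (Nat.le_add_right e.nodes f.nodes)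
    have h2 := mono (ihf h.2) (Nat.le_add_left f.nodes e.nodes)
    simp only [eval, nodes, pow_succ]
    nlinarith
  | sub e f ihe ihf =>
    exact (Nat.sub_le _ _).trans (mono (ihe h.1) (by simp only [nodes]; omega))
  | mul e f ihe ihf =>
    simp only [eval, nodes]
    refine mono (a := e.nodes + f.nodes) ?_ (by omega)
    rw [pow_add]
    exact Nat.mul_le_mul (ihe h.1) (ihf h.2)
  | div e f ihe ihf =>
    exact (Nat.div_le_self _ _).trans (mono (ihe h.1) (by simp only [nodes]; omega))

theorem size_pow_le (V k : ℕ) (hk : 1 ≤ k) : Nat.size (V ^ k) ≤ k * Nat.size V := by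
  rw [Nat.size_le, mul_comm, pow_mul]
  exact Nat.pow_lt_pow_left (Nat.lt_size_self V) (by omega)

theorem NExp.size_eval_le {V : ℕ} (hV : 2 ≤ V) {s : Mem} {e : NExp} (h : e.Ok V s) :
    Nat.size (e.eval s) ≤ e.nodes * Nat.size V :=
  (Nat.size_le_size (eval_le hV h)).trans (size_pow_le V _ e.nodes_pos)

/-- The weight of an expression: a bound for its cost in units of the bit length of `V`, whenever
all constants and cells are at most `V`. -/
def NExp.wt (e : NExp) : ℕ := e.nodes * (1 + e.nodes)

theorem one_le_size {V : ℕ} (hV : 2 ≤ V) : 1 ≤ Nat.size V :=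
  Nat.size_pos.2 (by omega)

theorem NExp.cost_le {V : ℕ} (hV : 2 ≤ V) {s : Mem} {e : NExp} (h : e.Ok V s) :
    e.cost s ≤ e.wt * Nat.size V := by
  have hS := one_le_size hV
  have key : e.cost s ≤ e.nodes * (1 + e.nodes * Nat.size V) := by
    have bin : ∀ (a b A B C : ℕ), A ≤ a * (1 + a * Nat.size V) → B ≤ b * (1 + b * Nat.size V) →
        C ≤ (a + b + 1) * Nat.size V →
        A + B + (1 + C) ≤ (a + b + 1) * (1 + (a + b + 1) * Nat.size V) := by
      intro a b A B C h1 h2 h3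
      have e1 : a * (1 + a * Nat.size V) ≤ a * (1 + (a + b + 1) * Nat.size V) := by
        gcongr; omega
      have e2 : b * (1 + b * Nat.size V) ≤ b * (1 + (a + b + 1) * Nat.size V) := by
        gcongr; omega
      linarith [e1, e2, add_mul (a + b) 1 (1 + (a + b + 1) * Nat.size V),
        add_mul a b (1 + (a + b + 1) * Nat.size V)]
    induction e with
    | const k =>
      have := Nat.size_le_size (show k ≤ V from h)
      simp only [cost, nodes]; omega
    | get x e ih =>
      have h3 := size_eval_le hV h
      have := bin e.nodes 0 (e.cost s) 0 _ (ih h.1) (by simp) (by simpa [nodes] using h3)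
      simpa [cost, nodes] using this
    | add e f ihe ihf => exact bin _ _ _ _ _ (ihe h.1) (ihf h.2) (size_eval_le hV h)
    | sub e f ihe ihf => exact bin _ _ _ _ _ (ihe h.1) (ihf h.2) (size_eval_le hV h)
    | mul e f ihe ihf => exact bin _ _ _ _ _ (ihe h.1) (ihf h.2) (size_eval_le hV h)
    | div e f ihe ihf => exact bin _ _ _ _ _ (ihe h.1) (ihf h.2) (size_eval_le hV h)
  refine key.trans ?_
  rw [wt, mul_assoc]
  gcongr
  nlinarith

/-- All constants and all memory cells of naturals that occur in the evaluation are at most `V`. -/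
def RExp.Ok (V : ℕ) (s : Mem) : RExp → Prop
  | ofNat e => e.Ok V s
  | get _ e => e.Ok V s
  | add e f => e.Ok V s ∧ f.Ok V s
  | sub e f => e.Ok V s ∧ f.Ok V s
  | mul e f => e.Ok V s ∧ f.Ok V s
  | div e f => e.Ok V s ∧ f.Ok V s
  | sqrt e => e.Ok V s

/-- The weight of an expression: a bound for its cost in units of the bit length of `V`. -/
def RExp.wt : RExp → ℕ
  | ofNat e => e.wt + 1
  | get _ e => e.wt + 1
  | add e f => e.wt + f.wt + 1
  | sub e f => e.wt + f.wt + 1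
  | mul e f => e.wt + f.wt + 1
  | div e f => e.wt + f.wt + 1
  | sqrt e => e.wt + 1

theorem RExp.cost_le {V : ℕ} (hV : 2 ≤ V) {s : Mem} {e : RExp} (h : e.Ok V s) :
    e.cost s ≤ e.wt * Nat.size V := by
  have hS := one_le_size hV
  induction e with
  | ofNat e => have := NExp.cost_le hV (show e.Ok V s from h); simp only [cost, wt]; nlinarith
  | get x e => have := NExp.cost_le hV (show e.Ok V s from h); simp only [cost, wt]; nlinarith
  | add e f ihe ihf => have := ihe h.1; have := ihf h.2; simp only [cost, wt]; nlinarith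
  | sub e f ihe ihf => have := ihe h.1; have := ihf h.2; simp only [cost, wt]; nlinarith
  | mul e f ihe ihf => have := ihe h.1; have := ihf h.2; simp only [cost, wt]; nlinarith
  | div e f ihe ihf => have := ihe h.1; have := ihf h.2; simp only [cost, wt]; nlinarith
  | sqrt e ih => have := ih h; simp only [cost, wt]; nlinarith

/-- The weight of a program: a bound for its cost, in units of the bit length of `V`, if every loop
made one round. The numbers of rounds enter through the factor `D` of the cost bounds below. -/
def Prog.wt : Prog → ℕ
  | skip => 1
  | setNat _ k e => k.wt + e.wt + 1
  | setReal _ k e => k.wt + e.wt + 1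
  | seq p q => p.wt + q.wt
  | ifNat e f p q => e.wt + f.wt + 1 + (p.wt + q.wt)
  | ifReal e f p q => e.wt + f.wt + 1 + (p.wt + q.wt)
  | loop _ e p => e.wt + e.nodes + 2 + p.wt

section Cost

variable {V D : ℕ} {s : Mem}

theorem cost_setNat_le (hV : 2 ≤ V) (hD : Nat.size V ≤ D) {x : NName} {k e : NExp}
    (hk : k.Ok V s) (he : e.Ok V s) :
    ((Prog.setNat x k e).exec s).2 ≤ (Prog.setNat x k e).wt * D := by
  have h1 := NExp.cost_le hV hk
  have h2 := NExp.cost_le hV he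
  have h3 : (k.wt + e.wt + 1) * Nat.size V ≤ (k.wt + e.wt + 1) * D := by gcongr
  have := one_le_size hV
  simp only [Prog.exec, Prog.wt]
  linarith [add_mul (k.wt + e.wt) 1 (Nat.size V), add_mul k.wt e.wt (Nat.size V)]

theorem cost_setReal_le (hV : 2 ≤ V) (hD : Nat.size V ≤ D) {x : RName} {k : NExp} {e : RExp}
    (hk : k.Ok V s) (he : e.Ok V s) :
    ((Prog.setReal x k e).exec s).2 ≤ (Prog.setReal x k e).wt * D := by
  have h1 := NExp.cost_le hV hk
  have h2 := RExp.cost_le hV he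
  have h3 : (k.wt + e.wt + 1) * Nat.size V ≤ (k.wt + e.wt + 1) * D := by gcongr
  have := one_le_size hV
  simp only [Prog.exec, Prog.wt]
  linarith [add_mul (k.wt + e.wt) 1 (Nat.size V), add_mul k.wt e.wt (Nat.size V)]

theorem cost_seq_le {P Q : Prog} (hP : (P.exec s).2 ≤ P.wt * D)
    (hQ : (Q.exec (P.exec s).1).2 ≤ Q.wt * D) :
    ((Prog.seq P Q).exec s).2 ≤ (Prog.seq P Q).wt * D := by
  simp only [Prog.exec, Prog.wt, add_mul]
  omega

/-- The rule for loops: an invariant that is preserved by the body holds after the loop, and the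
cost bound of the body is multiplied by the number of rounds. -/
theorem exec_loop (hV : 2 ≤ V) (hD : Nat.size V ≤ D) {x : NName} {e : NExp} {p : Prog} {v : ℕ}
    (Inv : ℕ → Mem → Prop) (he : e.Ok V s) (hv : e.eval s = v) (h0 : Inv 0 s)
    (hstep : ∀ k < v, ∀ t, Inv k t → Inv (k + 1) (p.exec (t.setNat x 0 k)).1 ∧
      (p.exec (t.setNat x 0 k)).2 ≤ p.wt * D) :
    Inv v ((Prog.loop x e p).exec s).1 ∧
      ((Prog.loop x e p).exec s).2 ≤ (Prog.loop x e p).wt * (D * (v + 1)) := by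
  have hsz := NExp.size_eval_le hV he
  have hcost := NExp.cost_le hV he
  have hS := one_le_size hV
  subst hv
  have key : ∀ u ≤ e.eval s,
      Inv u ((List.range u).foldl (fun (t : Mem × ℕ) k =>
        ((p.exec (t.1.setNat x 0 k)).1, t.2 + (1 + Nat.size k) + (p.exec (t.1.setNat x 0 k)).2))
        (s, e.cost s + 1)).1 ∧
      ((List.range u).foldl (fun (t : Mem × ℕ) k =>
        ((p.exec (t.1.setNat x 0 k)).1, t.2 + (1 + Nat.size k) + (p.exec (t.1.setNat x 0 k)).2))
        (s, e.cost s + 1)).2 ≤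
        (e.cost s + 1) + u * ((1 + e.nodes * Nat.size V) + p.wt * D) := by
    intro u
    induction u with
    | zero => intro _; simpa using h0
    | succ u ih =>
      intro hu
      obtain ⟨i1, i2⟩ := ih (by omega)
      rw [List.range_succ, List.foldl_append, List.foldl_cons, List.foldl_nil]
      obtain ⟨j1, j2⟩ := hstep u (by omega) _ i1
      refine ⟨j1, ?_⟩
      have := (Nat.size_le_size (show u ≤ e.eval s by omega)).trans hsz
      simp only
      rw [add_mul u 1]
      omega
  obtain ⟨k1, k2⟩ := key _ le_rfl
  refine ⟨k1, ?_⟩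
  rw [Prog.exec]
  refine k2.trans ?_
  simp only [Prog.wt]
  set v := e.eval s
  have e1 : e.cost s + 1 ≤ (e.wt + 1) * D := by
    have : (e.wt + 1) * Nat.size V ≤ (e.wt + 1) * D := by gcongr
    nlinarith
  have e2 : 1 + e.nodes * Nat.size V ≤ (1 + e.nodes) * D := by
    have : (1 + e.nodes) * Nat.size V ≤ (1 + e.nodes) * D := by gcongr
    nlinarith
  have e3 : v * ((1 + e.nodes * Nat.size V) + p.wt * D) ≤ v * ((1 + e.nodes) * D + p.wt * D) := by
    gcongr
  calc _ ≤ (e.wt + 1) * D + v * ((1 + e.nodes) * D + p.wt * D) := by omega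
    _ = (e.wt + 1) * (D * 1) + (1 + e.nodes + p.wt) * (D * v) := by ring
    _ ≤ (e.wt + 1) * (D * (v + 1)) + (1 + e.nodes + p.wt) * (D * (v + 1)) := by
      gcongr <;> omega
    _ = _ := by ring

end Cost

/-! ### Enumeration of the monomials of bounded degree -/

/-- An entry of a table of monomials. It describes the monomial `u * z ^ mult / mult!` by the
position `par` of the monomial `u * z ^ (mult - 1) / (mult - 1)!` in the table, the index `var` of
the variable `z`, the total degree and the multiplicity of `z`. The entry at position `0` stands
for the monomial `1` and has multiplicity `0`. -/
structure Entry where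
  par : ℕ
  var : ℕ
  deg : ℕ
  mult : ℕ

/-- The entry at position `m` of a table. -/
def entry (L : List Entry) (m : ℕ) : Entry := L.getD m ⟨0, 0, 0, 0⟩

theorem entry_append_left {L L' : List Entry} {m : ℕ} (h : m < L.length) :
    entry (L ++ L') m = entry L m := List.getD_append _ _ _ _ h

theorem entry_append_self {L : List Entry} {e : Entry} : entry (L ++ [e]) L.length = e := by
  rw [entry, List.getD_append_right _ _ _ _ le_rfl]; simp

theorem entry_of_prefix {L L' : List Entry} {m : ℕ} (h : L <+: L') (hm : m < L.length) :
    entry L' m = entry L m := by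
  obtain ⟨M, rfl⟩ := h
  exact entry_append_left hm

/-- The table `L` followed by the products of its monomial `cur`, of degree `dg`, with
`z ^ k / k!` for `k = 1, …, e`, where `z` is the variable `v`. -/
def chain (v cur dg : ℕ) (L : List Entry) (e : ℕ) : List Entry :=
  L ++ (List.range e).map fun k =>
    ⟨if k = 0 then cur else L.length + k - 1, v, dg + k + 1, k + 1⟩

/-- The table `L` followed by the products of degree at most `g` of its first monomials with the
powers of the variable `v`. -/
def extend (v g : ℕ) (L : List Entry) : ℕ → List Entry
  | 0 => L
  | m + 1 => chain v m (entry (extend v g L m) m).deg (extend v g L m)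
      (g - (entry (extend v g L m) m).deg)

/-- The monomials of degree at most `g` in the first `v` variables. -/
def table (g : ℕ) : ℕ → List Entry
  | 0 => [⟨0, 0, 0, 0⟩]
  | v + 1 => extend v g (table g v) (table g v).length

theorem chain_zero (v cur dg : ℕ) (L : List Entry) : chain v cur dg L 0 = L := by simp [chain]

theorem chain_succ (v cur dg : ℕ) (L : List Entry) (e : ℕ) :
    chain v cur dg L (e + 1) = chain v cur dg L e ++
      [⟨if e = 0 then cur else L.length + e - 1, v, dg + e + 1, e + 1⟩] := by
  simp [chain, List.range_succ]

@[simp]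
theorem length_chain (v cur dg : ℕ) (L : List Entry) (e : ℕ) :
    (chain v cur dg L e).length = L.length + e := by simp [chain]

theorem prefix_chain (v cur dg : ℕ) (L : List Entry) (e : ℕ) : L <+: chain v cur dg L e :=
  List.prefix_append _ _

theorem prefix_extend (v g : ℕ) (L : List Entry) (m : ℕ) : L <+: extend v g L m := by
  induction m with
  | zero => exact List.prefix_rfl
  | succ m ih => exact ih.trans (prefix_chain ..)

theorem length_extend_le (v g : ℕ) (L : List Entry) (m : ℕ) :
    (extend v g L m).length ≤ L.length + m * g := by
  induction m with
  | zero => simp [extend]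
  | succ m ih =>
    rw [extend, length_chain, Nat.succ_mul]
    omega

/-- The entries of `L` are as in a table of monomials of degree at most `g` in `c` variables. -/
structure GoodTable (c g : ℕ) (L : List Entry) : Prop where
  pos : 0 < L.length
  zero : entry L 0 = ⟨0, 0, 0, 0⟩
  par : ∀ m, 0 < m → m < L.length → (entry L m).par < m
  var : ∀ m, 0 < m → m < L.length → (entry L m).var < c
  deg : ∀ m, m < L.length → (entry L m).deg ≤ g

theorem GoodTable.append {c g : ℕ} {L : List Entry} (h : GoodTable c g L) {e : Entry}
    (h1 : e.par < L.length) (h2 : e.var < c) (h3 : e.deg ≤ g) : GoodTable c g (L ++ [e]) := by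
  have key : ∀ m, m < (L ++ [e]).length → m < L.length ∧ entry (L ++ [e]) m = entry L m ∨
      m = L.length ∧ entry (L ++ [e]) m = e := by
    intro m hm
    rcases lt_or_eq_of_le (Nat.lt_succ_iff.1 (by simpa using hm)) with hlt | rfl
    · exact Or.inl ⟨hlt, entry_append_left hlt⟩
    · exact Or.inr ⟨rfl, entry_append_self⟩
  refine ⟨by simp, by rw [entry_append_left h.pos, h.zero], ?_, ?_, ?_⟩
  · intro m h0 hm
    rcases key m hm with ⟨hlt, he⟩ | ⟨rfl, he⟩ <;> rw [he]
    exacts [h.par m h0 hlt, h1]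
  · intro m h0 hm
    rcases key m hm with ⟨hlt, he⟩ | ⟨rfl, he⟩ <;> rw [he]
    exacts [h.var m h0 hlt, h2]
  · intro m hm
    rcases key m hm with ⟨hlt, he⟩ | ⟨rfl, he⟩ <;> rw [he]
    exacts [h.deg m hlt, h3]

theorem GoodTable.chain {c g v cur dg : ℕ} {L : List Entry} (h : GoodTable c g L) (hv : v < c)
    (hcur : cur < L.length) {e : ℕ} (he : dg + e ≤ g) :
    GoodTable c g (chain v cur dg L e) := by
  induction e with
  | zero => simpa [chain_zero] using h
  | succ e ih =>
    rw [chain_succ]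
    refine (ih (by omega)).append ?_ hv (by simp only; omega)
    rw [length_chain]
    simp only
    split_ifs <;> omega

theorem GoodTable.mono {c c' g : ℕ} {L : List Entry} (h : GoodTable c g L) (hc : c ≤ c') :
    GoodTable c' g L :=
  { h with var := fun m h0 hm => (h.var m h0 hm).trans_le hc }

theorem GoodTable.extend {c g v : ℕ} {L : List Entry} (h : GoodTable c g L) (hv : v < c) {m : ℕ}
    (hm : m ≤ L.length) : GoodTable c g (extend v g L m) := by
  induction m with
  | zero => exact h
  | succ m ih =>
    have hlen := (prefix_extend v g L m).length_le
    have h1 := ih (by omega)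
    have h2 := h1.deg m (by omega)
    exact h1.chain hv (by omega) (by omega)

theorem goodTable_table (g c : ℕ) : GoodTable c g (table g c) := by
  induction c with
  | zero =>
    refine ⟨?_, ?_, ?_, ?_, ?_⟩ <;> simp [table, entry]
    all_goals omega
  | succ c ih => exact (ih.mono (Nat.le_succ c)).extend (Nat.lt_succ_self c) le_rfl

/-- `W` gives the values of the monomials of the table `L` at the point `z`, each divided by the
product of the factorials of its exponents. -/
structure IsEval (z W : ℕ → ℝ) (L : List Entry) : Prop where
  zero : W 0 = 1
  step : ∀ m, 0 < m → m < L.length →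
    W m = W (entry L m).par * z (entry L m).var / (entry L m).mult

theorem IsEval.of_prefix {z W : ℕ → ℝ} {L L' : List Entry} (h : IsEval z W L') (hL : L <+: L') :
    IsEval z W L :=
  ⟨h.zero, fun m h0 hm => by
    rw [h.step m h0 (hm.trans_le hL.length_le), entry_of_prefix hL hm]⟩

/-- The sum over the table `L` of a function of degree and value. -/
noncomputable def tableSum (F : ℕ → ℝ → ℝ) (W : ℕ → ℝ) (L : List Entry) : ℝ :=
  ∑ m ∈ Finset.range L.length, F (entry L m).deg (W m)

theorem tableSum_append (F : ℕ → ℝ → ℝ) (W : ℕ → ℝ) (L : List Entry) (e : Entry) :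
    tableSum F W (L ++ [e]) = tableSum F W L + F e.deg (W L.length) := by
  rw [tableSum, tableSum, List.length_append, List.length_singleton, Finset.sum_range_succ,
    entry_append_self]
  congr 1
  refine Finset.sum_congr rfl fun m hm => ?_
  rw [entry_append_left (Finset.mem_range.1 hm)]

/-- The entries of a chain are worth the divided powers of the variable times the first monomial. -/
theorem tableSum_chain (F : ℕ → ℝ → ℝ) {z W : ℕ → ℝ} {L : List Entry} (hL : 0 < L.length)
    (v cur dg e : ℕ) (h : IsEval z W (chain v cur dg L e)) :
    tableSum F W (chain v cur dg L e) = tableSum F W L + ∑ k ∈ Finset.range e,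
        F (dg + k + 1) (W cur * (z v ^ (k + 1) / (k + 1).factorial)) ∧
      ∀ k < e, W (L.length + k) = W cur * (z v ^ (k + 1) / (k + 1).factorial) := by
  induction e with
  | zero => simp [chain_zero]
  | succ e ih =>
    have hp : chain v cur dg L e <+: chain v cur dg L (e + 1) := by
      rw [chain_succ]; exact List.prefix_append _ _
    obtain ⟨i1, i2⟩ := ih (h.of_prefix hp)
    have hW : W (L.length + e) = W cur * (z v ^ (e + 1) / (e + 1).factorial) := by
      have h1 := h.step (L.length + e) (by omega) (by simp)
      have h2 : entry (chain v cur dg L (e + 1)) (L.length + e) =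
          ⟨if e = 0 then cur else L.length + e - 1, v, dg + e + 1, e + 1⟩ := by
        rw [chain_succ, ← length_chain v cur dg L e, entry_append_self]
      rw [h1, h2]
      rcases Nat.eq_zero_or_pos e with rfl | he
      · simp
      · obtain ⟨e, rfl⟩ : ∃ e', e = e' + 1 := ⟨e - 1, by omega⟩
        rw [if_neg (by omega), show L.length + (e + 1) - 1 = L.length + e by omega,
          i2 e (by omega), Nat.factorial_succ (e + 1)]
        push_cast
        field_simp
        ring
    refine ⟨?_, fun k hk => ?_⟩
    · rw [chain_succ, tableSum_append, i1, Finset.sum_range_succ, length_chain, hW, add_assoc]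
    · rcases Nat.lt_succ_iff_lt_or_eq.1 hk with h1 | rfl
      exacts [i2 k h1, hW]

theorem tableSum_extend (F : ℕ → ℝ → ℝ) {z W : ℕ → ℝ} {L : List Entry}
    (v g m : ℕ) (hm : m ≤ L.length) (h : IsEval z W (extend v g L m)) :
    tableSum F W (extend v g L m) = tableSum F W L + ∑ m' ∈ Finset.range m,
      ∑ k ∈ Finset.range (g - (entry L m').deg),
        F ((entry L m').deg + k + 1) (W m' * (z v ^ (k + 1) / (k + 1).factorial)) := by
  induction m with
  | zero => simp [extend]
  | succ m ih =>
    have hlen := (prefix_extend v g L m).length_le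
    have h1 := ih (by omega) (h.of_prefix (prefix_chain ..))
    have h2 := (tableSum_chain F (by omega) _ _ _ _ h).1
    rw [extend, h2, h1, Finset.sum_range_succ, entry_of_prefix (prefix_extend v g L m) (by omega),
      add_assoc]

/-- The monomials of degree `t`, with their multinomial weights, add up to `(∑ z)^t / t!`. -/
theorem sum_table_deg {z W : ℕ → ℝ} (g : ℕ) {t : ℕ} (ht : t ≤ g) (c : ℕ)
    (h : IsEval z W (table g c)) :
    tableSum (fun d w => if d = t then w else 0) W (table g c) =
      (∑ v ∈ Finset.range c, z v) ^ t / t.factorial := by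
  induction c generalizing t with
  | zero =>
    simp only [tableSum, table, List.length_singleton, Finset.range_one, Finset.sum_singleton,
      entry, h.zero, Finset.range_zero, Finset.sum_empty]
    rcases Nat.eq_zero_or_pos t with rfl | h0
    · simp
    · simp [h0.ne, h0.ne']
  | succ c ih =>
    have hp := prefix_extend c g (table g c) (table g c).length
    have good := goodTable_table g c
    have h' := h.of_prefix hp
    rw [table, tableSum_extend _ _ _ _ le_rfl h]
    -- the power of the sum is expanded by the binomial theorem, with divided powers
    have rhs : (∑ v ∈ Finset.range (c + 1), z v) ^ t / t.factorial =
        ∑ u ∈ Finset.range (t + 1), (∑ v ∈ Finset.range c, z v) ^ u / u.factorial *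
          (z c ^ (t - u) / (t - u).factorial) := by
      rw [Finset.sum_range_succ, add_pow, Finset.sum_div]
      refine Finset.sum_congr rfl fun u hu => ?_
      have hu : u ≤ t := Nat.lt_succ_iff.1 (Finset.mem_range.1 hu)
      rw [Nat.cast_choose ℝ hu]
      have := Nat.factorial_ne_zero t
      field_simp
    rw [rhs]
    have rhs2 : ∑ u ∈ Finset.range (t + 1), (∑ v ∈ Finset.range c, z v) ^ u / u.factorial *
          (z c ^ (t - u) / (t - u).factorial) =
        ∑ m ∈ Finset.range (table g c).length, ∑ u ∈ Finset.range (t + 1),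
          (if (entry (table g c) m).deg = u then W m else 0) *
            (z c ^ (t - u) / (t - u).factorial) := by
      rw [Finset.sum_comm]
      refine Finset.sum_congr rfl fun u hu => ?_
      have hu : u ≤ t := Nat.lt_succ_iff.1 (Finset.mem_range.1 hu)
      rw [← Finset.sum_mul, ← ih (hu.trans ht) h', tableSum]
    rw [rhs2, tableSum, ← Finset.sum_add_distrib]
    refine Finset.sum_congr rfl fun m hm => ?_
    set dm := (entry (table g c) m).deg
    rw [Finset.sum_range_succ]
    rcases lt_trichotomy dm t with hlt | heq | hgt
    · rw [if_neg hlt.ne, Finset.sum_eq_single (t - dm - 1),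
        Finset.sum_eq_single dm]
      · rw [if_pos (by omega), if_pos rfl, show t - dm - 1 + 1 = t - dm by omega]; ring
      · intro u _ hu; rw [if_neg (Ne.symm hu), zero_mul]
      · intro hn; exact absurd (Finset.mem_range.2 hlt) hn
      · intro k _ hk; rw [if_neg (by omega)]
      · intro hn; exact absurd (Finset.mem_range.2 (by omega)) hn
    · rw [if_pos heq, Finset.sum_eq_zero, Finset.sum_eq_zero]
      · simp
      · intro u hu; rw [if_neg (by have := Finset.mem_range.1 hu; omega), zero_mul]
      · intro k _; rw [if_neg (by omega)]
    · rw [if_neg hgt.ne', Finset.sum_eq_zero, Finset.sum_eq_zero]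
      · simp
      · intro u hu; rw [if_neg (by have := Finset.mem_range.1 hu; omega), zero_mul]
      · intro k _; rw [if_neg (by omega)]

/-- The exponential series up to degree `g`. -/
noncomputable def truncExp (g : ℕ) (x : ℝ) : ℝ :=
  ∑ t ∈ Finset.range (g + 1), x ^ t / t.factorial

theorem sum_table {z W : ℕ → ℝ} (g c : ℕ) (h : IsEval z W (table g c)) :
    ∑ m ∈ Finset.range (table g c).length, W m =
      truncExp g (∑ v ∈ Finset.range c, z v) := by
  rw [truncExp]
  have : ∀ t ∈ Finset.range (g + 1), (∑ v ∈ Finset.range c, z v) ^ t / t.factorial =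
      ∑ m ∈ Finset.range (table g c).length,
        if (entry (table g c) m).deg = t then W m else 0 := fun t ht => by
    rw [← sum_table_deg g (Nat.lt_succ_iff.1 (Finset.mem_range.1 ht)) c h, tableSum]
  rw [Finset.sum_congr rfl this, Finset.sum_comm]
  refine Finset.sum_congr rfl fun m hm => ?_
  have := (goodTable_table g c).deg m (Finset.mem_range.1 hm)
  rw [Finset.sum_ite_eq, if_pos (Finset.mem_range.2 (by omega))]

/-- The values of the monomials of the table `L` at the point `x`, computed along the table; the
factor `r m` is contributed by the entry `m`. -/
noncomputable def feat (L : List Entry) (r x : ℕ → ℝ) (m : ℕ) : ℝ :=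
  if (entry L m).par < m then feat L r x (entry L m).par * x (entry L m).var * r m else 1
termination_by m

theorem feat_zero (L : List Entry) (r x : ℕ → ℝ) : feat L r x 0 = 1 := by
  rw [feat]; simp

theorem feat_step {c g : ℕ} {L : List Entry} (hL : GoodTable c g L) (r x : ℕ → ℝ) {m : ℕ}
    (h0 : 0 < m) (hm : m < L.length) :
    feat L r x m = feat L r x (entry L m).par * x (entry L m).var * r m := by
  rw [feat, if_pos (hL.par m h0 hm)]

/-- The weighted features of `x` and the plain features of `y` have the truncated exponential of
the inner product of `x` and `y` as their inner product. -/
theorem sum_feat_mul_feat (g c : ℕ) (x y : ℕ → ℝ) :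
    ∑ m ∈ Finset.range (table g c).length,
      feat (table g c) (fun m => ((entry (table g c) m).mult : ℝ)⁻¹) x m *
        feat (table g c) (fun _ => 1) y m =
      truncExp g (∑ v ∈ Finset.range c, x v * y v) := by
  have good := goodTable_table g c
  refine sum_table g c (z := fun v => x v * y v) ⟨by simp [feat_zero], fun m h0 hm => ?_⟩
  rw [feat_step good _ _ h0 hm, feat_step good _ _ h0 hm]
  ring

/-- The generating function of the number of monomials by degree, cut off at degree `g`, is at most
`(1 - x)^{-c}`. -/
theorem tableSum_pow_le (g c : ℕ) {x : ℝ} (h0 : 0 < x) (h1 : x < 1) :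
    tableSum (fun d _ => x ^ d) (feat (table g c) (fun m => ((entry (table g c) m).mult : ℝ)⁻¹)
      (fun _ => 1)) (table g c) ≤ ((1 - x)⁻¹) ^ c := by
  -- the values of the monomials play no role
  have key : ∀ W : ℕ → ℝ, IsEval (fun _ => 1) W (table g c) →
      tableSum (fun d _ => x ^ d) W (table g c) ≤ ((1 - x)⁻¹) ^ c := by
    intro W hW
    induction c with
    | zero => simp [tableSum, table, entry]
    | succ c ih =>
      have hp := prefix_extend c g (table g c) (table g c).length
      have good := goodTable_table g c
      have ih := ih (hW.of_prefix hp)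
      rw [table, tableSum_extend _ _ _ _ le_rfl hW, pow_succ]
      refine le_trans ?_ (mul_le_mul_of_nonneg_right ih (inv_nonneg.2 (by linarith)))
      rw [tableSum, Finset.sum_mul, ← Finset.sum_add_distrib]
      refine Finset.sum_le_sum fun m _ => ?_
      set dm := (entry (table g c) m).deg
      have e1 : x ^ dm + ∑ k ∈ Finset.range (g - dm), x ^ (dm + k + 1) =
          x ^ dm * ∑ k ∈ Finset.range (g - dm + 1), x ^ k := by
        rw [Finset.sum_range_succ', mul_add, Finset.mul_sum, add_comm]
        simp [pow_add, mul_assoc]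
      rw [e1]
      have e2 : ∑ k ∈ Finset.range (g - dm + 1), x ^ k ≤ (1 - x)⁻¹ := by
        rw [← tsum_geometric_of_lt_one h0.le h1]
        exact (summable_geometric_of_lt_one h0.le h1).sum_le_tsum _ (fun i _ => by positivity)
      gcongr
  refine key _ ⟨feat_zero .., fun m h h' => ?_⟩
  rw [feat_step (goodTable_table g c) _ _ h h']
  ring

/-- Every monomial contributes at least `x ^ g` to the generating function. -/
theorem length_table_le (g c : ℕ) {x : ℝ} (h0 : 0 < x) (h1 : x < 1) :
    ((table g c).length : ℝ) ≤ (x⁻¹) ^ g * ((1 - x)⁻¹) ^ c := by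
  have h := tableSum_pow_le g c h0 h1
  have h2 : ((table g c).length : ℝ) * x ^ g ≤ tableSum (fun d _ => x ^ d)
      (feat (table g c) (fun m => ((entry (table g c) m).mult : ℝ)⁻¹) (fun _ => 1))
      (table g c) := by
    rw [tableSum, ← nsmul_eq_mul, ← Finset.card_range (table g c).length, ← Finset.sum_const,
      Finset.card_range]
    refine Finset.sum_le_sum fun m hm => ?_
    exact pow_le_pow_of_le_one h0.le h1.le ((goodTable_table g c).deg m (Finset.mem_range.1 hm))
  rw [inv_pow, mul_comm, ← div_eq_mul_inv, le_div_iff₀ (by positivity)]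
  exact h2.trans h

/-! ### Tabulation programs -/

section Mem

variable (s : Mem)

theorem Mem.setNat_nat (x y : NName) (k j v : ℕ) :
    (s.setNat x k v).nat y j = if y = x ∧ j = k then v else s.nat y j := by
  by_cases hy : y = x
  · subst hy
    by_cases hj : j = k
    · subst hj; simp [setNat]
    · simp [setNat, hj]
  · simp [setNat, hy]

theorem Mem.setNat_nat_of_ne {x y : NName} (h : y ≠ x) (k v : ℕ) :
    (s.setNat x k v).nat y = s.nat y := by
  simp [setNat, h]

@[simp]
theorem Mem.setNat_nat_self (x : NName) (k v : ℕ) : (s.setNat x k v).nat x k = v := by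
  simp [setNat]

@[simp]
theorem Mem.setNat_real (x : NName) (k v : ℕ) : (s.setNat x k v).real = s.real := rfl

@[simp]
theorem Mem.setReal_nat (x : RName) (k : ℕ) (v : ℝ) : (s.setReal x k v).nat = s.nat := rfl

theorem Mem.setReal_real_of_ne {x y : RName} (h : y ≠ x) (k : ℕ) (v : ℝ) :
    (s.setReal x k v).real y = s.real y := by
  simp [setReal, h]

@[simp]
theorem Mem.setReal_real_self (x : RName) (k : ℕ) (v : ℝ) : (s.setReal x k v).real x k = v := by
  simp [setReal]

theorem Mem.setReal_real_of_ne_idx (x : RName) {k j : ℕ} (h : j ≠ k) (v : ℝ) :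
    (s.setReal x k v).real x j = s.real x j := by
  simp [setReal, h]

end Mem

theorem cost_mono {P : Prog} {s : Mem} {D D' : ℕ} (h : (P.exec s).2 ≤ P.wt * D) (hD : D ≤ D') :
    (P.exec s).2 ≤ P.wt * D' :=
  h.trans (Nat.mul_le_mul_left _ hD)

/-- The data that stay fixed once the table of monomials has been built: a bound `V` on all natural
numbers in use, the dimensions `n` and `c`, and the degree `g` of the table. -/
structure Ctx where
  V : ℕ
  n : ℕ
  c : ℕ
  g : ℕ
  two_le : 2 ≤ V
  n_le : n ≤ V
  c_le : c ≤ V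
  length_le : (table g c).length ≤ V

/-- The table of monomials. -/
def Ctx.L (Γ : Ctx) : List Entry := table Γ.g Γ.c

/-- The number of monomials. -/
def Ctx.m (Γ : Ctx) : ℕ := Γ.L.length

/-- The memory holds the dimensions (`dimN`, `dimC`), the number of monomials (`tmp 3`) and the
table of monomials: parents in `tmp 4`, variables in `tmp 5`, inverse multiplicities in the real
array `tmp 21`, and the indicator of the monomial `1` in the real array `tmp 22`. -/
structure Env (Γ : Ctx) (s : Mem) : Prop where
  dimN : s.nat .dimN 0 = Γ.n
  dimC : s.nat .dimC 0 = Γ.c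
  len : s.nat (.tmp 3) 0 = Γ.m
  par : ∀ m < Γ.m, s.nat (.tmp 4) m = (entry Γ.L m).par
  var : ∀ m < Γ.m, s.nat (.tmp 5) m = (entry Γ.L m).var
  inv : ∀ m < Γ.m, s.real (.tmp 21) m = ((entry Γ.L m).mult : ℝ)⁻¹
  one : ∀ m < Γ.m, s.real (.tmp 22) m = if m = 0 then 1 else 0

theorem Env.congr {Γ : Ctx} {s t : Mem} (h : Env Γ s)
    (hn : ∀ x, x ≠ .tmp 0 → x ≠ .tmp 1 → x ≠ .tmp 2 → t.nat x = s.nat x)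
    (h1 : t.real (.tmp 21) = s.real (.tmp 21)) (h2 : t.real (.tmp 22) = s.real (.tmp 22)) :
    Env Γ t := by
  constructor
  · rw [hn _ (by simp) (by simp) (by simp), h.dimN]
  · rw [hn _ (by simp) (by simp) (by simp), h.dimC]
  · rw [hn _ (by simp) (by simp) (by simp), h.len]
  · rw [hn _ (by simp) (by simp) (by simp)]; exact h.par
  · rw [hn _ (by simp) (by simp) (by simp)]; exact h.var
  · rw [h1]; exact h.inv
  · rw [h2]; exact h.one

theorem Env.setNat {Γ : Ctx} {s : Mem} (h : Env Γ s) {x : NName}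
    (hx : x = .tmp 0 ∨ x = .tmp 1 ∨ x = .tmp 2) (k v : ℕ) : Env Γ (s.setNat x k v) :=
  h.congr (fun y h0 h1 h2 => s.setNat_nat_of_ne (by rintro rfl; tauto) k v) rfl rfl

theorem Env.setReal {Γ : Ctx} {s : Mem} (h : Env Γ s) {x : RName} (h1 : x ≠ .tmp 21)
    (h2 : x ≠ .tmp 22) (k : ℕ) (v : ℝ) : Env Γ (s.setReal x k v) :=
  h.congr (fun _ _ _ _ => rfl) (s.setReal_real_of_ne h1.symm k v)
    (s.setReal_real_of_ne h2.symm k v)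

/-- The expression `e` has the value `v ≤ V` in every memory that holds the fixed data. -/
def IsVal (Γ : Ctx) (e : NExp) (v : ℕ) : Prop :=
  v ≤ Γ.V ∧ ∀ t, Env Γ t → e.eval t = v ∧ e.Ok Γ.V t

/-- The run of `P` from `s` ends in `s'`, keeps the fixed data, changes only the real arrays in `W`
and costs at most `P.wt * D`. -/
structure Runs (Γ : Ctx) (D : ℕ) (P : Prog) (s s' : Mem) (W : List RName) : Prop where
  exec : (P.exec s).1 = s'
  env : Env Γ s'
  frame : ∀ B ∉ W, s'.real B = s.real B
  cost : (P.exec s).2 ≤ P.wt * D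

theorem Runs.seq {Γ : Ctx} {D : ℕ} {P Q : Prog} {s s₁ s₂ : Mem} {W₁ W₂ : List RName}
    (h₁ : Runs Γ D P s s₁ W₁) (h₂ : Runs Γ D Q s₁ s₂ W₂) :
    Runs Γ D (.seq P Q) s s₂ (W₁ ++ W₂) where
  exec := by rw [Prog.exec, h₁.exec, h₂.exec]
  env := h₂.env
  frame B hB := by
    rw [List.mem_append, not_or] at hB
    rw [h₂.frame B hB.2, h₁.frame B hB.1]
  cost := cost_seq_le h₁.cost (by rw [h₁.exec]; exact h₂.cost)

/-- The row index inside a tabulation. -/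
abbrev rowI : NExp := .get (.tmp 0) (.const 0)
/-- The column index inside a tabulation. -/
abbrev colI : NExp := .get (.tmp 1) (.const 0)
/-- The summation index inside a tabulation. -/
abbrev sumI : NExp := .get (.tmp 2) (.const 0)

/-- `A[off + (i * cols + j)] := e₀ + ∑_{k < m} e` for all `i < rows` and `j < cols`, row by row. -/
def tab (A : RName) (off rows cols : NExp) (e₀ : RExp) (m : NExp) (e : RExp) : Prog :=
  .loop (.tmp 0) rows (.loop (.tmp 1) cols
    (.seq (.setReal A (.add off (.add (.mul rowI cols) colI)) e₀)
      (.loop (.tmp 2) m (.setReal A (.add off (.add (.mul rowI cols) colI))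
        (.add (.get A (.add off (.add (.mul rowI cols) colI))) e)))))

/-- Correctness and cost of a tabulation, for any values `F₀ i j` and `F i j k` that the expressions
`e₀` and `e` have whenever the loop variables are `i`, `j`, `k`. The expression `e₀` may read the
cells of `A` that are already filled in its row; this makes recursive tables possible. -/
theorem tab_runs (Γ : Ctx) {D : ℕ} {s : Mem} (hs : Env Γ s) {A : RName} (hA₁ : A ≠ .tmp 21)
    (hA₂ : A ≠ .tmp 22) {off rows cols m : NExp} {e₀ e : RExp} {o r c' m' : ℕ}
    (hoff : IsVal Γ off o) (hrows : IsVal Γ rows r) (hcols : IsVal Γ cols c') (hm : IsVal Γ m m')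
    (hD : Nat.size Γ.V * (m' + 1) * (c' + 1) * (r + 1) ≤ D)
    (F₀ : ℕ → ℕ → ℝ) (F : ℕ → ℕ → ℕ → ℝ)
    (h₀ : ∀ t i j, Env Γ t → (∀ B, B ≠ A → t.real B = s.real B) → i < r → j < c' → i ≤ Γ.V →
      j ≤ Γ.V → t.nat (.tmp 0) 0 = i → t.nat (.tmp 1) 0 = j →
      (∀ j' < j, t.real A (o + (i * c' + j')) = F₀ i j' + ∑ k ∈ Finset.range m', F i j' k) →
      e₀.eval t = F₀ i j ∧ e₀.Ok Γ.V t)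
    (h₁ : ∀ t i j k, Env Γ t → (∀ B, B ≠ A → t.real B = s.real B) → i < r → j < c' → k < m' →
      i ≤ Γ.V → j ≤ Γ.V → k ≤ Γ.V → t.nat (.tmp 0) 0 = i → t.nat (.tmp 1) 0 = j →
      t.nat (.tmp 2) 0 = k → e.eval t = F i j k ∧ e.Ok Γ.V t) :
    ∃ s', Runs Γ D (tab A off rows cols e₀ m e) s s' [A] ∧
      (∀ i < r, ∀ j < c', s'.real A (o + (i * c' + j)) =
        F₀ i j + ∑ k ∈ Finset.range m', F i j k) ∧
      ∀ q < o, s'.real A q = s.real A q := by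
  have hS := one_le_size Γ.two_le
  set G : ℕ → ℕ → ℝ := fun i j => F₀ i j + ∑ k ∈ Finset.range m', F i j k with hG
  let Base : Mem → Prop := fun t => Env Γ t ∧ ∀ B, B ≠ A → t.real B = s.real B
  have base_nat : ∀ {t x}, (x = .tmp 0 ∨ x = .tmp 1 ∨ x = .tmp 2) → ∀ k v, Base t →
      Base (t.setNat x k v) := fun hx k v hB => ⟨hB.1.setNat hx k v, hB.2⟩
  have base_real : ∀ {t} k v, Base t → Base (t.setReal A k v) := fun k v hB =>
    ⟨hB.1.setReal hA₁ hA₂ k v, fun B hne => by rw [Mem.setReal_real_of_ne _ hne, hB.2 B hne]⟩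
  -- the cell that is being filled
  have hidx : ∀ {t i j}, Env Γ t → i ≤ Γ.V → j ≤ Γ.V → t.nat (.tmp 0) 0 = i →
      t.nat (.tmp 1) 0 = j →
      (NExp.add off (.add (.mul rowI cols) colI)).eval t = o + (i * c' + j) ∧
      (NExp.add off (.add (.mul rowI cols) colI)).Ok Γ.V t := by
    intro t i j ht hi hj h0 h1
    obtain ⟨a1, a2⟩ := hoff.2 t ht
    obtain ⟨b1, b2⟩ := hcols.2 t ht
    simp [NExp.eval, NExp.Ok, a1, a2, b1, b2, h0, h1, hi, hj]
  -- one cell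
  have cell : ∀ i < r, ∀ j < c', ∀ t, Base t → t.nat (.tmp 0) 0 = i → t.nat (.tmp 1) 0 = j →
      (∀ j' < j, t.real A (o + (i * c' + j')) = G i j') →
      let P := Prog.seq (.setReal A (.add off (.add (.mul rowI cols) colI)) e₀)
        (.loop (.tmp 2) m (.setReal A (.add off (.add (.mul rowI cols) colI))
        (.add (.get A (.add off (.add (.mul rowI cols) colI))) e)))
      (Base (P.exec t).1 ∧ (P.exec t).1.nat (.tmp 0) 0 = i ∧
        (∀ q < o + (i * c' + j), (P.exec t).1.real A q = t.real A q) ∧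
        (P.exec t).1.real A (o + (i * c' + j)) = G i j) ∧
      (P.exec t).2 ≤ P.wt * (Nat.size Γ.V * (m' + 1)) := by
    intro i hi j hj t hB hti htj hprev
    have hiV : i ≤ Γ.V := hi.le.trans hrows.1
    have hjV : j ≤ Γ.V := hj.le.trans hcols.1
    obtain ⟨x1, x2⟩ := hidx hB.1 hiV hjV hti htj
    obtain ⟨y1, y2⟩ := h₀ t i j hB.1 hB.2 hi hj hiV hjV hti htj hprev
    set t₁ := ((Prog.setReal A (.add off (.add (.mul rowI cols) colI)) e₀).exec t).1 with ht₁
    have ht₁' : t₁ = t.setReal A (o + (i * c' + j)) (F₀ i j) := by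
      rw [ht₁, Prog.exec, x1, y1]
    have hB₁ : Base t₁ := ht₁' ▸ base_real _ _ hB
    have h := exec_loop (s := t₁) (x := .tmp 2) (p := .setReal A
        (.add off (.add (.mul rowI cols) colI))
        (.add (.get A (.add off (.add (.mul rowI cols) colI))) e)) Γ.two_le (le_refl _)
      (fun k u => Base u ∧ u.nat (.tmp 0) 0 = i ∧ u.nat (.tmp 1) 0 = j ∧
        (∀ q < o + (i * c' + j), u.real A q = t.real A q) ∧
        u.real A (o + (i * c' + j)) = F₀ i j + ∑ k' ∈ Finset.range k, F i j k')
      (hm.2 t₁ hB₁.1).2 (hm.2 t₁ hB₁.1).1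
      ⟨hB₁, by rw [ht₁']; exact hti, by rw [ht₁']; exact htj,
        fun q hq => by rw [ht₁', Mem.setReal_real_of_ne_idx _ _ hq.ne], by rw [ht₁']; simp⟩
      (by
        rintro k hk u ⟨c1, c2, c3, c4, c5⟩
        have d1 := base_nat (x := .tmp 2) (by simp) 0 k c1
        have d2 : (u.setNat (.tmp 2) 0 k).nat (.tmp 0) 0 = i := by
          rw [Mem.setNat_nat_of_ne _ (by simp), c2]
        have d3 : (u.setNat (.tmp 2) 0 k).nat (.tmp 1) 0 = j := by
          rw [Mem.setNat_nat_of_ne _ (by simp), c3]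
        have hkV := hk.le.trans hm.1
        obtain ⟨x1, x2⟩ := hidx d1.1 hiV hjV d2 d3
        obtain ⟨y1, y2⟩ := h₁ _ i j k d1.1 d1.2 hi hj hk hiV hjV hkV d2 d3 (by simp)
        refine ⟨?_, cost_setReal_le Γ.two_le le_rfl x2 ⟨x2, y2⟩⟩
        rw [Prog.exec, x1]
        refine ⟨base_real _ _ d1, d2, d3, fun q hq => ?_, ?_⟩
        · rw [Mem.setReal_real_of_ne_idx _ _ hq.ne]; exact c4 q hq
        · rw [Mem.setReal_real_self, RExp.eval, RExp.eval, x1, y1, Mem.setNat_real, c5,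
            Finset.sum_range_succ, add_assoc])
    obtain ⟨⟨c1, c2, -, c4, c5⟩, hc⟩ := h
    refine ⟨⟨c1, c2, c4, c5⟩, cost_seq_le ?_ ?_⟩
    · refine cost_mono (cost_setReal_le Γ.two_le le_rfl x2 y2) ?_
      exact Nat.le_mul_of_pos_right _ (by omega)
    · exact hc
  -- one row
  have row : ∀ i < r, ∀ t, Base t → t.nat (.tmp 0) 0 = i →
      let P := Prog.loop (.tmp 1) cols
        (.seq (.setReal A (.add off (.add (.mul rowI cols) colI)) e₀)
        (.loop (.tmp 2) m (.setReal A (.add off (.add (.mul rowI cols) colI))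
        (.add (.get A (.add off (.add (.mul rowI cols) colI))) e))))
      (Base (P.exec t).1 ∧ (∀ q < o + i * c', (P.exec t).1.real A q = t.real A q) ∧
        ∀ j < c', (P.exec t).1.real A (o + (i * c' + j)) = G i j) ∧
      (P.exec t).2 ≤ P.wt * (Nat.size Γ.V * (m' + 1) * (c' + 1)) := by
    intro i hi t hB hti
    have h := exec_loop (s := t) (x := .tmp 1) (p := .seq
        (.setReal A (.add off (.add (.mul rowI cols) colI)) e₀)
        (.loop (.tmp 2) m (.setReal A (.add off (.add (.mul rowI cols) colI))
        (.add (.get A (.add off (.add (.mul rowI cols) colI))) e)))) Γ.two_le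
      (show Nat.size Γ.V ≤ Nat.size Γ.V * (m' + 1) from Nat.le_mul_of_pos_right _ (by omega))
      (fun j u => Base u ∧ u.nat (.tmp 0) 0 = i ∧ (∀ q < o + i * c', u.real A q = t.real A q) ∧
        ∀ j' < j, u.real A (o + (i * c' + j')) = G i j')
      (hcols.2 t hB.1).2 (hcols.2 t hB.1).1
      ⟨hB, hti, fun _ _ => rfl, fun j' hj' => absurd hj' (Nat.not_lt_zero _)⟩
      (by
        rintro j hj u ⟨c1, c2, c3, c4⟩
        obtain ⟨⟨d1, d2, d3, d4⟩, d5⟩ := cell i hi j hj (u.setNat (.tmp 1) 0 j)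
          (base_nat (by simp) 0 j c1) (by rw [Mem.setNat_nat_of_ne _ (by simp), c2]) (by simp) c4
        refine ⟨⟨d1, d2, fun q hq => ?_, fun j' hj' => ?_⟩, d5⟩
        · rw [d3 q (by omega), Mem.setNat_real, c3 q hq]
        · rcases Nat.lt_succ_iff_lt_or_eq.1 hj' with h' | rfl
          · rw [d3 _ (by omega), Mem.setNat_real, c4 j' h']
          · exact d4)
    obtain ⟨⟨c1, -, c3, c4⟩, hc⟩ := h
    exact ⟨⟨c1, c3, c4⟩, hc⟩
  have h := exec_loop (s := s) (x := .tmp 0) (p := Prog.loop (.tmp 1) cols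
        (.seq (.setReal A (.add off (.add (.mul rowI cols) colI)) e₀)
        (.loop (.tmp 2) m (.setReal A (.add off (.add (.mul rowI cols) colI))
        (.add (.get A (.add off (.add (.mul rowI cols) colI))) e))))) Γ.two_le
    (show Nat.size Γ.V ≤ Nat.size Γ.V * (m' + 1) * (c' + 1) by
      rw [mul_assoc]; exact Nat.le_mul_of_pos_right _ (by positivity))
    (fun i u => Base u ∧ (∀ q < o, u.real A q = s.real A q) ∧
      ∀ i' < i, ∀ j < c', u.real A (o + (i' * c' + j)) = G i' j)
    (hrows.2 s hs).2 (hrows.2 s hs).1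
    ⟨⟨hs, fun _ _ => rfl⟩, fun _ _ => rfl, fun i' hi' => absurd hi' (Nat.not_lt_zero _)⟩
    (by
      rintro i hi u ⟨c1, c2, c3⟩
      obtain ⟨⟨d1, d2, d3⟩, d4⟩ := row i hi (u.setNat (.tmp 0) 0 i)
        (base_nat (by simp) 0 i c1) (by simp)
      refine ⟨⟨d1, fun q hq => ?_, fun i' hi' j hj => ?_⟩, d4⟩
      · rw [d2 q (by omega), Mem.setNat_real, c2 q hq]
      · rcases Nat.lt_succ_iff_lt_or_eq.1 hi' with h' | rfl
        · have : (i' + 1) * c' ≤ i * c' := Nat.mul_le_mul_right _ h'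
          rw [d2 _ (by rw [add_mul] at this; omega), Mem.setNat_real, c3 i' h' j hj]
        · exact d3 j hj)
  obtain ⟨⟨⟨c1, c1'⟩, c2, c3⟩, hc⟩ := h
  exact ⟨_, ⟨rfl, c1, fun B hB => c1' B (by simpa using hB), cost_mono hc hD⟩, c3, c2⟩

/-! ### The attention program -/

/-- A common bound, in units of the weight, for the cost of a tabulation one of whose dimensions is
a number of at most `Q` tokens, while the other two dimensions are at most `6 c + 16`, or one of them
is the number of monomials. -/
def Ctx.D (Γ : Ctx) (Q : ℕ) : ℕ :=
  Nat.size Γ.V * ((Γ.m + 1) * ((6 * Γ.c + 17) * (6 * Γ.c + 17)) * (Q + 1))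

theorem Ctx.le_D (Γ : Ctx) {Q m' c' r : ℕ} (hm : m' ≤ 6 * Γ.c + 16) (hc : c' ≤ 6 * Γ.c + 16)
    (hr : r ≤ Q) : Nat.size Γ.V * (m' + 1) * (c' + 1) * (r + 1) ≤ Γ.D Q := by
  rw [Ctx.D, mul_assoc, mul_assoc, ← mul_assoc (m' + 1)]
  refine Nat.mul_le_mul_left _ (Nat.mul_le_mul ?_ (by omega))
  rw [← one_mul ((m' + 1) * (c' + 1))]
  exact Nat.mul_le_mul (by omega) (Nat.mul_le_mul (by omega) (by omega))

/-- The order of the three dimensions of a tabulation does not matter. -/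
theorem Ctx.le_D' (Γ : Ctx) {Q m' c' r y r' : ℕ}
    (h : (m' + 1) * (c' + 1) * (r + 1) = (Γ.m + 1) * (y + 1) * (r' + 1)) (hy : y ≤ 6 * Γ.c + 16)
    (hr : r' ≤ Q) : Nat.size Γ.V * (m' + 1) * (c' + 1) * (r + 1) ≤ Γ.D Q := by
  rw [Ctx.D, mul_assoc, mul_assoc, ← mul_assoc (m' + 1), h]
  refine Nat.mul_le_mul_left _ (Nat.mul_le_mul (Nat.mul_le_mul_left _ ?_) (by omega))
  rw [← mul_one (y + 1)]
  exact Nat.mul_le_mul (by omega) (by omega)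

/-- The number of channels. -/
abbrev cN : NExp := .get .dimC (.const 0)
/-- The number of monomials. -/
abbrev mN : NExp := .get (.tmp 3) (.const 0)

theorem isVal_const (Γ : Ctx) {k : ℕ} (hk : k ≤ Γ.V) : IsVal Γ (.const k) k :=
  ⟨hk, fun _ _ => ⟨rfl, hk⟩⟩

theorem isVal_cN (Γ : Ctx) : IsVal Γ cN Γ.c :=
  ⟨Γ.c_le, fun t ht => by
    have := Γ.c_le
    simp [NExp.eval, NExp.Ok, ht.dimC, this]⟩

theorem isVal_mN (Γ : Ctx) : IsVal Γ mN Γ.m :=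
  ⟨Γ.length_le, fun t ht => by
    have : Γ.m ≤ Γ.V := Γ.length_le
    simp [NExp.eval, NExp.Ok, ht.len, this]⟩

/-- The score of the tokens `i` and `k` of the flat array `X`. -/
noncomputable def flatScore (c : ℕ) (X WQ WK : ℕ → ℝ) (i k : ℕ) : ℝ :=
  ∑ v ∈ Finset.range c, (∑ t ∈ Finset.range c, (∑ u ∈ Finset.range c,
    X (i * c + u) * WQ (u * c + t)) * WK (v * c + t)) * X (k * c + v)

/-- Attention, with the truncated exponential in place of the exponential, of the token `i` to the
first `N` tokens of the flat array `X`. -/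
noncomputable def flatAttn (g c N : ℕ) (X WQ WK WV : ℕ → ℝ) (i j : ℕ) : ℝ :=
  (∑ k ∈ Finset.range N, truncExp g (flatScore c X WQ WK i k) *
    ∑ u ∈ Finset.range c, X (k * c + u) * WV (u * c + j)) /
  ∑ k ∈ Finset.range N, truncExp g (flatScore c X WQ WK i k)

/-- The zero constant. -/
abbrev zeroR : RExp := .ofNat (.const 0)
/-- The cell `i * cols + j` of an array. -/
abbrev cell (A : RName) (i cols j : NExp) : RExp := .get A (.add (.mul i cols) j)

/-- Polynomial attention of `nq` tokens, from the position `q` on, of the flat array `X` to its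
first `N` tokens. The result is in `tmp 9`. The array `tmp 2` holds the queries `X W_Q W_Kᵀ`, whose
inner products with the tokens are the scores, and `tmp 3` holds the values `X W_V`. The features of
the keys (`tmp 4`) and of the queries (`tmp 5`) are the values of all monomials, computed along the
table; the indicator in the real array `tmp 22` makes the first of them `1`. The keys enter only
through the moments: the sums of features times values in `tmp 6`, the sums of features in `tmp 7`.
The denominators are in `tmp 8`. -/
def attnProg (X : RName) (q nq N : NExp) (WQ WK WV : RName) : Prog :=
  .seq (.seq (.seq (.seq (.seq (.seq (.seq (.seq
    (tab (.tmp 1) (.const 0) nq cN zeroR cN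
      (.mul (cell X (.add q rowI) cN sumI) (cell WQ sumI cN colI)))
    (tab (.tmp 2) (.const 0) nq cN zeroR cN
      (.mul (cell (.tmp 1) rowI cN sumI) (cell WK colI cN sumI))))
    (tab (.tmp 3) (.const 0) N cN zeroR cN
      (.mul (cell X rowI cN sumI) (cell WV sumI cN colI))))
    (tab (.tmp 4) (.const 0) N mN (.add (.get (.tmp 22) colI)
      (.mul (.mul (cell (.tmp 4) rowI mN (.get (.tmp 4) colI))
        (cell X rowI cN (.get (.tmp 5) colI)))
        (.sub (.ofNat (.const 1)) (.get (.tmp 22) colI)))) (.const 0) zeroR))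
    (tab (.tmp 5) (.const 0) nq mN (.add (.get (.tmp 22) colI)
      (.mul (.mul (cell (.tmp 5) rowI mN (.get (.tmp 4) colI))
        (cell (.tmp 2) rowI cN (.get (.tmp 5) colI)))
        (.get (.tmp 21) colI))) (.const 0) zeroR))
    (tab (.tmp 6) (.const 0) mN cN zeroR N
      (.mul (cell (.tmp 4) sumI mN rowI) (cell (.tmp 3) sumI cN colI))))
    (tab (.tmp 7) (.const 0) mN (.const 1) zeroR N (cell (.tmp 4) sumI mN rowI)))
    (tab (.tmp 8) (.const 0) nq (.const 1) zeroR mN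
      (.mul (cell (.tmp 5) rowI mN sumI) (.get (.tmp 7) sumI))))
    (tab (.tmp 9) (.const 0) nq cN zeroR mN
      (.div (.mul (cell (.tmp 5) rowI mN sumI) (cell (.tmp 6) sumI cN colI))
        (.get (.tmp 8) rowI)))

/-- The real arrays written by the attention program. -/
abbrev attnTmp : List RName :=
  [.tmp 1] ++ [.tmp 2] ++ [.tmp 3] ++ [.tmp 4] ++ [.tmp 5] ++ [.tmp 6] ++ [.tmp 7] ++ [.tmp 8] ++
    [.tmp 9]

/-- The attention program computes polynomial attention at the cost of at most `Q` tokens times the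
number of monomials. -/
theorem attnProg_runs (Γ : Ctx) {Q : ℕ} {s : Mem} (hs : Env Γ s) {X WQ WK WV : RName}
    {q nq N : NExp} {q' nq' N' : ℕ} (hX : X ∉ attnTmp) (hWQ : WQ ∉ attnTmp) (hWK : WK ∉ attnTmp)
    (hWV : WV ∉ attnTmp) (hq : IsVal Γ q q') (hnq : IsVal Γ nq nq') (hN : IsVal Γ N N')
    (hQ : nq' ≤ Q) (hQ' : N' ≤ Q) :
    ∃ s', Runs Γ (Γ.D Q) (attnProg X q nq N WQ WK WV) s s' attnTmp ∧
      ∀ i < nq', ∀ j < Γ.c, s'.real (.tmp 9) (i * Γ.c + j) =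
        flatAttn Γ.g Γ.c N' (s.real X) (s.real WQ) (s.real WK) (s.real WV) (q' + i) j := by
  have good : GoodTable Γ.c Γ.g Γ.L := goodTable_table Γ.g Γ.c
  have hcV := Γ.c_le
  have hmV : Γ.m ≤ Γ.V := Γ.length_le
  have h1V : 1 ≤ Γ.V := by have := Γ.two_le; omega
  have h0 := isVal_const Γ (Nat.zero_le Γ.V)
  have h1 := isVal_const Γ h1V
  have hc := isVal_cN Γ
  have hm := isVal_mN Γ
  have X1 : X ≠ .tmp 1 := by rintro rfl; simp at hX
  have X2 : X ≠ .tmp 2 := by rintro rfl; simp at hX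
  have X3 : X ≠ .tmp 3 := by rintro rfl; simp at hX
  have X4 : X ≠ .tmp 4 := by rintro rfl; simp at hX
  have Q1 : WQ ≠ .tmp 1 := by rintro rfl; simp at hWQ
  have K1 : WK ≠ .tmp 1 := by rintro rfl; simp at hWK
  have K2 : WK ≠ .tmp 2 := by rintro rfl; simp at hWK
  have V1 : WV ≠ .tmp 1 := by rintro rfl; simp at hWV
  have V2 : WV ≠ .tmp 2 := by rintro rfl; simp at hWV
  have V3 : WV ≠ .tmp 3 := by rintro rfl; simp at hWV
  have parV : ∀ m < Γ.m, (entry Γ.L m).par ≤ Γ.V := fun m hm => by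
    rcases Nat.eq_zero_or_pos m with rfl | h
    · rw [good.zero]; exact Nat.zero_le _
    · exact (good.par m h hm).le.trans (hm.le.trans hmV)
  have varV : ∀ m < Γ.m, (entry Γ.L m).var ≤ Γ.V := fun m hm => by
    rcases Nat.eq_zero_or_pos m with rfl | h
    · rw [good.zero]; exact Nat.zero_le _
    · exact (good.var m h hm).le.trans hcV
  obtain ⟨s₁, r₁, v₁, -⟩ := tab_runs Γ hs (A := .tmp 1) (by simp) (by simp) h0 hnq hc hc
    (e₀ := zeroR) (e := .mul (cell X (.add q rowI) cN sumI) (cell WQ sumI cN colI))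
    (Γ.le_D (by omega) (by omega) hQ) (fun _ _ => 0)
    (fun i j k => s.real X ((q' + i) * Γ.c + k) * s.real WQ (k * Γ.c + j))
    (by intros; simp [RExp.eval, RExp.Ok, NExp.eval, NExp.Ok])
    (by
      intro t i j k ht hr _ _ _ hi hj hk hi' hj' hk'
      obtain ⟨a1, a2⟩ := hq.2 t ht
      simp [RExp.eval, RExp.Ok, NExp.eval, NExp.Ok, hi', hj', hk', hi, hj, hk, ht.dimC, hcV, a1, a2,
        hr X X1, hr WQ Q1])
  obtain ⟨s₂, r₂, v₂, -⟩ := tab_runs Γ r₁.env (A := .tmp 2) (by simp) (by simp) h0 hnq hc hc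
    (e₀ := zeroR) (e := .mul (cell (.tmp 1) rowI cN sumI) (cell WK colI cN sumI))
    (Γ.le_D (by omega) (by omega) hQ) (fun _ _ => 0)
    (fun i j k => (∑ u ∈ Finset.range Γ.c,
      s.real X ((q' + i) * Γ.c + u) * s.real WQ (u * Γ.c + k)) * s.real WK (j * Γ.c + k))
    (by intros; simp [RExp.eval, RExp.Ok, NExp.eval, NExp.Ok])
    (by
      intro t i j k ht hr hi0 hj0 hk0 hi hj hk hi' hj' hk'
      have e1 := v₁ i hi0 k hk0
      rw [zero_add, zero_add] at e1
      simp [RExp.eval, RExp.Ok, NExp.eval, NExp.Ok, hi', hj', hk', hi, hj, hk, ht.dimC, hcV,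
        hr, e1, hr WK K2, r₁.frame WK (by simp [K1])])
  have R₂ := r₁.seq r₂
  obtain ⟨s₃, r₃, v₃, -⟩ := tab_runs Γ R₂.env (A := .tmp 3) (by simp) (by simp) h0 hN hc hc
    (e₀ := zeroR) (e := .mul (cell X rowI cN sumI) (cell WV sumI cN colI))
    (Γ.le_D (by omega) (by omega) hQ') (fun _ _ => 0)
    (fun i j k => s.real X (i * Γ.c + k) * s.real WV (k * Γ.c + j))
    (by intros; simp [RExp.eval, RExp.Ok, NExp.eval, NExp.Ok])
    (by
      intro t i j k ht hr _ _ _ hi hj hk hi' hj' hk'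
      simp [RExp.eval, RExp.Ok, NExp.eval, NExp.Ok, hi', hj', hk', hi, hj, hk, ht.dimC, hcV,
        hr X X3, hr WV V3, R₂.frame WV (by simp [V1, V2]), R₂.frame X (by simp [X1, X2])])
  have R₃ := R₂.seq r₃
  -- features of the keys
  obtain ⟨s₄, r₄, v₄, -⟩ := tab_runs Γ R₃.env (A := .tmp 4) (by simp) (by simp) h0 hN hm h0
    (e₀ := .add (.get (.tmp 22) colI)
      (.mul (.mul (cell (.tmp 4) rowI mN (.get (.tmp 4) colI))
        (cell X rowI cN (.get (.tmp 5) colI)))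
        (.sub (.ofNat (.const 1)) (.get (.tmp 22) colI)))) (e := zeroR)
    (Γ.le_D' (y := 0) (r' := N') (by ring) (by omega) hQ')
    (fun i j => feat Γ.L (fun _ => 1) (fun v => s.real X (i * Γ.c + v)) j) (fun _ _ _ => 0)
    (by
      intro t i j ht hr hi0 hj0 hi hj hi' hj' prev
      have eX : t.real X = s.real X := by rw [hr X X4, R₃.frame X (by simp [X1, X2, X3])]
      refine ⟨?_, by
        simp [RExp.Ok, NExp.eval, NExp.Ok, hi', hj', hi, hj, ht.dimC, hcV, ht.len, hmV,
          ht.par j hj0, ht.var j hj0, parV j hj0, varV j hj0, h1V]⟩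
      simp only [RExp.eval, NExp.eval, hi', hj', ht.dimC, ht.len, ht.par j hj0, ht.var j hj0,
        ht.one j hj0, eX]
      rcases Nat.eq_zero_or_pos j with rfl | hj1
      · simp [feat_zero]
      · have e1 := prev _ (good.par j hj1 hj0)
        simp only [zero_add, Finset.range_zero, Finset.sum_empty, add_zero] at e1
        rw [if_neg hj1.ne', e1, feat_step good _ _ hj1 hj0]
        simp)
    (by intros; simp [RExp.eval, RExp.Ok, NExp.eval, NExp.Ok])
  have R₄ := R₃.seq r₄
  -- features of the queries
  obtain ⟨s₅, r₅, v₅, -⟩ := tab_runs Γ R₄.env (A := .tmp 5) (by simp) (by simp) h0 hnq hm h0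
    (e₀ := .add (.get (.tmp 22) colI)
      (.mul (.mul (cell (.tmp 5) rowI mN (.get (.tmp 4) colI))
        (cell (.tmp 2) rowI cN (.get (.tmp 5) colI)))
        (.get (.tmp 21) colI))) (e := zeroR)
    (Γ.le_D' (y := 0) (r' := nq') (by ring) (by omega) hQ)
    (fun i j => feat Γ.L (fun m => ((entry Γ.L m).mult : ℝ)⁻¹)
      (fun v => ∑ k ∈ Finset.range Γ.c, (∑ u ∈ Finset.range Γ.c,
      s.real X ((q' + i) * Γ.c + u) * s.real WQ (u * Γ.c + k)) * s.real WK (v * Γ.c + k)) j)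
    (fun _ _ _ => 0)
    (by
      intro t i j ht hr hi0 hj0 hi hj hi' hj' prev
      refine ⟨?_, by
        simp [RExp.Ok, NExp.eval, NExp.Ok, hi', hj', hi, hj, ht.dimC, hcV, ht.len, hmV,
          ht.par j hj0, ht.var j hj0, parV j hj0, varV j hj0]⟩
      simp only [RExp.eval, NExp.eval, hi', hj', ht.dimC, ht.len, ht.par j hj0, ht.var j hj0,
        ht.one j hj0, ht.inv j hj0]
      rcases Nat.eq_zero_or_pos j with rfl | hj1
      · simp [feat_zero, good.zero]
      · have e1 := prev _ (good.par j hj1 hj0)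
        have e2 := v₂ i hi0 _ (good.var j hj1 hj0)
        simp only [zero_add, Finset.range_zero, Finset.sum_empty, add_zero] at e1 e2
        rw [if_neg hj1.ne', e1, feat_step good _ _ hj1 hj0, hr (.tmp 2) (by simp),
          r₄.frame (.tmp 2) (by simp), r₃.frame (.tmp 2) (by simp), e2]
        simp)
    (by intros; simp [RExp.eval, RExp.Ok, NExp.eval, NExp.Ok])
  have R₅ := R₄.seq r₅
  simp only [zero_add, Finset.range_zero, Finset.sum_empty, add_zero] at v₃ v₄ v₅
  obtain ⟨s₆, r₆, v₆, -⟩ := tab_runs Γ R₅.env (A := .tmp 6) (by simp) (by simp) h0 hm hc hN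
    (e₀ := zeroR) (e := .mul (cell (.tmp 4) sumI mN rowI) (cell (.tmp 3) sumI cN colI))
    (Γ.le_D' (y := Γ.c) (r' := N') (by ring) (by omega) hQ') (fun _ _ => 0)
    (fun i j k => feat Γ.L (fun _ => 1) (fun v => s.real X (k * Γ.c + v)) i *
      ∑ u ∈ Finset.range Γ.c, s.real X (k * Γ.c + u) * s.real WV (u * Γ.c + j))
    (by intros; simp [RExp.eval, RExp.Ok, NExp.eval, NExp.Ok])
    (by
      intro t i j k ht hr hi0 hj0 hk0 hi hj hk hi' hj' hk'
      simp [RExp.eval, RExp.Ok, NExp.eval, NExp.Ok, hi', hj', hk', hi, hj, hk, ht.dimC, hcV,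
        ht.len, hmV, hr, r₅.frame (.tmp 4) (by simp), r₅.frame (.tmp 3) (by simp),
        r₄.frame (.tmp 3) (by simp), v₄ k hk0 i hi0, v₃ k hk0 j hj0])
  have R₆ := R₅.seq r₆
  obtain ⟨s₇, r₇, v₇, -⟩ := tab_runs Γ R₆.env (A := .tmp 7) (by simp) (by simp) h0 hm h1 hN
    (e₀ := zeroR) (e := cell (.tmp 4) sumI mN rowI)
    (Γ.le_D' (y := 1) (r' := N') (by ring) (by omega) hQ') (fun _ _ => 0)
    (fun i _ k => feat Γ.L (fun _ => 1) (fun v => s.real X (k * Γ.c + v)) i)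
    (by intros; simp [RExp.eval, RExp.Ok, NExp.eval, NExp.Ok])
    (by
      intro t i j k ht hr hi0 hj0 hk0 hi hj hk hi' hj' hk'
      simp [RExp.eval, RExp.Ok, NExp.eval, NExp.Ok, hi', hk', hi, hk,
        ht.len, hmV, hr, r₆.frame (.tmp 4) (by simp), r₅.frame (.tmp 4) (by simp), v₄ k hk0 i hi0])
  have R₇ := R₆.seq r₇
  simp only [zero_add] at v₆ v₇
  obtain ⟨s₈, r₈, v₈, -⟩ := tab_runs Γ R₇.env (A := .tmp 8) (by simp) (by simp) h0 hnq h1 hm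
    (e₀ := zeroR) (e := .mul (cell (.tmp 5) rowI mN sumI) (.get (.tmp 7) sumI))
    (Γ.le_D' (y := 1) (r' := nq') (by ring) (by omega) hQ) (fun _ _ => 0)
    (fun i _ k => s₅.real (.tmp 5) (i * Γ.m + k) * s₇.real (.tmp 7) k)
    (by intros; simp [RExp.eval, RExp.Ok, NExp.eval, NExp.Ok])
    (by
      intro t i j k ht hr hi0 hj0 hk0 hi hj hk hi' hj' hk'
      simp [RExp.eval, RExp.Ok, NExp.eval, NExp.Ok, hi', hk', hi, hk,
        ht.len, hmV, hr, r₇.frame (.tmp 5) (by simp), r₆.frame (.tmp 5) (by simp)])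
  have R₈ := R₇.seq r₈
  obtain ⟨s₉, r₉, v₉, -⟩ := tab_runs Γ R₈.env (A := .tmp 9) (by simp) (by simp) h0 hnq hc hm
    (e₀ := zeroR) (e := .div (.mul (cell (.tmp 5) rowI mN sumI) (cell (.tmp 6) sumI cN colI))
        (.get (.tmp 8) rowI))
    (Γ.le_D' (y := Γ.c) (r' := nq') (by ring) (by omega) hQ) (fun _ _ => 0)
    (fun i j k => s₅.real (.tmp 5) (i * Γ.m + k) * s₆.real (.tmp 6) (k * Γ.c + j) /
      s₈.real (.tmp 8) i)
    (by intros; simp [RExp.eval, RExp.Ok, NExp.eval, NExp.Ok])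
    (by
      intro t i j k ht hr hi0 hj0 hk0 hi hj hk hi' hj' hk'
      simp [RExp.eval, RExp.Ok, NExp.eval, NExp.Ok, hi', hj', hk', hi, hj, hk, ht.dimC, hcV,
        ht.len, hmV, hr, r₈.frame (.tmp 5) (by simp), r₇.frame (.tmp 5) (by simp),
        r₆.frame (.tmp 5) (by simp), r₈.frame (.tmp 6) (by simp), r₇.frame (.tmp 6) (by simp)])
  refine ⟨s₉, R₈.seq r₉, fun i hi j hj => ?_⟩
  have e9 := v₉ i hi j hj
  have e8 := v₈ i hi 0 (by omega)
  simp only [zero_add, mul_one, add_zero] at e9 e8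
  rw [e9, ← Finset.sum_div, e8, flatAttn]
  have feats : ∀ k, ∑ m ∈ Finset.range Γ.m, s₅.real (.tmp 5) (i * Γ.m + m) *
      feat Γ.L (fun _ => 1) (fun v => s.real X (k * Γ.c + v)) m =
      truncExp Γ.g (flatScore Γ.c (s.real X) (s.real WQ) (s.real WK) (q' + i) k) := by
    intro k
    rw [flatScore, ← sum_feat_mul_feat]
    exact Finset.sum_congr rfl fun m hm => by rw [v₅ i hi m (Finset.mem_range.1 hm)]; rfl
  congr 1
  · calc _ = ∑ m ∈ Finset.range Γ.m, ∑ k ∈ Finset.range N', s₅.real (.tmp 5) (i * Γ.m + m) *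
          feat Γ.L (fun _ => 1) (fun v => s.real X (k * Γ.c + v)) m *
          ∑ u ∈ Finset.range Γ.c, s.real X (k * Γ.c + u) * s.real WV (u * Γ.c + j) :=
        Finset.sum_congr rfl fun m hm => by
          rw [v₆ m (Finset.mem_range.1 hm) j hj, Finset.mul_sum]
          exact Finset.sum_congr rfl fun k _ => by ring
      _ = _ := by
        rw [Finset.sum_comm]
        exact Finset.sum_congr rfl fun k _ => by rw [← Finset.sum_mul, feats]
  · calc _ = ∑ m ∈ Finset.range Γ.m, ∑ k ∈ Finset.range N', s₅.real (.tmp 5) (i * Γ.m + m) *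
          feat Γ.L (fun _ => 1) (fun v => s.real X (k * Γ.c + v)) m :=
        Finset.sum_congr rfl fun m hm => by
          have := v₇ m (Finset.mem_range.1 hm) 0 (by omega)
          simp only [mul_one, add_zero] at this
          rw [this, Finset.mul_sum]
      _ = _ := by
        rw [Finset.sum_comm]
        exact Finset.sum_congr rfl fun k _ => feats k

/-! ### From flat arrays to token maps -/

/-- The attention layer with the truncated exponential in place of the exponential. -/
noncomputable def polyAttn {ι : Type*} [Fintype ι] {c : ℕ} (g : ℕ) (W : AttnWeights c)
    (X : Matrix ι (Fin c) ℝ) : Matrix ι (Fin c) ℝ :=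
  fun i l => (∑ j, truncExp g (scores W X i j) * (X * W.WV) j l) /
    ∑ j, truncExp g (scores W X i j)

/-- Polynomial attention in place of every attention layer. -/
noncomputable def polyLayers (n a K : ℕ) {c : ℕ} (g : ℕ) (M : Model c) : AttnLayers n a K c where
  ar i := polyAttn g (M.scale i).ar
  fm i := polyAttn g (M.scale i).fm

theorem flatScore_eq {ι : Type*} {c : ℕ} {W : AttnWeights c} {X : Matrix ι (Fin c) ℝ}
    {A WQ WK : ℕ → ℝ} {e : ι → ℕ} (hA : ∀ i (l : Fin c), A (e i * c + l) = X i l)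
    (hQ : HoldsMat WQ W.WQ) (hK : HoldsMat WK W.WK) (i k : ι) :
    flatScore c A WQ WK (e i) (e k) = scores W X i k := by
  simp only [flatScore, scores, Matrix.mul_apply, Matrix.transpose_apply, Finset.sum_range, hA]
  refine Finset.sum_congr rfl fun v _ => ?_
  congr 1
  refine Finset.sum_congr rfl fun t _ => ?_
  rw [hK v t]
  congr 1
  exact Finset.sum_congr rfl fun u _ => by rw [hQ u t]

theorem flatAttn_eq {ι : Type*} [Fintype ι] {c g N : ℕ} {W : AttnWeights c}
    {X : Matrix ι (Fin c) ℝ} {A WQ WK WV : ℕ → ℝ} {e : ι → ℕ}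
    (he : ∀ f : ℕ → ℝ, ∑ k ∈ Finset.range N, f k = ∑ i, f (e i))
    (hA : ∀ i (l : Fin c), A (e i * c + l) = X i l)
    (hQ : HoldsMat WQ W.WQ) (hK : HoldsMat WK W.WK) (hV : HoldsMat WV W.WV) (i : ι) (l : Fin c) :
    flatAttn g c N A WQ WK WV (e i) l = polyAttn g W X i l := by
  rw [flatAttn, he, he, polyAttn]
  congr 1
  · refine Finset.sum_congr rfl fun k _ => ?_
    rw [flatScore_eq hA hQ hK, Finset.sum_range, Matrix.mul_apply]
    congr 1
    exact Finset.sum_congr rfl fun u _ => by rw [hA, hV]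
  · exact Finset.sum_congr rfl fun k _ => by rw [flatScore_eq hA hQ hK]

/-- The position of a token in the row-major order. -/
def gridIdx {m : ℕ} (p : Fin m × Fin m) : ℕ := (p.1 : ℕ) * m + p.2

theorem gridIdx_lt {m : ℕ} (p : Fin m × Fin m) : gridIdx p < m * m := by
  obtain ⟨x, y⟩ := p
  have h : ((x : ℕ) + 1) * m ≤ m * m := Nat.mul_le_mul_right _ x.2
  rw [add_mul] at h
  have := y.2
  simp only [gridIdx]
  omega

theorem sum_gridIdx (m : ℕ) (f : ℕ → ℝ) :
    ∑ k ∈ Finset.range (m * m), f k = ∑ p : Fin m × Fin m, f (gridIdx p) := by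
  rw [Finset.sum_range, ← finProdFinEquiv.sum_comp]
  refine Finset.sum_congr rfl fun p _ => ?_
  simp only [finProdFinEquiv, Equiv.coe_fn_mk, gridIdx]
  congr 1
  ring

theorem holdsGrid_iff {m c : ℕ} {A : ℕ → ℝ} {X : Grid m c} :
    HoldsGrid A X ↔ ∀ p (l : Fin c), A (gridIdx p * c + l) = X p l :=
  ⟨fun h p l => h p.1 p.2 l, fun h x y l => h (x, y) l⟩

/-- The number of tokens in the scales before scale `i`. -/
def offset (n a K : ℕ) : ℕ → ℕ
  | 0 => 0
  | i + 1 => offset n a K i + side n a K i * side n a K i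

/-- The position of a token in the flattened sequence. -/
def seqIdx {n a K i : ℕ} (p : SeqIdx n a K i) : ℕ := offset n a K p.1 + gridIdx p.2

theorem sum_offset (n a K i : ℕ) (f : ℕ → ℝ) :
    ∑ k ∈ Finset.range (offset n a K i), f k = ∑ j ∈ Finset.range i,
      ∑ k ∈ Finset.range (side n a K j * side n a K j), f (offset n a K j + k) := by
  induction i with
  | zero => simp [offset]
  | succ i ih => rw [offset, Finset.sum_range_add, ih, Finset.sum_range_succ]

theorem sum_seqIdx (n a K i : ℕ) (f : ℕ → ℝ) :
    ∑ k ∈ Finset.range (offset n a K (i + 1)), f k = ∑ p : SeqIdx n a K i, f (seqIdx p) := by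
  rw [sum_offset, Fintype.sum_sigma, Finset.sum_range]
  refine Finset.sum_congr rfl fun j _ => ?_
  rw [sum_gridIdx]
  rfl

/-- The array `A` holds the sequence `Z`, scale by scale and row by row. -/
def HoldsSeq {n a K i c : ℕ} (A : ℕ → ℝ) (Z : Matrix (SeqIdx n a K i) (Fin c) ℝ) : Prop :=
  ∀ p (l : Fin c), A (seqIdx p * c + l) = Z p l

/-! ### The programs of the layers -/

section Tab

variable (Γ : Ctx) {D : ℕ} {s : Mem} {A : RName} {rows cols m : NExp} {e₀ e : RExp} {r c' m' : ℕ}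

/-- A tabulation that fills an array from its beginning. -/
theorem sum_runs (hs : Env Γ s) (hA₁ : A ≠ .tmp 21) (hA₂ : A ≠ .tmp 22)
    (hrows : IsVal Γ rows r) (hcols : IsVal Γ cols c') (hm : IsVal Γ m m')
    (hD : Nat.size Γ.V * (m' + 1) * (c' + 1) * (r + 1) ≤ D)
    (F₀ : ℕ → ℕ → ℝ) (F : ℕ → ℕ → ℕ → ℝ)
    (h₀ : ∀ t i j, Env Γ t → (∀ B, B ≠ A → t.real B = s.real B) → i < r → j < c' → i ≤ Γ.V →
      j ≤ Γ.V → t.nat (.tmp 0) 0 = i → t.nat (.tmp 1) 0 = j → e₀.eval t = F₀ i j ∧ e₀.Ok Γ.V t)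
    (h₁ : ∀ t i j k, Env Γ t → (∀ B, B ≠ A → t.real B = s.real B) → i < r → j < c' → k < m' →
      i ≤ Γ.V → j ≤ Γ.V → k ≤ Γ.V → t.nat (.tmp 0) 0 = i → t.nat (.tmp 1) 0 = j →
      t.nat (.tmp 2) 0 = k → e.eval t = F i j k ∧ e.Ok Γ.V t) :
    ∃ s', Runs Γ D (tab A (.const 0) rows cols e₀ m e) s s' [A] ∧
      ∀ i < r, ∀ j < c', s'.real A (i * c' + j) = F₀ i j + ∑ k ∈ Finset.range m', F i j k := by
  obtain ⟨s', h, h', -⟩ := tab_runs Γ hs hA₁ hA₂ (isVal_const Γ (Nat.zero_le _)) hrows hcols hm hD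
    F₀ F (fun t i j a1 a2 a3 a4 a5 a6 a7 a8 _ => h₀ t i j a1 a2 a3 a4 a5 a6 a7 a8) h₁
  exact ⟨s', h, fun i hi j hj => by simpa using h' i hi j hj⟩

/-- A tabulation without summation. -/
theorem map_runs (hs : Env Γ s) (hA₁ : A ≠ .tmp 21) (hA₂ : A ≠ .tmp 22)
    (hrows : IsVal Γ rows r) (hcols : IsVal Γ cols c')
    (hD : Nat.size Γ.V * (0 + 1) * (c' + 1) * (r + 1) ≤ D)
    (F₀ : ℕ → ℕ → ℝ)
    (h₀ : ∀ t i j, Env Γ t → (∀ B, B ≠ A → t.real B = s.real B) → i < r → j < c' → i ≤ Γ.V →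
      j ≤ Γ.V → t.nat (.tmp 0) 0 = i → t.nat (.tmp 1) 0 = j → e₀.eval t = F₀ i j ∧ e₀.Ok Γ.V t) :
    ∃ s', Runs Γ D (tab A (.const 0) rows cols e₀ (.const 0) zeroR) s s' [A] ∧
      ∀ i < r, ∀ j < c', s'.real A (i * c' + j) = F₀ i j := by
  obtain ⟨s', h, h'⟩ := sum_runs Γ (e := zeroR) hs hA₁ hA₂ hrows hcols (isVal_const Γ
      (Nat.zero_le _)) hD
    F₀ (fun _ _ _ => 0) h₀ (by intros; simp [RExp.eval, RExp.Ok, NExp.eval, NExp.Ok])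
  exact ⟨s', h, fun i hi j hj => by simpa using h' i hi j hj⟩

end Tab

/-- The rectified linear unit, as `(x + √(x²)) / 2`. -/
abbrev reluR (e : RExp) : RExp := .div (.add e (.sqrt (.mul e e))) (.ofNat (.const 2))

theorem relu_eq (x : ℝ) : (x + Real.sqrt (x * x)) / 2 = max 0 x := by
  rw [Real.sqrt_mul_self_eq_abs]
  rcases le_total 0 x with h | h
  · rw [abs_of_nonneg h, max_eq_right h]; ring
  · rw [abs_of_nonpos h, max_eq_left h]; ring

theorem Runs.weaken {Γ : Ctx} {D : ℕ} {P : Prog} {s s' : Mem} {W W' : List RName}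
    (h : Runs Γ D P s s' W) (hW : ∀ B ∈ W, B ∈ W') : Runs Γ D P s s' W' :=
  { h with frame := fun B hB => h.frame B fun hB' => hB (hW B hB') }

/-- The working arrays other than those of the table of monomials. -/
def workArrays : List RName := (List.range 21).map .tmp

theorem mem_workArrays {k : ℕ} : RName.tmp k ∈ workArrays ↔ k < 21 := by
  simp [workArrays]

section Layers

variable {Γ : Ctx} {Q : ℕ} {s : Mem} {m a K : ℕ} {sq : NExp}

/-- The feed-forward layer, from `tmp 9` to `tmp 11`; the hidden layer is in `tmp 10`. -/
def ffnProg (i : ℕ) (sq : NExp) : Prog :=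
  .seq (tab (.tmp 10) (.const 0) sq cN (.get (.weight i .b₁) colI) cN
      (.mul (cell (.tmp 9) rowI cN sumI) (cell (.weight i .W₁) sumI cN colI)))
    (tab (.tmp 11) (.const 0) sq cN (.add (cell (.tmp 9) rowI cN colI) (.get (.weight i .b₂) colI))
      cN (.mul (reluR (cell (.tmp 10) rowI cN sumI)) (cell (.weight i .W₂) sumI cN colI)))

theorem ffnProg_runs (hs : Env Γ s) (hsq : IsVal Γ sq (m * m)) (hQ : m * m ≤ Q) {i : ℕ}
    {S : ScaleParams Γ.c} (hS : HoldsScale (fun w => s.real (.weight i w)) S) {X : Grid m Γ.c}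
    (hX : HoldsGrid (s.real (.tmp 9)) X) :
    ∃ s', Runs Γ (Γ.D Q) (ffnProg i sq) s s' [.tmp 10, .tmp 11] ∧
      HoldsGrid (s'.real (.tmp 11)) (ffn S.W₁ S.b₁ S.W₂ S.b₂ X) := by
  have hcV := Γ.c_le
  have h2V := Γ.two_le
  have hc := isVal_cN Γ
  obtain ⟨s₁, r₁, v₁⟩ := sum_runs Γ hs (A := .tmp 10) (by simp) (by simp) hsq hc hc
    (e₀ := .get (.weight i .b₁) colI)
    (e := .mul (cell (.tmp 9) rowI cN sumI) (cell (.weight i .W₁) sumI cN colI))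
    (Γ.le_D (by omega) (by omega) hQ) (fun _ j => s.real (.weight i .b₁) j)
    (fun i' j k => s.real (.tmp 9) (i' * Γ.c + k) * s.real (.weight i .W₁) (k * Γ.c + j))
    (by
      intro t i' j ht hr _ _ hi hj hi' hj'
      simp [RExp.eval, RExp.Ok, NExp.eval, NExp.Ok, hj', hj, hr])
    (by
      intro t i' j k ht hr _ _ _ hi hj hk hi' hj' hk'
      simp [RExp.eval, RExp.Ok, NExp.eval, NExp.Ok, hi', hj', hk', hi, hj, hk, ht.dimC, hcV, hr])
  obtain ⟨s₂, r₂, v₂⟩ := sum_runs Γ r₁.env (A := .tmp 11) (by simp) (by simp) hsq hc hc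
    (e₀ := .add (cell (.tmp 9) rowI cN colI) (.get (.weight i .b₂) colI))
    (e := .mul (reluR (cell (.tmp 10) rowI cN sumI)) (cell (.weight i .W₂) sumI cN colI))
    (Γ.le_D (by omega) (by omega) hQ)
    (fun i' j => s.real (.tmp 9) (i' * Γ.c + j) + s.real (.weight i .b₂) j)
    (fun i' j k => max 0 (s₁.real (.tmp 10) (i' * Γ.c + k)) *
      s.real (.weight i .W₂) (k * Γ.c + j))
    (by
      intro t i' j ht hr _ _ hi hj hi' hj'
      simp [RExp.eval, RExp.Ok, NExp.eval, NExp.Ok, hi', hi, hj', hj, hr, ht.dimC, hcV,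
        r₁.frame (.tmp 9) (by simp), r₁.frame (.weight i .b₂) (by simp)])
    (by
      intro t i' j k ht hr _ _ _ hi hj hk hi' hj' hk'
      simp [RExp.eval, RExp.Ok, NExp.eval, NExp.Ok, hi', hj', hk', hi, hj, hk, ht.dimC, hcV, hr,
        r₁.frame (.weight i .W₂) (by simp), relu_eq, h2V])
  refine ⟨s₂, r₁.seq r₂, holdsGrid_iff.2 fun p l => ?_⟩
  rw [holdsGrid_iff] at hX
  show _ = X p l + ((Matrix.of (fun s k => max 0 (mlp S.W₁ S.b₁ X s k)) * S.W₂) p l + S.b₂ l)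
  rw [v₂ _ (gridIdx_lt p) l l.2, hX p l, Matrix.mul_apply, Finset.sum_range, hS.b₂ l, add_assoc,
    add_comm (S.b₂ l)]
  congr 2
  refine Finset.sum_congr rfl fun k _ => ?_
  rw [v₁ _ (gridIdx_lt p) k k.2, hS.W₂ k l]
  show _ = max 0 ((X * S.W₁) p k + S.b₁ k) * S.W₂ k l
  rw [Matrix.mul_apply, Finset.sum_range, add_comm, hS.b₁ k]
  congr 3
  exact Finset.sum_congr rfl fun u _ => by rw [hX p u, hS.W₁ u k]

/-- The interpolation with the noise (`tmp 12`) and the six modulation parameters (`tmp 13`),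
computed from `tmp 11`. -/
def condProg (i : ℕ) (sq : NExp) : Prog :=
  .seq (tab (.tmp 12) (.const 0) sq cN (.add (.mul (.get .time (.const i))
      (cell (.tmp 11) rowI cN colI)) (.mul (.sub (.ofNat (.const 1)) (.get .time (.const i)))
        (cell (.noise i) rowI cN colI))) (.const 0) zeroR)
    (tab (.tmp 13) (.const 0) sq (.mul (.const 6) cN) (.get (.weight i .modB) colI) cN
      (.mul (.add (cell (.tmp 11) rowI cN sumI) (.get .time (.const i)))
        (cell (.weight i .modW) sumI (.mul (.const 6) cN) colI)))

theorem condProg_runs {i : ℕ} (hs : Env Γ s)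
    (hsq : IsVal Γ sq (side Γ.n a K i * side Γ.n a K i)) (hQ : side Γ.n a K i * side Γ.n a K i ≤ Q)
    (hi : i ≤ Γ.V) (h6 : 6 * Γ.c + 6 ≤ Γ.V)
    {R : ℝ} {M : Model Γ.c} {I : Input Γ.n a K Γ.c} (hI : Loaded s R M I) (hiK : i < K)
    {Y : Grid (side Γ.n a K i) Γ.c} (hY : HoldsGrid (s.real (.tmp 11)) Y) :
    ∃ s', Runs Γ (Γ.D Q) (condProg i sq) s s' [.tmp 12, .tmp 13] ∧
      HoldsGrid (s'.real (.tmp 12)) (interpolate I i Y) ∧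
      ∀ p (b : Fin 6) (l : Fin Γ.c), s'.real (.tmp 13) (gridIdx p * (6 * Γ.c) + (b * Γ.c + l)) =
        modulation M I i Y b p l := by
  have hcV := Γ.c_le
  have hS := hI.weights i hiK
  have ht0 := hI.time i hiK
  have hN := holdsGrid_iff.1 (hI.noise i hiK)
  have hc := isVal_cN Γ
  have hc6 : IsVal Γ (.mul (.const 6) cN) (6 * Γ.c) := ⟨by omega, fun t ht => by
    obtain ⟨b1, b2⟩ := hc.2 t ht
    exact ⟨by simp [NExp.eval, ht.dimC], show 6 ≤ Γ.V by omega, b2⟩⟩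
  obtain ⟨s₁, r₁, v₁⟩ := map_runs Γ hs (A := .tmp 12) (by simp) (by simp) hsq hc
    (e₀ := .add (.mul (.get .time (.const i))
      (cell (.tmp 11) rowI cN colI)) (.mul (.sub (.ofNat (.const 1)) (.get .time (.const i)))
        (cell (.noise i) rowI cN colI)))
    (Γ.le_D (by omega) (by omega) hQ) (fun i' j => s.real .time i * s.real (.tmp 11) (i' * Γ.c + j)
      + (1 - s.real .time i) * s.real (.noise i) (i' * Γ.c + j))
    (by
      intro t i' j ht hr _ _ hi0 hj hi' hj'
      have : 1 ≤ Γ.V := by omega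
      simp [RExp.eval, RExp.Ok, NExp.eval, NExp.Ok, hj', hj, hr, hi', hi0, ht.dimC, hcV, hi, this])
  obtain ⟨s₂, r₂, v₂⟩ := sum_runs Γ r₁.env (A := .tmp 13) (by simp) (by simp) hsq hc6 hc
    (e₀ := .get (.weight i .modB) colI)
    (e := .mul (.add (cell (.tmp 11) rowI cN sumI) (.get .time (.const i)))
        (cell (.weight i .modW) sumI (.mul (.const 6) cN) colI))
    (Γ.le_D (by omega) (by omega) hQ)
    (fun _ j => s.real (.weight i .modB) j)
    (fun i' j k => (s.real (.tmp 11) (i' * Γ.c + k) + s.real .time i) *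
      s.real (.weight i .modW) (k * (6 * Γ.c) + j))
    (by
      intro t i' j ht hr _ _ hi0 hj hi' hj'
      simp [RExp.eval, RExp.Ok, NExp.eval, NExp.Ok, hj', hj, hr,
        r₁.frame (.weight i .modB) (by simp)])
    (by
      intro t i' j k ht hr _ _ _ hi0 hj hk hi' hj' hk'
      have : 6 ≤ Γ.V := by omega
      simp [RExp.eval, RExp.Ok, NExp.eval, NExp.Ok, hi', hj', hk', hi0, hj, hk, ht.dimC, hcV, hr,
        r₁.frame (.weight i .modW) (by simp), r₁.frame (.tmp 11) (by simp),
        r₁.frame .time (by simp), this, hi])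
  rw [holdsGrid_iff] at hY
  refine ⟨s₂, r₁.seq r₂, holdsGrid_iff.2 fun p l => ?_, fun p b l => ?_⟩
  · rw [r₂.frame (.tmp 12) (by simp), v₁ _ (gridIdx_lt p) l l.2, hY p l, hN p l, ht0, interpolate]
  · have hbl : (b : ℕ) * Γ.c + l < 6 * Γ.c := by
      have h1 : ((b : ℕ) + 1) * Γ.c ≤ 6 * Γ.c := Nat.mul_le_mul_right _ b.2
      rw [add_mul] at h1
      have := l.2
      omega
    show _ = (Matrix.of (fun s k => Y s k + (I.time i : ℝ)) * (M.scale i).modW) p (b, l) +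
      (M.scale i).modB (b, l)
    rw [v₂ _ (gridIdx_lt p) _ hbl, Matrix.mul_apply, Finset.sum_range, add_comm, hS.modB b l]
    congr 1
    exact Finset.sum_congr rfl fun k _ => by
      rw [hY p k, ht0, hS.modW k b l, Matrix.of_apply]

/-- Layer normalization of the array `src`, scaled by the modulation parameter `γ` and shifted by
the modulation parameter `β`. The means are in `tmp 14`, the variances in `tmp 15`. -/
def normProg (src dst : RName) (γ β : ℕ) (sq : NExp) : Prog :=
  .seq (.seq (tab (.tmp 14) (.const 0) sq (.const 1) zeroR cN
      (.div (cell src rowI cN sumI) (.ofNat cN)))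
    (tab (.tmp 15) (.const 0) sq (.const 1) zeroR cN
      (.div (.mul (.sub (cell src rowI cN sumI) (.get (.tmp 14) rowI))
        (.sub (cell src rowI cN sumI) (.get (.tmp 14) rowI))) (.ofNat cN))))
    (tab dst (.const 0) sq cN (.add (.mul
      (cell (.tmp 13) rowI (.mul (.const 6) cN) (.add (.mul (.const γ) cN) colI))
      (.div (.sub (cell src rowI cN colI) (.get (.tmp 14) rowI)) (.sqrt (.get (.tmp 15) rowI))))
      (cell (.tmp 13) rowI (.mul (.const 6) cN) (.add (.mul (.const β) cN) colI)))
      (.const 0) zeroR)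

theorem normProg_runs {src dst : RName} (hs : Env Γ s) (hsq : IsVal Γ sq (m * m)) (hQ : m * m ≤ Q)
    (h6 : 6 * Γ.c + 6 ≤ Γ.V) (h1 : src ≠ .tmp 14) (h2 : src ≠ .tmp 15) (h3 : src ≠ dst)
    (h4 : dst ≠ .tmp 13) (h4' : dst ≠ .tmp 14) (h4'' : dst ≠ .tmp 15)
    (h5 : dst ≠ .tmp 21) (h5' : dst ≠ .tmp 22) {F : Grid m Γ.c} (hF : HoldsGrid (s.real src) F)
    {Mod : Fin 6 → Grid m Γ.c}
    (hMod : ∀ p (b : Fin 6) (l : Fin Γ.c), s.real (.tmp 13) (gridIdx p * (6 * Γ.c) +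
      (b * Γ.c + l)) = Mod b p l) (γ β : Fin 6) :
    ∃ s', Runs Γ (Γ.D Q) (normProg src dst γ β sq) s s' [.tmp 14, .tmp 15, dst] ∧
      HoldsGrid (s'.real dst) (fun p l => Mod γ p l * layerNorm F p l + Mod β p l) := by
  have hcV := Γ.c_le
  have hc := isVal_cN Γ
  have h1V := isVal_const Γ (show 1 ≤ Γ.V by omega)
  obtain ⟨s₁, r₁, v₁⟩ := sum_runs Γ hs (A := .tmp 14) (by simp) (by simp) hsq h1V hc
    (e₀ := zeroR) (e := .div (cell src rowI cN sumI) (.ofNat cN))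
    (Γ.le_D (by omega) (by omega) hQ) (fun _ _ => 0)
    (fun i _ k => s.real src (i * Γ.c + k) / Γ.c)
    (by intros; simp [RExp.eval, RExp.Ok, NExp.eval, NExp.Ok])
    (by
      intro t i j k ht hr _ _ _ hi hj hk hi' hj' hk'
      simp [RExp.eval, RExp.Ok, NExp.eval, NExp.Ok, hi', hk', hi, hk, ht.dimC, hcV, hr src h1])
  have mean : ∀ p : Fin m × Fin m, s₁.real (.tmp 14) (gridIdx p) = rowMean F p := fun p => by
    have := v₁ _ (gridIdx_lt p) 0 (by omega)
    simp only [mul_one, add_zero, zero_add] at this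
    rw [this, rowMean, Finset.sum_range, Finset.sum_div]
    exact Finset.sum_congr rfl fun k _ => by rw [holdsGrid_iff.1 hF p k]
  obtain ⟨s₂, r₂, v₂⟩ := sum_runs Γ r₁.env (A := .tmp 15) (by simp) (by simp) hsq h1V hc
    (e₀ := zeroR) (e := .div (.mul (.sub (cell src rowI cN sumI) (.get (.tmp 14) rowI))
        (.sub (cell src rowI cN sumI) (.get (.tmp 14) rowI))) (.ofNat cN))
    (Γ.le_D (by omega) (by omega) hQ) (fun _ _ => 0)
    (fun i _ k => (s.real src (i * Γ.c + k) - s₁.real (.tmp 14) i) *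
      (s.real src (i * Γ.c + k) - s₁.real (.tmp 14) i) / Γ.c)
    (by intros; simp [RExp.eval, RExp.Ok, NExp.eval, NExp.Ok])
    (by
      intro t i j k ht hr _ _ _ hi hj hk hi' hj' hk'
      simp [RExp.eval, RExp.Ok, NExp.eval, NExp.Ok, hi', hk', hi, hk, ht.dimC, hcV, hr src h2,
        hr (.tmp 14) (by simp), r₁.frame src (by simp [h1])])
  have var : ∀ p : Fin m × Fin m, s₂.real (.tmp 15) (gridIdx p) = rowVar F p := fun p => by
    have := v₂ _ (gridIdx_lt p) 0 (by omega)
    simp only [mul_one, add_zero, zero_add] at this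
    rw [this, rowVar, Finset.sum_range, Finset.sum_div]
    exact Finset.sum_congr rfl fun k _ => by rw [holdsGrid_iff.1 hF p k, mean, pow_two]
  have R₂ := r₁.seq r₂
  obtain ⟨s₃, r₃, v₃⟩ := map_runs Γ R₂.env (A := dst) h5 h5' hsq hc
    (e₀ := .add (.mul
      (cell (.tmp 13) rowI (.mul (.const 6) cN) (.add (.mul (.const (γ : ℕ)) cN) colI))
      (.div (.sub (cell src rowI cN colI) (.get (.tmp 14) rowI)) (.sqrt (.get (.tmp 15) rowI))))
      (cell (.tmp 13) rowI (.mul (.const 6) cN) (.add (.mul (.const (β : ℕ)) cN) colI)))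
    (Γ.le_D (by omega) (by omega) hQ)
    (fun i j => s.real (.tmp 13) (i * (6 * Γ.c) + (γ * Γ.c + j)) *
      ((s.real src (i * Γ.c + j) - s₁.real (.tmp 14) i) / Real.sqrt (s₂.real (.tmp 15) i)) +
      s.real (.tmp 13) (i * (6 * Γ.c) + (β * Γ.c + j)))
    (by
      intro t i j ht hr _ _ hi hj hi' hj'
      have : 6 ≤ Γ.V := by omega
      have g1 : (γ : ℕ) ≤ Γ.V := by omega
      have g2 : (β : ℕ) ≤ Γ.V := by omega
      simp [RExp.eval, RExp.Ok, NExp.eval, NExp.Ok, hi', hi, hj, hj', ht.dimC, hcV, hr src h3,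
        hr (.tmp 13) h4.symm, hr (.tmp 14) h4'.symm, hr (.tmp 15) h4''.symm,
        R₂.frame (.tmp 13) (by simp), R₂.frame src (by simp [h1, h2]),
        r₂.frame (.tmp 14) (by simp), this, g1, g2])
  refine ⟨s₃, R₂.seq r₃, holdsGrid_iff.2 fun p l => ?_⟩
  rw [v₃ _ (gridIdx_lt p) l l.2, hMod, hMod, mean, var, holdsGrid_iff.1 hF p l, layerNorm]

/-- The product of `src` and the modulation parameter `b`. -/
def scaleByProg (src dst : RName) (b : ℕ) (sq : NExp) : Prog :=
  tab dst (.const 0) sq cN (.mul (cell src rowI cN colI)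
    (cell (.tmp 13) rowI (.mul (.const 6) cN) (.add (.mul (.const b) cN) colI))) (.const 0) zeroR

theorem scaleByProg_runs {src dst : RName} (hs : Env Γ s) (hsq : IsVal Γ sq (m * m))
    (hQ : m * m ≤ Q) (h6 : 6 * Γ.c + 6 ≤ Γ.V) (h3 : src ≠ dst) (h4 : dst ≠ .tmp 13)
    (h5 : dst ≠ .tmp 21) (h5' : dst ≠ .tmp 22) {F : Grid m Γ.c} (hF : HoldsGrid (s.real src) F)
    {Mod : Fin 6 → Grid m Γ.c}
    (hMod : ∀ p (b : Fin 6) (l : Fin Γ.c), s.real (.tmp 13) (gridIdx p * (6 * Γ.c) +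
      (b * Γ.c + l)) = Mod b p l) (b : Fin 6) :
    ∃ s', Runs Γ (Γ.D Q) (scaleByProg src dst b sq) s s' [dst] ∧
      HoldsGrid (s'.real dst) (fun p l => F p l * Mod b p l) := by
  have hcV := Γ.c_le
  have hc := isVal_cN Γ
  obtain ⟨s₁, r₁, v₁⟩ := map_runs Γ hs (A := dst) h5 h5' hsq hc
    (e₀ := .mul (cell src rowI cN colI)
      (cell (.tmp 13) rowI (.mul (.const 6) cN) (.add (.mul (.const (b : ℕ)) cN) colI)))
    (Γ.le_D (by omega) (by omega) hQ)
    (fun i j => s.real src (i * Γ.c + j) * s.real (.tmp 13) (i * (6 * Γ.c) + (b * Γ.c + j)))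
    (by
      intro t i j ht hr _ _ hi hj hi' hj'
      have : 6 ≤ Γ.V := by omega
      have g1 : (b : ℕ) ≤ Γ.V := by omega
      simp [RExp.eval, RExp.Ok, NExp.eval, NExp.Ok, hi', hi, hj, hj', ht.dimC, hcV, hr src h3,
        hr (.tmp 13) h4.symm, this, g1])
  refine ⟨s₁, r₁, holdsGrid_iff.2 fun p l => ?_⟩
  rw [v₁ _ (gridIdx_lt p) l l.2, hMod, holdsGrid_iff.1 hF p l]

/-- The MLP layer at the end of a scale, from `tmp 18` to `tmp 19`. -/
def outMlpProg (i : ℕ) (sq : NExp) : Prog :=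
  tab (.tmp 19) (.const 0) sq cN (.get (.weight i .outB) colI) cN
    (.mul (cell (.tmp 18) rowI cN sumI) (cell (.weight i .outW) sumI cN colI))

theorem outMlpProg_runs (hs : Env Γ s) (hsq : IsVal Γ sq (m * m)) (hQ : m * m ≤ Q) {i : ℕ}
    {S : ScaleParams Γ.c} (hS : HoldsScale (fun w => s.real (.weight i w)) S) {X : Grid m Γ.c}
    (hX : HoldsGrid (s.real (.tmp 18)) X) :
    ∃ s', Runs Γ (Γ.D Q) (outMlpProg i sq) s s' [.tmp 19] ∧
      HoldsGrid (s'.real (.tmp 19)) (mlp S.outW S.outB X) := by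
  have hcV := Γ.c_le
  have hc := isVal_cN Γ
  obtain ⟨s₁, r₁, v₁⟩ := sum_runs Γ hs (A := .tmp 19) (by simp) (by simp) hsq hc hc
    (e₀ := .get (.weight i .outB) colI)
    (e := .mul (cell (.tmp 18) rowI cN sumI) (cell (.weight i .outW) sumI cN colI))
    (Γ.le_D (by omega) (by omega) hQ) (fun _ j => s.real (.weight i .outB) j)
    (fun i' j k => s.real (.tmp 18) (i' * Γ.c + k) * s.real (.weight i .outW) (k * Γ.c + j))
    (by
      intro t i' j ht hr _ _ hi hj hi' hj'
      simp [RExp.eval, RExp.Ok, NExp.eval, NExp.Ok, hj', hj, hr])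
    (by
      intro t i' j k ht hr _ _ _ hi hj hk hi' hj' hk'
      simp [RExp.eval, RExp.Ok, NExp.eval, NExp.Ok, hi', hj', hk', hi, hj, hk, ht.dimC, hcV, hr])
  refine ⟨s₁, r₁, holdsGrid_iff.2 fun p l => ?_⟩
  rw [v₁ _ (gridIdx_lt p) l l.2, mlp, Matrix.mul_apply, Finset.sum_range, add_comm, hS.outB l]
  congr 1
  exact Finset.sum_congr rfl fun u _ => by rw [holdsGrid_iff.1 hX p u, hS.outW u l]

end Layers

/-! ### The program of the pipeline -/

/-- The side of the token map of scale `j`. -/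
def sideN (a K j : ℕ) : NExp := .div (.get .dimN (.const 0)) (.const (a ^ (K - 1 - j)))
/-- The number of tokens of scale `j`. -/
def sqN (a K j : ℕ) : NExp := .mul (sideN a K j) (sideN a K j)
/-- The number of tokens of the scales before scale `j`. -/
def offN (a K : ℕ) : ℕ → NExp
  | 0 => .const 0
  | j + 1 => .add (offN a K j) (sqN a K j)

/-- The size conditions under which the bound `V` suffices for the pipeline. -/
structure Ctx.Fits (Γ : Ctx) (a K : ℕ) : Prop where
  one_le_a : 1 ≤ a
  offset_le : offset Γ.n a K K * (Γ.c + 1) ≤ Γ.V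
  pow_le : a ^ K ≤ Γ.V
  K_le : K + 16 ≤ Γ.V
  c_le : 6 * Γ.c + 6 ≤ Γ.V
  side_pos : ∀ j, 1 ≤ side Γ.n a K j

section

variable {Γ : Ctx} {a K : ℕ} (hΓ : Γ.Fits a K)

theorem offset_mono (n a K : ℕ) : Monotone (offset n a K) :=
  monotone_nat_of_le_succ fun _ => Nat.le_add_right _ _

theorem sq_le_offset {n a K i : ℕ} (hi : i < K) :
    side n a K i * side n a K i ≤ offset n a K K :=
  (Nat.le_add_left _ (offset n a K i)).trans (offset_mono n a K hi)

include hΓ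

theorem Ctx.Fits.offset_le_V {i : ℕ} (hi : i ≤ K) : offset Γ.n a K i ≤ Γ.V :=
  ((offset_mono Γ.n a K hi).trans (Nat.le_mul_of_pos_right _ (Nat.succ_pos _))).trans hΓ.offset_le

theorem isVal_sideN {j : ℕ} (hj : j < K) : IsVal Γ (sideN a K j) (side Γ.n a K j) := by
  have h1 : side Γ.n a K j ≤ Γ.V := (Nat.div_le_self _ _).trans Γ.n_le
  refine ⟨h1, fun t ht => ?_⟩
  have h2 : a ^ (K - 1 - j) ≤ Γ.V :=
    (Nat.pow_le_pow_right hΓ.one_le_a (by omega)).trans hΓ.pow_le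
  simp [sideN, NExp.eval, NExp.Ok, ht.dimN, side, Γ.n_le, h2]

theorem isVal_sqN {j : ℕ} (hj : j < K) :
    IsVal Γ (sqN a K j) (side Γ.n a K j * side Γ.n a K j) :=
  ⟨(sq_le_offset hj).trans (hΓ.offset_le_V le_rfl), fun t ht => by
    obtain ⟨h1, h2⟩ := (isVal_sideN hΓ hj).2 t ht
    exact ⟨by rw [sqN, NExp.eval, h1], h2, h2⟩⟩

theorem isVal_offN {j : ℕ} (hj : j ≤ K) : IsVal Γ (offN a K j) (offset Γ.n a K j) := by
  induction j with
  | zero => exact isVal_const Γ (Nat.zero_le _)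
  | succ j ih =>
    refine ⟨hΓ.offset_le_V hj, fun t ht => ?_⟩
    obtain ⟨h1, h2⟩ := (ih (by omega)).2 t ht
    obtain ⟨h3, h4⟩ := (isVal_sqN hΓ hj).2 t ht
    exact ⟨by rw [offN, NExp.eval, h1, h3, offset], h2, h4⟩

end

theorem Loaded.of_runs {Γ : Ctx} {D a K : ℕ} {P : Prog} {s s' : Mem} {W : List RName} {R : ℝ}
    {M : Model Γ.c} {I : Input Γ.n a K Γ.c} (h : Loaded s R M I) (r : Runs Γ D P s s' W)
    (hW : ∀ B ∈ W, B ∈ workArrays) : Loaded s' R M I := by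
  have key : ∀ B, (∀ k, B ≠ .tmp k) → s'.real B = s.real B := fun B hB =>
    r.frame B fun hB' => by
      obtain ⟨k, -, hk⟩ := List.mem_map.1 (hW B hB')
      exact hB k hk.symm
  constructor
  · exact r.env.dimN
  · exact r.env.dimC
  · rw [key _ (by simp)]; exact h.bound
  · rw [key _ (by simp)]; exact h.kernel
  · rw [key _ (by simp)]; exact h.zInit
  · rw [key _ (by simp)]; exact h.time
  · intro i hi; rw [key _ (by simp)]; exact h.noise i hi
  · intro i hi
    have : (fun w => s'.real (.weight i w)) = fun w => s.real (.weight i w) :=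
      funext fun w => key _ (by simp)
    rw [this]; exact h.weights i hi

/-- All the computations of scale `i`. The sequence of tokens is in `tmp 0`, the result is in
`tmp 20`. -/
def scaleProg (a K i : ℕ) : Prog :=
  .seq (.seq (.seq (.seq (.seq (.seq (.seq (.seq
    (attnProg (.tmp 0) (offN a K i) (sqN a K i) (offN a K (i + 1))
      (.weight i .arQ) (.weight i .arK) (.weight i .arV))
    (ffnProg i (sqN a K i)))
    (condProg i (sqN a K i)))
    (normProg (.tmp 12) (.tmp 16) 4 2 (sqN a K i)))
    (attnProg (.tmp 16) (.const 0) (sqN a K i) (sqN a K i)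
      (.weight i .fmQ) (.weight i .fmK) (.weight i .fmV)))
    (scaleByProg (.tmp 9) (.tmp 17) 0 (sqN a K i)))
    (normProg (.tmp 17) (.tmp 18) 5 3 (sqN a K i)))
    (outMlpProg i (sqN a K i)))
    (scaleByProg (.tmp 19) (.tmp 20) 1 (sqN a K i))

/-- The real arrays written by the computations of a scale. -/
abbrev scaleTmp : List RName :=
  attnTmp ++ [.tmp 10, .tmp 11] ++ [.tmp 12, .tmp 13] ++ [.tmp 14, .tmp 15, .tmp 16] ++ attnTmp ++
    [.tmp 17] ++ [.tmp 14, .tmp 15, .tmp 18] ++ [.tmp 19] ++ [.tmp 20]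

/-- One scale of the pipeline with polynomial attention. -/
theorem scaleProg_runs {Γ : Ctx} {a K i : ℕ} (hΓ : Γ.Fits a K) (hi : i < K) {s : Mem}
    (hs : Env Γ s) {R : ℝ} {M : Model Γ.c} {I : Input Γ.n a K Γ.c} (hI : Loaded s R M I)
    (hZ : HoldsSeq (s.real (.tmp 0)) (zSeq M I (polyLayers Γ.n a K Γ.g M) i)) :
    ∃ s', Runs Γ (Γ.D (offset Γ.n a K K)) (scaleProg a K i) s s' scaleTmp ∧
      HoldsGrid (s'.real (.tmp 20)) (yTilde M I (polyLayers Γ.n a K Γ.g M) i) := by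
  set A := polyLayers Γ.n a K Γ.g M with hA
  set m := side Γ.n a K i with hm
  have hsq := isVal_sqN hΓ hi
  have hQ := sq_le_offset (n := Γ.n) (a := a) hi
  have h6 := hΓ.c_le
  have hiV : i ≤ Γ.V := by have := hΓ.K_le; omega
  have hW := hI.weights i hi
  obtain ⟨s₁, r₁, v₁⟩ := attnProg_runs Γ hs (X := .tmp 0) (WQ := .weight i .arQ)
    (WK := .weight i .arK) (WV := .weight i .arV) (by simp) (by simp) (by simp) (by simp)
    (isVal_offN hΓ hi.le) hsq (isVal_offN hΓ (Nat.succ_le_of_lt hi)) hQ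
    (offset_mono _ _ _ (Nat.succ_le_of_lt hi))
  have w₁ : HoldsGrid (s₁.real (.tmp 9)) (fun p => A.ar i (zSeq M I A i) ⟨Fin.last i, p⟩) :=
    holdsGrid_iff.2 fun p l => by
      rw [v₁ _ (gridIdx_lt p) l l.2]
      exact flatAttn_eq (e := seqIdx) (sum_seqIdx Γ.n a K i) hZ hW.arQ hW.arK hW.arV
        ⟨Fin.last i, p⟩ l
  have I₁ := hI.of_runs r₁ (by simp [mem_workArrays])
  obtain ⟨s₂, r₂, v₂⟩ := ffnProg_runs r₁.env hsq hQ (I₁.weights i hi) w₁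
  have w₂ : HoldsGrid (s₂.real (.tmp 11)) (yHat M I A i) := v₂
  have R₂ := r₁.seq r₂
  have I₂ := I₁.of_runs r₂ (by simp [mem_workArrays])
  obtain ⟨s₃, r₃, v₃, v₃'⟩ := condProg_runs R₂.env hsq hQ hiV h6 I₂ hi w₂
  have R₃ := R₂.seq r₃
  have I₃ := I₂.of_runs r₃ (by simp [mem_workArrays])
  obtain ⟨s₄, r₄, v₄⟩ := normProg_runs (src := .tmp 12) (dst := .tmp 16) R₃.env hsq hQ h6 (by simp)
    (by simp) (by simp) (by simp) (by simp) (by simp) (by simp) (by simp) v₃ v₃' 4 2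
  have R₄ := R₃.seq r₄
  have I₄ := I₃.of_runs r₄ (by simp [mem_workArrays])
  have W₄ := I₄.weights i hi
  obtain ⟨s₅, r₅, v₅⟩ := attnProg_runs Γ R₄.env (X := .tmp 16) (WQ := .weight i .fmQ)
    (WK := .weight i .fmK) (WV := .weight i .fmV) (by simp) (by simp) (by simp) (by simp)
    (isVal_const Γ (Nat.zero_le _)) hsq hsq hQ hQ
  have w₅ : HoldsGrid (s₅.real (.tmp 9)) (A.fm i (flowAttnIn M I i (yHat M I A i)
      (interpolate I i (yHat M I A i)))) := holdsGrid_iff.2 fun p l => by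
    rw [v₅ _ (gridIdx_lt p) l l.2, zero_add]
    exact flatAttn_eq (e := gridIdx) (sum_gridIdx m) (holdsGrid_iff.1 v₄) W₄.fmQ W₄.fmK W₄.fmV p l
  have R₅ := R₄.seq r₅
  have I₅ := I₄.of_runs r₅ (by simp [mem_workArrays])
  have w₅' := v₃'
  rw [← r₄.frame (.tmp 13) (by simp), ← r₅.frame (.tmp 13) (by simp)] at w₅'
  obtain ⟨s₆, r₆, v₆⟩ := scaleByProg_runs (src := .tmp 9) (dst := .tmp 17) R₅.env hsq hQ h6
    (by simp) (by simp) (by simp) (by simp) w₅ w₅' 0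
  have R₆ := R₅.seq r₆
  have I₆ := I₅.of_runs r₆ (by simp [mem_workArrays])
  have w₆' := w₅'
  rw [← r₆.frame (.tmp 13) (by simp)] at w₆'
  obtain ⟨s₇, r₇, v₇⟩ := normProg_runs (src := .tmp 17) (dst := .tmp 18) R₆.env hsq hQ h6 (by simp)
    (by simp) (by simp) (by simp) (by simp) (by simp) (by simp) (by simp) v₆ w₆' 5 3
  have R₇ := R₆.seq r₇
  have I₇ := I₆.of_runs r₇ (by simp [mem_workArrays])
  obtain ⟨s₈, r₈, v₈⟩ := outMlpProg_runs R₇.env hsq hQ (I₇.weights i hi) v₇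
  have R₈ := R₇.seq r₈
  have w₈' := w₆'
  rw [← r₇.frame (.tmp 13) (by simp), ← r₈.frame (.tmp 13) (by simp)] at w₈'
  obtain ⟨s₉, r₉, v₉⟩ := scaleByProg_runs (src := .tmp 19) (dst := .tmp 20) R₈.env hsq hQ h6
    (by simp) (by simp) (by simp) (by simp) v₈ w₈' 1
  refine ⟨s₉, R₈.seq r₉, ?_⟩
  rw [yTilde]
  exact v₉

/-- The smaller of `m - 1` and `q + s - 2`, with truncated subtraction. This is the position
`q + (s - 1)`, counted from `1` and clamped to `1, …, m`, as a position counted from `0`. -/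
def clampN (m q s : NExp) : NExp :=
  .sub (.sub m (.const 1)) (.sub (.sub m (.const 1)) (.sub (.add q s) (.const 2)))

/-- The row of the token number `rowI` of a token map of side `m`. -/
abbrev tokRow (m : NExp) : NExp := .div rowI m
/-- The column of the token number `rowI` of a token map of side `m`. -/
abbrev tokCol (m : NExp) : NExp := .sub rowI (.mul m (.div rowI m))
/-- The first index, shifted to `0, …, 3`, of the kernel position number `sumI < 16`. -/
abbrev kerRow : NExp := .div sumI (.const 4)
/-- The second index, shifted to `0, …, 3`, of the kernel position number `sumI < 16`. -/
abbrev kerCol : NExp := .sub sumI (.mul (.const 4) (.div sumI (.const 4)))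

/-- The upsampling of the result of scale `i`, appended to the sequence of tokens. -/
def upProg (a K i : ℕ) : Prog :=
  tab (.tmp 0) (.mul (offN a K (i + 1)) cN) (sqN a K (i + 1)) cN zeroR (.const 16)
    (.mul (.mul (.get .kernel kerRow) (.get .kernel kerCol))
      (cell (.tmp 20) (.add (.mul
        (clampN (sideN a K i) (.div (.add (tokRow (sideN a K (i + 1))) (.const 1)) (.const a))
          kerRow) (sideN a K i))
        (clampN (sideN a K i) (.div (.add (tokCol (sideN a K (i + 1))) (.const 1)) (.const a))
          kerCol)) cN colI))

/-- The sixteen kernel positions, numbered row by row. -/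
theorem sum_kernel (f : ℕ → ℕ → ℝ) :
    ∑ k ∈ Finset.range 16, f (k / 4) (k - 4 * (k / 4)) =
      ∑ s ∈ Finset.Icc (-1 : ℤ) 2, ∑ t ∈ Finset.Icc (-1 : ℤ) 2, f (s + 1).toNat (t + 1).toNat := by
  have : Finset.Icc (-1 : ℤ) 2 = {-1, 0, 1, 2} := by decide
  rw [this]
  simp [Finset.sum_range_succ]
  ring

theorem readClamped_eq {m c : ℕ} (hm : 1 ≤ m) {A : ℕ → ℝ} {X : Grid m c} (hX : HoldsGrid A X)
    (p q s t : ℕ) (l : Fin c) :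
    readClamped X ((p : ℤ) + ((s : ℤ) - 1)) ((q : ℤ) + ((t : ℤ) - 1)) l =
      A (((m - 1 - (m - 1 - (p + s - 2))) * m + (m - 1 - (m - 1 - (q + t - 2)))) * c + l) := by
  have key : ∀ p s : ℕ, (max 1 (min (m : ℤ) ((p : ℤ) + ((s : ℤ) - 1))) - 1).toNat =
      m - 1 - (m - 1 - (p + s - 2)) := by intro p s; omega
  have h1 : m - 1 - (m - 1 - (p + s - 2)) < m ∧ m - 1 - (m - 1 - (q + t - 2)) < m := by omega
  simp only [readClamped, key]
  rw [dif_pos h1]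
  exact (hX ⟨_, h1.1⟩ ⟨_, h1.2⟩ l).symm

theorem upProg_runs {Γ : Ctx} {a K i : ℕ} (hΓ : Γ.Fits a K) (hi : i + 1 < K) {s : Mem}
    (hs : Env Γ s) {R : ℝ} {M : Model Γ.c} {I : Input Γ.n a K Γ.c} (hI : Loaded s R M I)
    {A : AttnLayers Γ.n a K Γ.c} (hZ : HoldsSeq (s.real (.tmp 0)) (zSeq M I A i))
    (hY : HoldsGrid (s.real (.tmp 20)) (yTilde M I A i)) :
    ∃ s', Runs Γ (Γ.D (offset Γ.n a K K)) (upProg a K i) s s' [.tmp 0] ∧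
      HoldsSeq (s'.real (.tmp 0)) (zSeq M I A (i + 1)) := by
  have hcV := Γ.c_le
  have hc := isVal_cN Γ
  have hV : 16 ≤ Γ.V := by have := hΓ.K_le; omega
  have hoff : IsVal Γ (.mul (offN a K (i + 1)) cN) (offset Γ.n a K (i + 1) * Γ.c) := by
    refine ⟨(Nat.mul_le_mul (offset_mono _ _ _ hi.le) (Nat.le_succ _)).trans hΓ.offset_le,
      fun t ht => ?_⟩
    obtain ⟨h1, h2⟩ := (isVal_offN hΓ hi.le).2 t ht
    obtain ⟨h3, h4⟩ := hc.2 t ht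
    exact ⟨by rw [NExp.eval, h1, h3], h2, h4⟩
  have ha : a ≤ Γ.V := le_trans (by
    simpa using Nat.pow_le_pow_right hΓ.one_le_a (show 1 ≤ K by omega)) hΓ.pow_le
  set m := side Γ.n a K i with hm
  set m' := side Γ.n a K (i + 1) with hm'
  have hm1 : 1 ≤ m := hΓ.side_pos i
  obtain ⟨s', r, v, u⟩ := tab_runs Γ hs (A := .tmp 0) (by simp) (by simp) hoff
    (isVal_sqN hΓ hi) hc (isVal_const Γ hV) (e₀ := zeroR)
    (e := .mul (.mul (.get .kernel kerRow) (.get .kernel kerCol))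
      (cell (.tmp 20) (.add (.mul
        (clampN (sideN a K i) (.div (.add (tokRow (sideN a K (i + 1))) (.const 1)) (.const a))
          kerRow) (sideN a K i))
        (clampN (sideN a K i) (.div (.add (tokCol (sideN a K (i + 1))) (.const 1)) (.const a))
          kerCol)) cN colI))
    (Γ.le_D (by omega) (by omega) (sq_le_offset hi)) (fun _ _ => 0)
    (fun x j k => s.real .kernel (k / 4) * s.real .kernel (k - 4 * (k / 4)) *
      s.real (.tmp 20) (((m - 1 - (m - 1 - ((x / m' + 1) / a + k / 4 - 2))) * m +
        (m - 1 - (m - 1 - ((x - m' * (x / m') + 1) / a + (k - 4 * (k / 4)) - 2)))) * Γ.c + j))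
    (by intros; simp [RExp.eval, RExp.Ok, NExp.eval, NExp.Ok])
    (by
      intro t x j k ht hr _ _ _ hx hj hk hx' hj' hk'
      obtain ⟨a1, a2⟩ := (isVal_sideN hΓ (show i < K by omega)).2 t ht
      obtain ⟨b1, b2⟩ := (isVal_sideN hΓ hi).2 t ht
      have e1 : 1 ≤ Γ.V := by omega
      have e2 : 2 ≤ Γ.V := by omega
      have e4 : 4 ≤ Γ.V := by omega
      simp [RExp.eval, RExp.Ok, NExp.eval, NExp.Ok, clampN, hx', hj', hk', hx, hj, hk, ht.dimC,
        hcV, a1, a2, b1, b2, hr, e1, e2, e4, ha, ← hm, ← hm'])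
  refine ⟨s', r, fun p l => ?_⟩
  obtain ⟨⟨j, hj⟩, p⟩ := p
  rcases Nat.lt_succ_iff_lt_or_eq.1 hj with hlt | rfl
  · -- a token of an earlier scale
    have h1 : seqIdx (⟨⟨j, hj⟩, p⟩ : SeqIdx Γ.n a K (i + 1)) + 1 ≤ offset Γ.n a K (i + 1) :=
      le_trans (Nat.add_lt_add_left (gridIdx_lt p) _) (offset_mono Γ.n a K hlt)
    have h2 := Nat.mul_le_mul_right Γ.c h1
    rw [add_mul, one_mul] at h2
    rw [u _ (lt_of_lt_of_le (Nat.add_lt_add_left l.2 _) h2)]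
    have h3 := hZ ⟨⟨j, hlt⟩, p⟩ l
    refine h3.trans ?_
    cases j <;> rfl
  · -- a token of the new scale
    have h1 := v _ (gridIdx_lt p) l l.2
    have h2 : seqIdx (⟨⟨i + 1, hj⟩, p⟩ : SeqIdx Γ.n a K (i + 1)) * Γ.c + l =
        offset Γ.n a K (i + 1) * Γ.c + (gridIdx p * Γ.c + l) := by
      simp only [seqIdx, add_mul]; omega
    have hp : gridIdx p / m' = p.1 ∧ gridIdx p - m' * (p.1 : ℕ) = p.2 := by
      have := p.2.2
      constructor
      · rw [gridIdx, mul_comm, Nat.mul_add_div (by omega), Nat.div_eq_of_lt this, add_zero]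
      · rw [gridIdx, mul_comm m']; exact Nat.add_sub_cancel_left _ _
    rw [h2, h1, hp.1, hp.2, zero_add,
      sum_kernel fun x y => s.real .kernel x * s.real .kernel y * s.real (.tmp 20)
        (((m - 1 - (m - 1 - (((p.1 : ℕ) + 1) / a + x - 2))) * m +
        (m - 1 - (m - 1 - (((p.2 : ℕ) + 1) / a + y - 2)))) * Γ.c + l)]
    show _ = upsample M.kernel a (yTilde M I A i) p l
    rw [upsample]
    refine Finset.sum_congr rfl fun x hx => Finset.sum_congr rfl fun y hy => ?_
    rw [Finset.mem_Icc] at hx hy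
    obtain ⟨x, rfl⟩ : ∃ x' : ℕ, x = (x' : ℤ) - 1 := ⟨(x + 1).toNat, by omega⟩
    obtain ⟨y, rfl⟩ : ∃ y' : ℕ, y = (y' : ℤ) - 1 := ⟨(y + 1).toNat, by omega⟩
    rw [readClamped_eq hm1 hY, sub_add_cancel, sub_add_cancel, Int.toNat_natCast,
      Int.toNat_natCast, hI.kernel x (by omega), hI.kernel y (by omega)]
    push_cast
    rfl

/-- The computation of the scales `0, …, i`. -/
def scalesProg (a K : ℕ) : ℕ → Prog
  | 0 => .seq (tab (.tmp 0) (.const 0) (sqN a K 0) cN (cell .zInit rowI cN colI) (.const 0) zeroR)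
      (scaleProg a K 0)
  | i + 1 => .seq (.seq (scalesProg a K i) (upProg a K i)) (scaleProg a K (i + 1))

theorem scalesProg_runs {Γ : Ctx} {a K i : ℕ} (hΓ : Γ.Fits a K) (hi : i < K) {s : Mem}
    (hs : Env Γ s) {R : ℝ} {M : Model Γ.c} {I : Input Γ.n a K Γ.c} (hI : Loaded s R M I) :
    ∃ s', Runs Γ (Γ.D (offset Γ.n a K K)) (scalesProg a K i) s s' workArrays ∧
      HoldsSeq (s'.real (.tmp 0)) (zSeq M I (polyLayers Γ.n a K Γ.g M) i) ∧
      HoldsGrid (s'.real (.tmp 20)) (yTilde M I (polyLayers Γ.n a K Γ.g M) i) := by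
  induction i with
  | zero =>
    obtain ⟨s₁, r₁, v₁⟩ := map_runs Γ hs (A := .tmp 0) (by simp) (by simp) (isVal_sqN hΓ hi)
      (isVal_cN Γ) (e₀ := cell .zInit rowI cN colI)
      (Γ.le_D (by omega) (by omega) (sq_le_offset hi)) (fun x j => s.real .zInit (x * Γ.c + j))
      (by
        intro t x j ht hr _ _ hx hj hx' hj'
        simp [RExp.eval, RExp.Ok, NExp.eval, NExp.Ok, hx', hj', hx, hj, ht.dimC, Γ.c_le, hr])
    have hZ : HoldsSeq (s₁.real (.tmp 0)) (zSeq M I (polyLayers Γ.n a K Γ.g M) 0) := by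
      rintro ⟨⟨j, hj⟩, p⟩ l
      obtain rfl : j = 0 := by omega
      have : seqIdx (⟨⟨0, hj⟩, p⟩ : SeqIdx Γ.n a K 0) = gridIdx p := by simp [seqIdx, offset]
      rw [this, v₁ _ (gridIdx_lt p) l l.2, holdsGrid_iff.1 hI.zInit p l]
      rfl
    have I₁ := hI.of_runs r₁ (by simp [mem_workArrays])
    obtain ⟨s₂, r₂, v₂⟩ := scaleProg_runs hΓ hi r₁.env I₁ hZ
    refine ⟨s₂, (r₁.seq r₂).weaken (by simp [mem_workArrays]), ?_, v₂⟩
    rw [r₂.frame (.tmp 0) (by simp)]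
    exact hZ
  | succ i ih =>
    obtain ⟨s₁, r₁, z₁, y₁⟩ := ih (by omega)
    have I₁ := hI.of_runs r₁ (fun _ h => h)
    obtain ⟨s₂, r₂, z₂⟩ := upProg_runs hΓ hi r₁.env I₁ z₁ y₁
    have I₂ := I₁.of_runs r₂ (by simp [mem_workArrays])
    obtain ⟨s₃, r₃, v₃⟩ := scaleProg_runs hΓ hi r₂.env I₂ z₂
    refine ⟨s₃, ((r₁.seq r₂).seq r₃).weaken ?_, ?_, v₃⟩
    · intro B hB
      rw [List.mem_append, List.mem_append] at hB
      rcases hB with (hB | hB) | hB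
      · exact hB
      · revert B; simp [mem_workArrays]
      · revert B; simp [mem_workArrays]
    · rw [r₃.frame (.tmp 0) (by simp)]
      exact z₂

/-- All scales, followed by the copy of the last result to the output array. -/
def pipelineProg (a K : ℕ) : Prog :=
  .seq (scalesProg a K (K - 1))
    (tab .out (.const 0) (sqN a K (K - 1)) cN (cell (.tmp 20) rowI cN colI) (.const 0) zeroR)

/-- The program computes the pipeline with polynomial attention. -/
theorem pipelineProg_spec {Γ : Ctx} {a K : ℕ} (hΓ : Γ.Fits a K) (hK : 1 ≤ K) {s : Mem}
    (hs : Env Γ s) {R : ℝ} {M : Model Γ.c} {I : Input Γ.n a K Γ.c} (hI : Loaded s R M I) :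
    readOut _ _ ((pipelineProg a K).exec s).1 = output M I (polyLayers Γ.n a K Γ.g M) ∧
      ((pipelineProg a K).exec s).2 ≤ (pipelineProg a K).wt * Γ.D (offset Γ.n a K K) := by
  have hi : K - 1 < K := by omega
  obtain ⟨s₁, r₁, -, y₁⟩ := scalesProg_runs hΓ hi hs hI
  obtain ⟨s₂, r₂, v₂⟩ := map_runs Γ r₁.env (A := .out) (by simp) (by simp) (isVal_sqN hΓ hi)
    (isVal_cN Γ) (e₀ := cell (.tmp 20) rowI cN colI)
    (Γ.le_D (by omega) (by omega) (sq_le_offset hi)) (fun x j => s₁.real (.tmp 20) (x * Γ.c + j))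
    (by
      intro t x j ht hr _ _ hx hj hx' hj'
      simp [RExp.eval, RExp.Ok, NExp.eval, NExp.Ok, hx', hj', hx, hj, ht.dimC, Γ.c_le, hr])
  have R₂ := r₁.seq r₂
  refine ⟨?_, R₂.cost⟩
  rw [show ((pipelineProg a K).exec s).1 = s₂ from R₂.exec]
  funext p l
  exact (v₂ _ (gridIdx_lt p) l l.2).trans (holdsGrid_iff.1 y₁ p l)

/-! ### The choice of the degree -/

/-- The power `n ^ P`. -/
def powN : ℕ → NExp
  | 0 => .const 1
  | P + 1 => .mul (powN P) (.get .dimN (.const 0))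

theorem powN_eval {V : ℕ} (hV : 2 ≤ V) {s : Mem} {n : ℕ} (hs : s.nat .dimN 0 = n) (hn : n ≤ V)
    (P : ℕ) : (powN P).eval s = n ^ P ∧ (powN P).Ok V s := by
  induction P with
  | zero => exact ⟨by simp [powN, NExp.eval], show 1 ≤ V by omega⟩
  | succ P ih =>
    refine ⟨by rw [powN, NExp.eval, ih.1, pow_succ]; simp [NExp.eval, hs], ih.2, ?_⟩
    simp [NExp.Ok, NExp.eval, hs, hn]

/-- The degree `g` suffices for arguments of absolute value at most `B` and precision `n ^ (-P)`. -/
def DegOK (n P : ℕ) (B : ℝ) (g : ℕ) : Prop := B ^ g / g.factorial * (n : ℝ) ^ P ≤ 1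

open Classical in
/-- The least sufficient degree, or `n` if no degree below `n` is sufficient. -/
noncomputable def degree (n P : ℕ) (B : ℝ) : ℕ :=
  Nat.find (⟨n, Or.inr rfl⟩ : ∃ g, DegOK n P B g ∨ g = n)

theorem degree_le (n P : ℕ) (B : ℝ) : degree n P B ≤ n := by
  classical exact Nat.find_min' _ (Or.inr rfl)

theorem degree_le_of_degOK {n P : ℕ} {B : ℝ} {g : ℕ} (h : DegOK n P B g) : degree n P B ≤ g := by
  classical exact Nat.find_min' _ (Or.inl h)

theorem degOK_degree {n P : ℕ} {B : ℝ} {g : ℕ} (h : DegOK n P B g) (hg : g < n) :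
    DegOK n P B (degree n P B) := by
  classical
  have h1 : DegOK n P B (degree n P B) ∨ degree n P B = n :=
    Nat.find_spec (⟨n, Or.inr rfl⟩ : ∃ g, DegOK n P B g ∨ g = n)
  exact h1.resolve_right fun h2 => by have := degree_le_of_degOK h; omega

/-- The loop that finds the degree `g`, in `tmp 8`. The array `tmp 23` keeps `B ^ g / g!`, where
`B = R ^ 2 + 1`; after `n` rounds the least sufficient degree has been reached, or `g = n`. -/
def degProg (P : ℕ) : Prog :=
  .seq (.seq (.setNat (.tmp 8) (.const 0) (.const 0))
    (.setReal (.tmp 23) (.const 0) (.ofNat (.const 1))))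
    (.loop (.tmp 0) (.get .dimN (.const 0))
      (.ifReal (.mul (.get (.tmp 23) (.const 0)) (.ofNat (powN P))) (.ofNat (.const 1)) .skip
        (.seq (.setNat (.tmp 8) (.const 0) (.add (.get (.tmp 8) (.const 0)) (.const 1)))
          (.setReal (.tmp 23) (.const 0) (.div (.mul (.get (.tmp 23) (.const 0))
            (.add (.mul (.get .bound (.const 0)) (.get .bound (.const 0))) (.ofNat (.const 1))))
            (.ofNat (.get (.tmp 8) (.const 0))))))))

/-- The preparation phase keeps the dimensions and all real arrays but some working arrays. -/
structure Kept (s t : Mem) : Prop where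
  dimN : t.nat .dimN 0 = s.nat .dimN 0
  dimC : t.nat .dimC 0 = s.nat .dimC 0
  real : ∀ B, (∀ k, B ≠ .tmp k) → t.real B = s.real B

theorem Kept.trans {s t u : Mem} (h : Kept s t) (h' : Kept t u) : Kept s u :=
  ⟨h'.dimN.trans h.dimN, h'.dimC.trans h.dimC, fun B hB => (h'.real B hB).trans (h.real B hB)⟩

theorem Kept.setNat {s t : Mem} (h : Kept s t) (i k v : ℕ) : Kept s (t.setNat (.tmp i) k v) :=
  ⟨by rw [Mem.setNat_nat_of_ne _ (by simp), h.dimN],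
    by rw [Mem.setNat_nat_of_ne _ (by simp), h.dimC], h.real⟩

theorem Kept.setReal {s t : Mem} (h : Kept s t) (i k : ℕ) (v : ℝ) :
    Kept s (t.setReal (.tmp i) k v) :=
  ⟨h.dimN, h.dimC, fun B hB => by rw [Mem.setReal_real_of_ne _ (hB i), h.real B hB]⟩

theorem degProg_spec {V n P : ℕ} (hV : 2 ≤ V) (hn : n ≤ V) {s : Mem} (hs : s.nat .dimN 0 = n) :
    Kept s ((degProg P).exec s).1 ∧
      ((degProg P).exec s).1.nat (.tmp 8) 0 = degree n P (s.real .bound 0 ^ 2 + 1) ∧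
      ((degProg P).exec s).2 ≤ (degProg P).wt * (Nat.size V * (n + 1)) := by
  classical
  have hS := one_le_size hV
  set B := s.real .bound 0 ^ 2 + 1 with hB
  let s₁ := (s.setNat (.tmp 8) 0 0).setReal (.tmp 23) 0 1
  have hs₁ : Kept s s₁ := (Kept.setNat ⟨rfl, rfl, fun _ _ => rfl⟩ 8 0 0).setReal 23 0 1
  have e₁ : ((Prog.seq (.setNat (.tmp 8) (.const 0) (.const 0))
      (.setReal (.tmp 23) (.const 0) (.ofNat (.const 1)))).exec s).1 = s₁ := by
    simp [Prog.exec, NExp.eval, RExp.eval, s₁]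
  have h := exec_loop (s := s₁) (x := .tmp 0) (e := .get .dimN (.const 0)) (v := n)
    (p := .ifReal (.mul (.get (.tmp 23) (.const 0)) (.ofNat (powN P))) (.ofNat (.const 1)) .skip
        (.seq (.setNat (.tmp 8) (.const 0) (.add (.get (.tmp 8) (.const 0)) (.const 1)))
          (.setReal (.tmp 23) (.const 0) (.div (.mul (.get (.tmp 23) (.const 0))
            (.add (.mul (.get .bound (.const 0)) (.get .bound (.const 0))) (.ofNat (.const 1))))
            (.ofNat (.get (.tmp 8) (.const 0)))))))
    hV (le_refl _)
    -- after `k` rounds, `g` is the least sufficient degree or `k`, whichever is smaller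
    (fun k t => Kept s t ∧ ∃ g ≤ k, t.nat (.tmp 8) 0 = g ∧
      t.real (.tmp 23) 0 = B ^ g / g.factorial ∧ (∀ g' < g, ¬ DegOK n P B g') ∧
      (DegOK n P B g ∨ g = k))
    (by simp [NExp.Ok, NExp.eval, hs₁.dimN, hs, hn]) (by simp [NExp.eval, hs₁.dimN, hs])
    ⟨hs₁, 0, le_rfl, by simp [s₁], by simp [s₁], by simp, Or.inr rfl⟩
    (by
      rintro k hk t ⟨ht, g, hgk, h1, h2, h3, h4⟩
      have ht' := ht.setNat 0 0 k
      set t' := t.setNat (.tmp 0) 0 k with ht'def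
      have h1' : t'.nat (.tmp 8) 0 = g := by
        rw [ht'def, Mem.setNat_nat_of_ne _ (by simp), h1]
      have h2' : t'.real (.tmp 23) 0 = B ^ g / g.factorial := h2
      obtain ⟨p1, p2⟩ := powN_eval hV (ht'.dimN.trans hs) hn P
      have hg1 : g + 1 ≤ V := by omega
      have c1 : 1 ≤ V := by omega
      have hbd : t'.real .bound = s.real .bound := ht'.real _ (by simp)
      have cond : (RExp.mul (.get (.tmp 23) (.const 0)) (.ofNat (powN P))).eval t' ≤
          (RExp.ofNat (.const 1)).eval t' ↔ DegOK n P B g := by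
        simp [RExp.eval, NExp.eval, h2', p1, DegOK]
      have ca := RExp.cost_le hV (s := t')
        (e := .mul (.get (.tmp 23) (.const 0)) (.ofNat (powN P))) ⟨Nat.zero_le _, p2⟩
      have cb := RExp.cost_le hV (s := t') (e := .ofNat (.const 1)) c1
      simp only [Prog.exec, Prog.wt, cond]
      by_cases hd : DegOK n P B g
      · simp only [if_pos hd]
        refine ⟨⟨ht', g, by omega, h1', h2', h3, Or.inl hd⟩, ?_⟩
        nlinarith
      · simp only [if_neg hd]
        have cc := cost_setNat_le hV (le_refl _) (s := t') (x := .tmp 8) (k := .const 0)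
          (e := .add (.get (.tmp 8) (.const 0)) (.const 1)) (Nat.zero_le _)
          (by simp [NExp.Ok, NExp.eval, h1', c1]; omega)
        have cd := cost_setReal_le hV (le_refl _) (s := t'.setNat (.tmp 8) 0 (g + 1))
          (x := .tmp 23) (k := .const 0) (e := .div (.mul (.get (.tmp 23) (.const 0))
            (.add (.mul (.get .bound (.const 0)) (.get .bound (.const 0))) (.ofNat (.const 1))))
            (.ofNat (.get (.tmp 8) (.const 0)))) (Nat.zero_le _)
          (by simp [RExp.Ok, NExp.Ok, NExp.eval, c1, hg1])
        simp only [Prog.exec, Prog.wt, NExp.eval, h1'] at cc cd ⊢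
        refine ⟨⟨(ht'.setNat 8 0 (g + 1)).setReal 23 0 _, g + 1, by omega, by simp, ?_, ?_, ?_⟩, ?_⟩
        · simp only [Mem.setReal_real_self, RExp.eval, NExp.eval, Mem.setNat_real, h2', hbd,
            Mem.setNat_nat_self]
          rw [Nat.factorial_succ, pow_succ, hB]
          push_cast
          field_simp
        · intro g' hg'
          rcases Nat.lt_succ_iff_lt_or_eq.1 hg' with h' | rfl
          exacts [h3 g' h', hd]
        · exact Or.inr (by rw [h4.resolve_left hd])
        · nlinarith)
  obtain ⟨⟨hk, g, hgk, h1, h2, h3, h4⟩, hc⟩ := h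
  have ex : ∀ Q, ((Prog.seq (.seq (.setNat (.tmp 8) (.const 0) (.const 0))
      (.setReal (.tmp 23) (.const 0) (.ofNat (.const 1)))) Q).exec s).1 = (Q.exec s₁).1 :=
    fun Q => by rw [Prog.exec, e₁]
  refine ⟨by rw [degProg, ex]; exact hk, ?_, ?_⟩
  · rw [degProg, ex, h1]
    symm
    rw [degree, Nat.find_eq_iff]
    exact ⟨h4, fun g' hg' h' => h'.elim (h3 g' hg') (by omega)⟩
  · rw [degProg]
    refine cost_seq_le (cost_seq_le ?_ ?_) ?_
    · exact cost_mono (cost_setNat_le hV (le_refl _) (Nat.zero_le _) (Nat.zero_le _))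
        (Nat.le_mul_of_pos_right _ (by omega))
    · exact cost_mono (cost_setReal_le hV (le_refl _) (Nat.zero_le _) (show 1 ≤ V by omega))
        (Nat.le_mul_of_pos_right _ (by omega))
    · rw [e₁]; exact hc

/-! ### The construction of the table of monomials -/

/-- The memory holds the table `L`: its length in `tmp 3`, parents, variables and degrees in
`tmp 4`, `tmp 5`, `tmp 6`, inverse multiplicities in the real array `tmp 21`, and the indicator of the first
entry in the real array `tmp 22`. -/
structure Rep (s : Mem) (L : List Entry) : Prop where
  len : s.nat (.tmp 3) 0 = L.length
  par : ∀ m < L.length, s.nat (.tmp 4) m = (entry L m).par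
  var : ∀ m < L.length, s.nat (.tmp 5) m = (entry L m).var
  deg : ∀ m < L.length, s.nat (.tmp 6) m = (entry L m).deg
  inv : ∀ m < L.length, s.real (.tmp 21) m = ((entry L m).mult : ℝ)⁻¹
  one : ∀ m < L.length, s.real (.tmp 22) m = if m = 0 then 1 else 0

theorem Rep.setNat {s : Mem} {L : List Entry} (h : Rep s L) {i : ℕ} (hi : i < 3 ∨ 6 < i)
    (k v : ℕ) : Rep (s.setNat (.tmp i) k v) L := by
  have key : ∀ j, 3 ≤ j → j ≤ 6 → (s.setNat (.tmp i) k v).nat (.tmp j) = s.nat (.tmp j) :=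
    fun j h1 h2 => s.setNat_nat_of_ne (by simp; omega) k v
  constructor
  · rw [key 3 (by omega) (by omega)]; exact h.len
  · rw [key 4 (by omega) (by omega)]; exact h.par
  · rw [key 5 (by omega) (by omega)]; exact h.var
  · rw [key 6 (by omega) (by omega)]; exact h.deg
  · exact h.inv
  · exact h.one

/-- The memory after an entry has been appended to the table. -/
noncomputable def pushMem (s : Mem) (N : ℕ) (e : Entry) : Mem :=
  ((((((s.setNat (.tmp 4) N e.par).setNat (.tmp 5) N e.var).setNat (.tmp 6) N e.deg).setReal
    (.tmp 21) N (e.mult : ℝ)⁻¹).setReal (.tmp 22) N 0).setNat (.tmp 7) 0 N).setNat (.tmp 3) 0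
      (N + 1)

theorem Rep.push {s : Mem} {L : List Entry} (h : Rep s L) (hL : 0 < L.length) (e : Entry) :
    Rep (pushMem s L.length e) (L ++ [e]) := by
  have key : ∀ m, m < (L ++ [e]).length → m < L.length ∧ m ≠ L.length ∧
      entry (L ++ [e]) m = entry L m ∨ m = L.length ∧ entry (L ++ [e]) m = e := by
    intro m hm
    rcases lt_or_eq_of_le (Nat.lt_succ_iff.1 (by simpa using hm)) with hlt | rfl
    · exact Or.inl ⟨hlt, hlt.ne, entry_append_left hlt⟩
    · exact Or.inr ⟨rfl, entry_append_self⟩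
  constructor
  · simp [pushMem]
  · intro m hm
    rcases key m hm with ⟨hlt, hne, he⟩ | ⟨rfl, he⟩ <;> rw [he]
    · simp [pushMem, Mem.setNat_nat, hne, h.par m hlt]
    · simp [pushMem, Mem.setNat_nat]
  · intro m hm
    rcases key m hm with ⟨hlt, hne, he⟩ | ⟨rfl, he⟩ <;> rw [he]
    · simp [pushMem, Mem.setNat_nat, hne, h.var m hlt]
    · simp [pushMem, Mem.setNat_nat]
  · intro m hm
    rcases key m hm with ⟨hlt, hne, he⟩ | ⟨rfl, he⟩ <;> rw [he]
    · simp [pushMem, Mem.setNat_nat, hne, h.deg m hlt]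
    · simp [pushMem, Mem.setNat_nat]
  · intro m hm
    rcases key m hm with ⟨hlt, hne, he⟩ | ⟨rfl, he⟩ <;> rw [he]
    · simp [pushMem, Mem.setReal_real_of_ne, Mem.setReal_real_of_ne_idx _ _ hne, h.inv m hlt]
    · simp [pushMem, Mem.setReal_real_of_ne]
  · intro m hm
    rcases key m hm with ⟨hlt, hne, -⟩ | ⟨rfl, -⟩
    · simp [pushMem, Mem.setReal_real_of_ne_idx _ _ hne, Mem.setReal_real_of_ne, h.one m hlt]
    · simp [pushMem, hL.ne']

/-- Append the product of the monomial `tmp 7` with the variable `rowI` to the table, as an entry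
of degree `deg colI + sumI + 1` and multiplicity `sumI + 1`, and let `tmp 7` point to it. -/
def pushProg : Prog :=
  .seq (.seq (.seq (.seq (.seq (.seq
    (.setNat (.tmp 4) mN (.get (.tmp 7) (.const 0)))
    (.setNat (.tmp 5) mN rowI))
    (.setNat (.tmp 6) mN (.add (.add (.get (.tmp 6) colI) sumI) (.const 1))))
    (.setReal (.tmp 21) mN (.div (.ofNat (.const 1)) (.ofNat (.add sumI (.const 1))))))
    (.setReal (.tmp 22) mN zeroR))
    (.setNat (.tmp 7) (.const 0) mN))
    (.setNat (.tmp 3) (.const 0) (.add mN (.const 1)))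

theorem pushProg_spec {V : ℕ} (hV : 2 ≤ V) {s : Mem} {L : List Entry} {cur v m k : ℕ}
    (h : Rep s L) (hcur : s.nat (.tmp 7) 0 = cur) (h0 : s.nat (.tmp 0) 0 = v)
    (h1 : s.nat (.tmp 1) 0 = m) (h2 : s.nat (.tmp 2) 0 = k) (hm : m < L.length)
    (hcurV : cur ≤ V) (hvV : v ≤ V) (hkV : k ≤ V) (hLV : L.length + 1 ≤ V)
    (hdV : (entry L m).deg ≤ V) :
    (pushProg.exec s).1 = pushMem s L.length ⟨cur, v, (entry L m).deg + k + 1, k + 1⟩ ∧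
      (pushProg.exec s).2 ≤ pushProg.wt * Nat.size V := by
  have hm' := hm.ne
  have h1V : 1 ≤ V := by omega
  have hLV' : L.length ≤ V := by omega
  have hmV : m ≤ V := by omega
  have hlen := h.len
  have hdeg := h.deg m hm
  constructor
  · simp [pushProg, Prog.exec, NExp.eval, RExp.eval, Mem.setNat_nat, pushMem, hlen, hcur, h0,
      h1, h2, hdeg]
  · refine cost_seq_le (cost_seq_le (cost_seq_le (cost_seq_le (cost_seq_le (cost_seq_le
      (cost_setNat_le hV le_rfl ?_ ?_) (cost_setNat_le hV le_rfl ?_ ?_))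
      (cost_setNat_le hV le_rfl ?_ ?_)) (cost_setReal_le hV le_rfl ?_ ?_))
      (cost_setReal_le hV le_rfl ?_ ?_)) (cost_setNat_le hV le_rfl ?_ ?_))
      (cost_setNat_le hV le_rfl ?_ ?_) <;>
    simp [Prog.exec, NExp.Ok, RExp.Ok, NExp.eval, Mem.setNat_nat, hlen, hcur, h0, h1, h2, hdeg,
      hcurV, hvV, hkV, hLV', hdV, hmV, h1V]

/-- The loops that build the table of monomials: for every variable and every monomial in the
previous variables, a chain of products with powers of the variable. The number of monomials is
read before the loop over them, so that the loop does not see those appended meanwhile. -/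
def tableProg : Prog :=
  .seq (.seq (.seq (.seq (.seq (.seq
    (.setNat (.tmp 3) (.const 0) (.const 1))
    (.setNat (.tmp 4) (.const 0) (.const 0)))
    (.setNat (.tmp 5) (.const 0) (.const 0)))
    (.setNat (.tmp 6) (.const 0) (.const 0)))
    (.setReal (.tmp 21) (.const 0) zeroR))
    (.setReal (.tmp 22) (.const 0) (.ofNat (.const 1))))
    (.loop (.tmp 0) cN (.loop (.tmp 1) mN (.seq (.setNat (.tmp 7) (.const 0) colI)
      (.loop (.tmp 2) (.sub (.get (.tmp 8) (.const 0)) (.get (.tmp 6) colI)) pushProg))))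

theorem kept_pushMem {s t : Mem} (h : Kept s t) (N : ℕ) (e : Entry) :
    Kept s (pushMem t N e) :=
  ((((((h.setNat 4 _ _).setNat 5 _ _).setNat 6 _ _).setReal 21 _ _).setReal 22 _ _).setNat 7 _
    _).setNat 3 _ _

theorem table_length_mono (g : ℕ) : Monotone fun c => (table g c).length :=
  monotone_nat_of_le_succ fun _ => (prefix_extend ..).length_le

theorem tableProg_spec {V c g : ℕ} (hV : 2 ≤ V) (hc : c ≤ V) (hg : g ≤ V)
    (hL : (table g c).length * (g + 1) + 1 ≤ V) {s : Mem} (hsc : s.nat .dimC 0 = c)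
    (hsg : s.nat (.tmp 8) 0 = g) :
    Kept s (tableProg.exec s).1 ∧ Rep (tableProg.exec s).1 (table g c) ∧
      (tableProg.exec s).2 ≤ tableProg.wt *
        (Nat.size V * (g + 1) * ((table g c).length + 1) * (c + 1)) := by
  have hS := one_le_size hV
  set D₁ := Nat.size V * (g + 1) with hD₁
  set D₂ := Nat.size V * (g + 1) * ((table g c).length + 1) with hD₂
  have hSD₁ : Nat.size V ≤ D₁ := Nat.le_mul_of_pos_right _ (by omega)
  have hD₁₂ : D₁ ≤ D₂ := Nat.le_mul_of_pos_right _ (by omega)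
  let Base : Mem → Prop := fun t => Kept s t ∧ t.nat (.tmp 8) 0 = g
  -- the products of one monomial with the powers of one variable
  have inner : ∀ v < c, ∀ m < (table g v).length, ∀ t, Base t → t.nat (.tmp 0) 0 = v →
      t.nat (.tmp 1) 0 = m → Rep t (extend v g (table g v) m) →
      let P := Prog.seq (.setNat (.tmp 7) (.const 0) colI)
        (.loop (.tmp 2) (.sub (.get (.tmp 8) (.const 0)) (.get (.tmp 6) colI)) pushProg)
      (Base (P.exec t).1 ∧ (P.exec t).1.nat (.tmp 0) 0 = v ∧
        Rep (P.exec t).1 (extend v g (table g v) (m + 1))) ∧ (P.exec t).2 ≤ P.wt * D₁ := by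
    intro v hv m hm t hB h0 h1 hR
    have good : GoodTable (v + 1) g (extend v g (table g v) m) :=
      ((goodTable_table g v).mono (Nat.le_succ v)).extend (Nat.lt_succ_self v) hm.le
    have hlen : (extend v g (table g v) m).length + g ≤ (table g c).length * (g + 1) := by
      have h1 := length_extend_le v g (table g v) m
      have h2 : (table g v).length ≤ (table g c).length := table_length_mono g hv.le
      have h3 : (m + 1) * g ≤ (table g c).length * g := Nat.mul_le_mul_right _ (by omega)
      rw [Nat.succ_mul] at h3
      rw [Nat.mul_succ]
      omega
    have hmL : m < (extend v g (table g v) m).length :=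
      hm.trans_le (prefix_extend v g (table g v) m).length_le
    set L := extend v g (table g v) m with hLdef
    set dg := (entry L m).deg with hdg
    have hdgg : dg ≤ g := good.deg m hmL
    have hmV : m ≤ V := by omega
    let t₁ := t.setNat (.tmp 7) 0 m
    have e₁ : ((Prog.setNat (.tmp 7) (.const 0) colI).exec t).1 = t₁ := by
      simp [Prog.exec, NExp.eval, h1, t₁]
    have b₁ : t₁.nat (.tmp 8) 0 = g := by
      rw [Mem.setNat_nat_of_ne _ (by simp)]; exact hB.2
    have b₂ : t₁.nat (.tmp 1) 0 = m := by
      rw [Mem.setNat_nat_of_ne _ (by simp)]; exact h1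
    have b₃ : t₁.nat (.tmp 0) 0 = v := by
      rw [Mem.setNat_nat_of_ne _ (by simp)]; exact h0
    have b₄ : t₁.nat (.tmp 6) m = dg := by
      rw [Mem.setNat_nat_of_ne _ (by simp)]; exact hR.deg m hmL
    have hloop := exec_loop (s := t₁) (x := .tmp 2)
      (e := .sub (.get (.tmp 8) (.const 0)) (.get (.tmp 6) colI)) (v := g - dg) (p := pushProg)
      hV (le_refl _)
      (fun k u => Base u ∧ u.nat (.tmp 0) 0 = v ∧ u.nat (.tmp 1) 0 = m ∧
        u.nat (.tmp 7) 0 = (if k = 0 then m else L.length + k - 1) ∧ Rep u (chain v m dg L k))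
      (by simp [NExp.Ok, NExp.eval, b₁, b₂, b₄, hmV, hg]; omega)
      (by simp [NExp.eval, b₁, b₂, b₄])
      ⟨⟨hB.1.setNat 7 _ _, b₁⟩, b₃, b₂, by simp [t₁],
        by rw [chain_zero]; exact hR.setNat (by omega) _ _⟩
      (by
        rintro k hk u ⟨⟨u1, u2⟩, u3, u4, u5, u6⟩
        have hpre : entry (chain v m dg L k) m = entry L m :=
          entry_of_prefix (prefix_chain v m dg L k) hmL
        obtain ⟨x1, x2⟩ := pushProg_spec hV (s := u.setNat (.tmp 2) 0 k)
          (L := chain v m dg L k) (cur := if k = 0 then m else L.length + k - 1) (v := v) (m := m)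
          (k := k) (u6.setNat (by omega) _ _)
          (by rw [Mem.setNat_nat_of_ne _ (by simp)]; exact u5)
          (by rw [Mem.setNat_nat_of_ne _ (by simp)]; exact u3)
          (by rw [Mem.setNat_nat_of_ne _ (by simp)]; exact u4) (by simp)
          (by rw [length_chain]; omega) (by split_ifs <;> omega) (by omega) (by omega)
          (by rw [length_chain]; omega) (by rw [hpre]; omega)
        refine ⟨?_, x2⟩
        rw [x1, hpre]
        refine ⟨⟨kept_pushMem (u1.setNat 2 _ _) _ _, ?_⟩, ?_, ?_, ?_, ?_⟩
        · simp [pushMem, Mem.setNat_nat, u2]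
        · simp [pushMem, Mem.setNat_nat, u3]
        · simp [pushMem, Mem.setNat_nat, u4]
        · simp [pushMem, Mem.setNat_nat]
        · rw [chain_succ]
          exact (u6.setNat (by omega) _ _).push (by rw [length_chain]; omega) _)
    obtain ⟨⟨x1, x2, -, -, x3⟩, x4⟩ := hloop
    have ex : ∀ Q, ((Prog.seq (.setNat (.tmp 7) (.const 0) colI) Q).exec t).1 = (Q.exec t₁).1 :=
      fun Q => by rw [Prog.exec, e₁]
    intro P
    refine ⟨?_, cost_seq_le ?_ ?_⟩
    · simp only [P, ex]; exact ⟨x1, x2, x3⟩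
    · exact cost_mono (cost_setNat_le hV le_rfl (Nat.zero_le _)
        (by simp [NExp.Ok, NExp.eval, h1, hmV])) hSD₁
    · rw [e₁]
      exact cost_mono x4 (Nat.mul_le_mul_left _ (by omega))
  -- all products with the powers of one variable
  have middle : ∀ v < c, ∀ t, Base t → t.nat (.tmp 0) 0 = v → Rep t (table g v) →
      let P := Prog.loop (.tmp 1) mN (.seq (.setNat (.tmp 7) (.const 0) colI)
        (.loop (.tmp 2) (.sub (.get (.tmp 8) (.const 0)) (.get (.tmp 6) colI)) pushProg))
      (Base (P.exec t).1 ∧ Rep (P.exec t).1 (table g (v + 1))) ∧ (P.exec t).2 ≤ P.wt * D₂ := by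
    intro v hv t hB h0 hR
    have hlen : (table g v).length ≤ (table g c).length := table_length_mono g hv.le
    have hlenV : (table g v).length ≤ V := by nlinarith
    have hloop := exec_loop (s := t) (x := .tmp 1) (e := mN) (v := (table g v).length)
      (p := .seq (.setNat (.tmp 7) (.const 0) colI)
        (.loop (.tmp 2) (.sub (.get (.tmp 8) (.const 0)) (.get (.tmp 6) colI)) pushProg))
      hV hSD₁
      (fun m u => Base u ∧ u.nat (.tmp 0) 0 = v ∧ Rep u (extend v g (table g v) m))
      (by simp [NExp.Ok, NExp.eval, hR.len, hlenV]) (by simp [NExp.eval, hR.len])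
      ⟨hB, h0, hR⟩
      (by
        rintro m hm u ⟨⟨u1, u2⟩, u3, u4⟩
        exact inner v hv m hm (u.setNat (.tmp 1) 0 m)
          ⟨u1.setNat 1 _ _, by rw [Mem.setNat_nat_of_ne _ (by simp)]; exact u2⟩
          (by rw [Mem.setNat_nat_of_ne _ (by simp)]; exact u3) (by simp)
          (u4.setNat (by omega) _ _))
    obtain ⟨⟨x1, -, x3⟩, x4⟩ := hloop
    exact ⟨⟨x1, x3⟩, cost_mono x4 (Nat.mul_le_mul_left _ (by omega))⟩
  let s₁ := (((((s.setNat (.tmp 3) 0 1).setNat (.tmp 4) 0 0).setNat (.tmp 5) 0 0).setNat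
    (.tmp 6) 0 0).setReal (.tmp 21) 0 0).setReal (.tmp 22) 0 1
  have e₁ : ((Prog.seq (.seq (.seq (.seq (.seq
    (.setNat (.tmp 3) (.const 0) (.const 1))
    (.setNat (.tmp 4) (.const 0) (.const 0)))
    (.setNat (.tmp 5) (.const 0) (.const 0)))
    (.setNat (.tmp 6) (.const 0) (.const 0)))
    (.setReal (.tmp 21) (.const 0) zeroR))
    (.setReal (.tmp 22) (.const 0) (.ofNat (.const 1)))).exec s).1 = s₁ := by
    simp [Prog.exec, NExp.eval, RExp.eval, s₁]
  have hk : Kept s s₁ :=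
    ((((((⟨rfl, rfl, fun _ _ => rfl⟩ : Kept s s).setNat 3 _ _).setNat 4 _ _).setNat 5 _ _).setNat
      6 _ _).setReal 21 _ _).setReal 22 _ _
  have hR : Rep s₁ (table g 0) := by
    constructor <;> simp [table, s₁, entry, Mem.setNat_nat, Mem.setReal_real_of_ne]
  have hloop := exec_loop (s := s₁) (x := .tmp 0) (e := cN) (v := c)
    (p := .loop (.tmp 1) mN (.seq (.setNat (.tmp 7) (.const 0) colI)
      (.loop (.tmp 2) (.sub (.get (.tmp 8) (.const 0)) (.get (.tmp 6) colI)) pushProg)))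
    hV (hSD₁.trans hD₁₂) (fun v u => Base u ∧ Rep u (table g v))
    (by simp [NExp.Ok, NExp.eval, hk.dimC, hsc, hc]) (by simp [NExp.eval, hk.dimC, hsc])
    ⟨⟨hk, by simp [s₁, Mem.setNat_nat, hsg]⟩, hR⟩
    (by
      rintro v hv u ⟨⟨u1, u2⟩, u3⟩
      exact middle v hv (u.setNat (.tmp 0) 0 v)
        ⟨u1.setNat 0 _ _, by rw [Mem.setNat_nat_of_ne _ (by simp)]; exact u2⟩ (by simp)
        (u3.setNat (by omega) _ _))
  obtain ⟨⟨x1, x2⟩, x3⟩ := hloop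
  have ex : (tableProg.exec s).1 = ((Prog.loop (.tmp 0) cN (.loop (.tmp 1) mN
      (.seq (.setNat (.tmp 7) (.const 0) colI) (.loop (.tmp 2)
        (.sub (.get (.tmp 8) (.const 0)) (.get (.tmp 6) colI)) pushProg)))).exec s₁).1 := by
    rw [tableProg, Prog.exec, e₁]
  have hSD : Nat.size V ≤ D₂ * (c + 1) :=
    (hSD₁.trans hD₁₂).trans (Nat.le_mul_of_pos_right _ (by omega))
  refine ⟨by rw [ex]; exact x1.1, by rw [ex]; exact x2, ?_⟩
  rw [tableProg]
  refine cost_seq_le (cost_seq_le (cost_seq_le (cost_seq_le (cost_seq_le (cost_seq_le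
      (cost_setNat_le hV hSD ?_ ?_) (cost_setNat_le hV hSD ?_ ?_))
      (cost_setNat_le hV hSD ?_ ?_)) (cost_setNat_le hV hSD ?_ ?_))
      (cost_setReal_le hV hSD ?_ ?_)) (cost_setReal_le hV hSD ?_ ?_)) ?_
  case refine_13 => rw [e₁]; exact x3
  all_goals simp [NExp.Ok, RExp.Ok]
  all_goals omega

/-! ### Perturbation of sums, products and matrix products -/

section Calculus

variable {H ε : ℝ} {x x' y y' : ℝ} {a b u v m : ℕ}

/-! Sizes and errors are measured in powers of a number `H ≥ 2`, an upper bound for all weights and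
for the number of channels. The lemmas `bd_…` bound a quantity by `H ^ m`, the lemmas `nr_…` bound
its perturbation by `H ^ m * ε`. Numerical factors are absorbed by additional factors `H`, so the
exponents are not optimal. -/

theorem pow_mono (hH : 2 ≤ H) (h : a ≤ m) : H ^ a ≤ H ^ m :=
  pow_le_pow_right₀ (by linarith) h

theorem bd_mono (hH : 2 ≤ H) (hx : |x| ≤ H ^ a) (h : a ≤ m) : |x| ≤ H ^ m :=
  hx.trans (pow_mono hH h)

theorem add_le_pow (hH : 2 ≤ H) (hx : x ≤ H ^ a) (hy : y ≤ H ^ b) (ha : a < m) (hb : b < m) :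
    x + y ≤ H ^ m := by
  obtain ⟨m, rfl⟩ : ∃ m', m = m' + 1 := ⟨m - 1, by omega⟩
  have h1 := pow_mono hH (show a ≤ m by omega)
  have h2 := pow_mono hH (show b ≤ m by omega)
  have h3 : 0 ≤ H ^ m := pow_nonneg (by linarith) m
  rw [pow_succ]
  nlinarith

theorem bd_add (hH : 2 ≤ H) (hx : |x| ≤ H ^ a) (hy : |y| ≤ H ^ b) (ha : a < m) (hb : b < m) :
    |x + y| ≤ H ^ m :=
  (abs_add_le x y).trans (add_le_pow hH hx hy ha hb)

theorem bd_mul (hH : 2 ≤ H) (hx : |x| ≤ H ^ a) (hy : |y| ≤ H ^ b) (h : a + b ≤ m) :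
    |x * y| ≤ H ^ m := by
  rw [abs_mul]
  refine (mul_le_mul hx hy (abs_nonneg y) (pow_nonneg (by linarith) _)).trans ?_
  rw [← pow_add]
  exact pow_mono hH h

theorem bd_sum (hH : 2 ≤ H) {c : ℕ} (hc : (c : ℝ) ≤ H) {f : Fin c → ℝ} (hf : ∀ k, |f k| ≤ H ^ a)
    (h : a < m) : |∑ k, f k| ≤ H ^ m := by
  refine (Finset.abs_sum_le_sum_abs _ _).trans ((Finset.sum_le_sum fun k _ => hf k).trans ?_)
  rw [Finset.sum_const, Finset.card_univ, Fintype.card_fin, nsmul_eq_mul]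
  refine le_trans ?_ (pow_mono hH (show a + 1 ≤ m by omega))
  rw [pow_succ, mul_comm]
  exact mul_le_mul_of_nonneg_left hc (pow_nonneg (by linarith) _)

theorem nr_mono (hH : 2 ≤ H) (hε : 0 ≤ ε) (hx : |x| ≤ H ^ a * ε) (h : a ≤ m) :
    |x| ≤ H ^ m * ε :=
  hx.trans (mul_le_mul_of_nonneg_right (pow_mono hH h) hε)

theorem nr_add (hH : 2 ≤ H) (hε : 0 ≤ ε) (hx : |x' - x| ≤ H ^ a * ε) (hy : |y' - y| ≤ H ^ b * ε)
    (ha : a < m) (hb : b < m) : |x' + y' - (x + y)| ≤ H ^ m * ε := by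
  have h1 := add_le_pow hH le_rfl le_rfl ha hb
  calc _ = |(x' - x) + (y' - y)| := by ring_nf
    _ ≤ H ^ a * ε + H ^ b * ε := (abs_add_le _ _).trans (add_le_add hx hy)
    _ = (H ^ a + H ^ b) * ε := by ring
    _ ≤ _ := mul_le_mul_of_nonneg_right h1 hε

theorem nr_mul (hH : 2 ≤ H) (hε : 0 ≤ ε) (hx : |x' - x| ≤ H ^ a * ε) (hy : |y' - y| ≤ H ^ b * ε)
    (hy' : |y'| ≤ H ^ u) (hx' : |x| ≤ H ^ v) (h1 : a + u < m) (h2 : v + b < m) :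
    |x' * y' - x * y| ≤ H ^ m * ε := by
  have h3 := add_le_pow hH le_rfl le_rfl h1 h2
  have hH0 : 0 ≤ H := by linarith
  calc _ = |(x' - x) * y' + x * (y' - y)| := by ring_nf
    _ ≤ |x' - x| * |y'| + |x| * |y' - y| := by
      rw [← abs_mul, ← abs_mul]; exact abs_add_le _ _
    _ ≤ (H ^ a * ε) * H ^ u + H ^ v * (H ^ b * ε) := by gcongr
    _ = (H ^ (a + u) + H ^ (v + b)) * ε := by rw [pow_add, pow_add]; ring
    _ ≤ _ := mul_le_mul_of_nonneg_right h3 hε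

theorem nr_sum (hH : 2 ≤ H) (hε : 0 ≤ ε) {c : ℕ} (hc : (c : ℝ) ≤ H) {f f' : Fin c → ℝ}
    (hf : ∀ k, |f' k - f k| ≤ H ^ a * ε) (h : a < m) : |∑ k, f' k - ∑ k, f k| ≤ H ^ m * ε := by
  rw [← Finset.sum_sub_distrib]
  refine (Finset.abs_sum_le_sum_abs _ _).trans ((Finset.sum_le_sum fun k _ => hf k).trans ?_)
  rw [Finset.sum_const, Finset.card_univ, Fintype.card_fin, nsmul_eq_mul]
  refine le_trans ?_ (mul_le_mul_of_nonneg_right (pow_mono hH (show a + 1 ≤ m by omega)) hε)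
  rw [pow_succ, ← mul_assoc, mul_comm (c : ℝ)]
  have : H ^ a * (c : ℝ) ≤ H ^ a * H := mul_le_mul_of_nonneg_left hc (pow_nonneg (by linarith) _)
  exact mul_le_mul_of_nonneg_right this hε

theorem bd_of_nr (hH : 2 ≤ H) (hx : |x| ≤ H ^ a) (h : |x' - x| ≤ H ^ b * ε)
    (hε : H ^ b * ε ≤ 1) (ha : a < m) : |x'| ≤ H ^ m := by
  have h1 : |x' - x| ≤ H ^ 0 := by rw [pow_zero]; exact h.trans hε
  have := bd_add hH hx h1 ha (by omega)
  rwa [add_sub_cancel] at this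

theorem small_mono (hH : 2 ≤ H) (hε : 0 ≤ ε) (h : H ^ m * ε ≤ 1) (ha : a ≤ m) : H ^ a * ε ≤ 1 :=
  (mul_le_mul_of_nonneg_right (pow_mono hH ha) hε).trans h

end Calculus

section Layers

variable {ι κ : Type*} {c : ℕ} {H ε : ℝ} {a b m : ℕ}

/-- The entries of `X'` and `X` differ by at most `b`. -/
def Near (X' X : Matrix ι κ ℝ) (b : ℝ) : Prop := ∀ i j, |X' i j - X i j| ≤ b

theorem bd_matMul (hH : 2 ≤ H) (hc : (c : ℝ) ≤ H) {X : Matrix ι (Fin c) ℝ}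
    {W : Matrix (Fin c) κ ℝ} (hX : EntriesLE X (H ^ a)) (hW : EntriesLE W H) (h : a + 2 ≤ m) :
    EntriesLE (X * W) (H ^ m) := fun i j => by
  rw [Matrix.mul_apply]
  refine bd_sum (a := a + 1) hH hc (fun k => ?_) (by omega)
  exact bd_mul hH (hX i k) (by rw [pow_one]; exact hW k j : |W k j| ≤ H ^ 1) le_rfl

theorem nr_matMul (hH : 2 ≤ H) (hε : 0 ≤ ε) (hc : (c : ℝ) ≤ H) {X X' : Matrix ι (Fin c) ℝ}
    {W : Matrix (Fin c) κ ℝ} (hX : Near X' X (H ^ a * ε)) (hW : EntriesLE W H) (h : a + 2 ≤ m) :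
    Near (X' * W) (X * W) (H ^ m * ε) := fun i j => by
  rw [Matrix.mul_apply, Matrix.mul_apply]
  refine nr_sum (a := a + 1) hH hε hc (fun k => ?_) (by omega)
  rw [← sub_mul, abs_mul, pow_succ, mul_right_comm]
  have hH0 : 0 ≤ H := by linarith
  exact mul_le_mul (hX i k) (hW k j) (abs_nonneg _) (by positivity)

theorem bd_mlp (hH : 2 ≤ H) (hc : (c : ℝ) ≤ H) {X : Matrix ι (Fin c) ℝ}
    {W : Matrix (Fin c) κ ℝ} {β : κ → ℝ} (hX : EntriesLE X (H ^ a)) (hW : EntriesLE W H)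
    (hβ : ∀ k, |β k| ≤ H) (h : a + 3 ≤ m) : EntriesLE (mlp W β X) (H ^ m) := fun i j =>
  bd_add hH (bd_matMul hH hc hX hW le_rfl i j) (by rw [pow_one]; exact hβ j : |β j| ≤ H ^ 1)
    (by omega) (by omega)

theorem nr_mlp (hH : 2 ≤ H) (hε : 0 ≤ ε) (hc : (c : ℝ) ≤ H) {X X' : Matrix ι (Fin c) ℝ}
    {W : Matrix (Fin c) κ ℝ} (β : κ → ℝ) (hX : Near X' X (H ^ a * ε)) (hW : EntriesLE W H)
    (h : a + 2 ≤ m) : Near (mlp W β X') (mlp W β X) (H ^ m * ε) := fun i j => by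
  simp only [mlp, add_sub_add_right_eq_sub]
  exact nr_matMul hH hε hc hX hW h i j

theorem bd_ffn (hH : 2 ≤ H) (hc : (c : ℝ) ≤ H) {X : Matrix ι (Fin c) ℝ}
    {W₁ W₂ : Matrix (Fin c) (Fin c) ℝ} {b₁ b₂ : Fin c → ℝ} (hX : EntriesLE X (H ^ a))
    (hW₁ : EntriesLE W₁ H) (hb₁ : ∀ k, |b₁ k| ≤ H) (hW₂ : EntriesLE W₂ H)
    (hb₂ : ∀ k, |b₂ k| ≤ H) (h : a + 7 ≤ m) : EntriesLE (ffn W₁ b₁ W₂ b₂ X) (H ^ m) := by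
  intro i j
  refine bd_add (b := a + 6) hH (hX i j) (bd_mlp (a := a + 3) hH hc (fun s k => ?_) hW₂ hb₂
    (by omega) i j) (by omega) (by omega)
  have h1 := bd_mlp hH hc hX hW₁ hb₁ le_rfl s k
  refine le_trans ?_ h1
  rw [abs_of_nonneg (le_max_left _ _)]
  exact max_le (abs_nonneg _) (le_abs_self _)

theorem nr_ffn (hH : 2 ≤ H) (hε : 0 ≤ ε) (hc : (c : ℝ) ≤ H) {X X' : Matrix ι (Fin c) ℝ}
    {W₁ W₂ : Matrix (Fin c) (Fin c) ℝ} (b₁ b₂ : Fin c → ℝ) (hX : Near X' X (H ^ a * ε))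
    (hW₁ : EntriesLE W₁ H) (hW₂ : EntriesLE W₂ H) (h : a + 5 ≤ m) :
    Near (ffn W₁ b₁ W₂ b₂ X') (ffn W₁ b₁ W₂ b₂ X) (H ^ m * ε) := by
  intro i j
  refine nr_add (b := a + 4) hH hε (hX i j) (nr_mlp (a := a + 2) hH hε hc b₂ (fun s k => ?_) hW₂
    (by omega) i j) (by omega) (by omega)
  exact (abs_max_sub_max_le_max 0 _ 0 _).trans (by
    rw [sub_self, abs_zero, max_eq_right (abs_nonneg _)]
    exact nr_mlp hH hε hc b₁ hX hW₁ le_rfl s k)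

/-- The entries of a layer normalization are at most `√c ≤ c`. -/
theorem bd_layerNorm (X : Matrix ι (Fin c) ℝ) : EntriesLE (layerNorm X) c := by
  intro i l
  have hc : (1 : ℝ) ≤ c := by exact_mod_cast (Nat.lt_of_le_of_lt (Nat.zero_le _) l.2)
  have hc0 : (0 : ℝ) < c := by linarith
  have h1 : (X i l - rowMean X i) ^ 2 ≤ c * rowVar X i := by
    rw [rowVar, mul_div_cancel₀ _ hc0.ne']
    exact Finset.single_le_sum (f := fun k => (X i k - rowMean X i) ^ 2)
      (fun k _ => sq_nonneg _) (Finset.mem_univ l)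
  have h2 : |X i l - rowMean X i| ≤ c * Real.sqrt (rowVar X i) := by
    have h0 : 0 ≤ rowVar X i := by
      rw [rowVar]; exact div_nonneg (Finset.sum_nonneg fun k _ => sq_nonneg _) hc0.le
    refine abs_le_of_sq_le_sq' ?_ (by positivity) |> abs_le.2
    rw [mul_pow, Real.sq_sqrt h0]
    nlinarith
  rw [layerNorm, abs_div, abs_of_nonneg (Real.sqrt_nonneg _)]
  exact div_le_of_le_mul₀ (Real.sqrt_nonneg _) hc0.le h2

/-- The stability of a layer normalization is part of the assumptions on a model. -/
theorem nr_layerNorm (hH : 2 ≤ H) (hε : 0 ≤ ε) {L : ℝ} (hL : 0 < L) (hLH : L ≤ H)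
    {X X' : Matrix ι (Fin c) ℝ} (hLN : LNStable L (1 / L) X) (hX : Near X' X (H ^ a * ε))
    (hs : H ^ (a + 1) * ε ≤ 1) : Near (layerNorm X') (layerNorm X) (H ^ (a + 1) * ε) := by
  have h0 : 0 ≤ H ^ a * ε := mul_nonneg (pow_nonneg (by linarith) _) hε
  intro i l
  refine (hLN X' (H ^ a * ε) ?_ hX i l).trans ?_
  · rw [le_div_iff₀ hL]
    refine le_trans (mul_le_mul_of_nonneg_left hLH h0) ?_
    rwa [mul_right_comm, ← pow_succ]
  · calc L * (H ^ a * ε) = H ^ a * ε * L := by ring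
      _ ≤ H ^ a * ε * H := mul_le_mul_of_nonneg_left hLH h0
      _ = H ^ (a + 1) * ε := by ring

/-- A relative perturbation of the weights of a weighted mean. -/
theorem abs_weightedMean_sub_le [Fintype ι] (i₀ : ι) {w w' y : ι → ℝ} {ρ Y : ℝ}
    (hw : ∀ j, 0 < w j) (hρ : ρ ≤ 1 / 2) (h : ∀ j, |w' j - w j| ≤ ρ * w j) (hy : ∀ j, |y j| ≤ Y) :
    |(∑ j, w' j * y j) / ∑ j, w' j - (∑ j, w j * y j) / ∑ j, w j| ≤ 4 * ρ * Y := by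
  have hY : 0 ≤ Y := (abs_nonneg _).trans (hy i₀)
  have hρ0 : 0 ≤ ρ := by
    by_contra hlt
    have := (abs_nonneg _).trans (h i₀)
    nlinarith [hw i₀]
  set D := ∑ j, w j with hD
  set D' := ∑ j, w' j with hD'
  have hDpos : 0 < D := Finset.sum_pos (fun j _ => hw j) ⟨i₀, Finset.mem_univ _⟩
  have hDD : |D' - D| ≤ ρ * D := by
    rw [hD, hD', ← Finset.sum_sub_distrib, Finset.mul_sum]
    exact (Finset.abs_sum_le_sum_abs _ _).trans (Finset.sum_le_sum fun j _ => h j)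
  have hD'ge : D / 2 ≤ D' := by
    have := (abs_le.1 hDD).1
    nlinarith
  have hD'pos : 0 < D' := by linarith
  have h1 : |∑ j, w' j * y j - ∑ j, w j * y j| ≤ ρ * D * Y := by
    rw [← Finset.sum_sub_distrib, hD, Finset.mul_sum, Finset.sum_mul]
    refine (Finset.abs_sum_le_sum_abs _ _).trans (Finset.sum_le_sum fun j _ => ?_)
    rw [← sub_mul, abs_mul]
    exact mul_le_mul (h j) (hy j) (abs_nonneg _) (mul_nonneg hρ0 (hw j).le)
  have h2 : |∑ j, w j * y j| ≤ D * Y := by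
    rw [hD, Finset.sum_mul]
    refine (Finset.abs_sum_le_sum_abs _ _).trans (Finset.sum_le_sum fun j _ => ?_)
    rw [abs_mul, abs_of_pos (hw j)]
    exact mul_le_mul_of_nonneg_left (hy j) (hw j).le
  set T := ∑ j, w j * y j
  set T' := ∑ j, w' j * y j
  have e : T' / D' - T / D = ((T' - T) * D + T * (D - D')) / (D' * D) := by
    field_simp
    ring
  rw [e, abs_div, abs_of_pos (mul_pos hD'pos hDpos), div_le_iff₀ (mul_pos hD'pos hDpos)]
  have h3 : |(T' - T) * D + T * (D - D')| ≤ ρ * D * Y * D + D * Y * (ρ * D) := by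
    refine (abs_add_le _ _).trans (add_le_add ?_ ?_)
    · rw [abs_mul, abs_of_pos hDpos]
      exact mul_le_mul_of_nonneg_right h1 hDpos.le
    · rw [abs_mul, abs_sub_comm]
      exact mul_le_mul h2 hDD (abs_nonneg _) (by positivity)
  refine h3.trans ?_
  have : 4 * ρ * Y * ((D / 2) * D) ≤ 4 * ρ * Y * (D' * D) := by gcongr
  nlinarith

theorem nr_scores (hH : 2 ≤ H) (hε : 0 ≤ ε) (hc : (c : ℝ) ≤ H) {W : AttnWeights c}
    (hQ : EntriesLE W.WQ H) (hK : EntriesLE W.WK H) {X X' : Matrix ι (Fin c) ℝ}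
    (hX : EntriesLE X (H ^ a)) (hN : Near X' X (H ^ b * ε)) (hs : H ^ b * ε ≤ 1) :
    Near (scores W X') (scores W X) (H ^ (a + b + 7) * ε) := by
  intro i j
  have hK' : EntriesLE W.WK.transpose H := fun u v => hK v u
  rw [scores, scores, Matrix.mul_apply, Matrix.mul_apply]
  refine nr_sum (a := a + b + 6) hH hε hc (fun k => ?_) (by omega)
  refine nr_mul hH hε (nr_matMul hH hε hc (nr_matMul hH hε hc hN hQ le_rfl) hK' le_rfl i k)
    (hN j k) (bd_of_nr (m := a + 1) hH (hX j k) (hN j k) hs (by omega))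
    (bd_matMul hH hc (bd_matMul hH hc hX hQ le_rfl) hK' le_rfl i k) (by omega) (by omega)

variable [Fintype ι] [DecidableEq ι]

theorem attn_apply (W : AttnWeights c) (X : Matrix ι (Fin c) ℝ) (i : ι) (l : Fin c) :
    attn W X i l = (∑ j, Real.exp (scores W X i j) * (X * W.WV) j l) /
      ∑ j, Real.exp (scores W X i j) := by
  rw [attn, Matrix.mul_assoc, Matrix.mul_assoc, Matrix.diagonal_mul, Matrix.mul_apply,
    inv_mul_eq_div]
  rfl

theorem bd_attn (hH : 2 ≤ H) (hc : (c : ℝ) ≤ H) {W : AttnWeights c} (hV : EntriesLE W.WV H)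
    {X : Matrix ι (Fin c) ℝ} (hX : EntriesLE X (H ^ a)) (h : a + 2 ≤ m) :
    EntriesLE (attn W X) (H ^ m) := by
  intro i l
  have hpos : 0 < ∑ j, Real.exp (scores W X i j) :=
    Finset.sum_pos (fun j _ => Real.exp_pos _) ⟨i, Finset.mem_univ _⟩
  rw [attn_apply, abs_div, abs_of_pos hpos, div_le_iff₀ hpos, Finset.mul_sum]
  refine (Finset.abs_sum_le_sum_abs _ _).trans (Finset.sum_le_sum fun j _ => ?_)
  rw [abs_mul, abs_of_pos (Real.exp_pos _), mul_comm]
  exact mul_le_mul_of_nonneg_right (bd_matMul hH hc hX hV h j l) (Real.exp_pos _).le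

/-- A perturbation `Δ ≤ 1` of a score changes its exponential by the relative error `2 Δ`. -/
theorem nr_attn (hH : 2 ≤ H) (hε : 0 ≤ ε) (hc : (c : ℝ) ≤ H) {W : AttnWeights c}
    (hQ : EntriesLE W.WQ H) (hK : EntriesLE W.WK H) (hV : EntriesLE W.WV H)
    {X X' : Matrix ι (Fin c) ℝ} (hX : EntriesLE X (H ^ a)) (hN : Near X' X (H ^ b * ε))
    (hs : H ^ (a + b + 9) * ε ≤ 1) :
    Near (attn W X') (attn W X) (H ^ (2 * a + b + 14) * ε) := by
  intro i l
  have hs1 : H ^ b * ε ≤ 1 := small_mono hH hε hs (by omega)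
  have hsc := nr_scores hH hε hc hQ hK hX hN hs1
  have hX' : EntriesLE X' (H ^ (a + 1)) := fun j k =>
    bd_of_nr hH (hX j k) (hN j k) hs1 (by omega)
  have hv' := bd_matMul hH hc hX' hV (m := a + 3) (by omega)
  have hv := nr_matMul hH hε hc hN hV le_rfl
  set Δ := H ^ (a + b + 7) * ε with hΔ
  have hΔ0 : 0 ≤ Δ := mul_nonneg (pow_nonneg (by linarith) _) hε
  have hΔ4 : 4 * Δ ≤ 1 := by
    refine le_trans ?_ hs
    rw [hΔ, show a + b + 9 = 2 + (a + b + 7) by omega, pow_add H 2, mul_assoc]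
    exact mul_le_mul_of_nonneg_right (by nlinarith) hΔ0
  rw [attn_apply, attn_apply]
  have h1 := abs_weightedMean_sub_le i (w := fun j => Real.exp (scores W X i j))
    (w' := fun j => Real.exp (scores W X' i j)) (y := fun j => (X' * W.WV) j l) (ρ := 2 * Δ)
    (fun j => Real.exp_pos _) (by linarith) (fun j => by
      have h3 : Real.exp (scores W X' i j) - Real.exp (scores W X i j) =
          (Real.exp (scores W X' i j - scores W X i j) - 1) * Real.exp (scores W X i j) := by
        rw [sub_mul, ← Real.exp_add, one_mul, sub_add_cancel]
      rw [h3, abs_mul, abs_of_pos (Real.exp_pos (scores W X i j))]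
      refine mul_le_mul_of_nonneg_right ?_ (Real.exp_pos _).le
      exact (Real.abs_exp_sub_one_le ((hsc i j).trans (by linarith))).trans
        (mul_le_mul_of_nonneg_left (hsc i j) (by norm_num))) (fun j => hv' j l)
  have hpos : 0 < ∑ j, Real.exp (scores W X i j) :=
    Finset.sum_pos (fun j _ => Real.exp_pos _) ⟨i, Finset.mem_univ _⟩
  have h2 : |(∑ j, Real.exp (scores W X i j) * (X' * W.WV) j l) /
      ∑ j, Real.exp (scores W X i j) - (∑ j, Real.exp (scores W X i j) * (X * W.WV) j l) /
      ∑ j, Real.exp (scores W X i j)| ≤ H ^ (b + 2) * ε := by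
    rw [← sub_div, abs_div, abs_of_pos hpos, div_le_iff₀ hpos, Finset.mul_sum,
      ← Finset.sum_sub_distrib]
    refine (Finset.abs_sum_le_sum_abs _ _).trans (Finset.sum_le_sum fun j _ => ?_)
    rw [← mul_sub, abs_mul, abs_of_pos (Real.exp_pos _), mul_comm]
    exact mul_le_mul_of_nonneg_right (hv j l) (Real.exp_pos _).le
  have h4 : 4 * (2 * Δ) * H ^ (a + 3) ≤ H ^ (2 * a + b + 13) * ε := by
    rw [hΔ, show 2 * a + b + 13 = 3 + (a + b + 7) + (a + 3) by omega, pow_add H (3 + _),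
      pow_add H 3]
    have h8 : 8 ≤ H ^ 3 := by
      calc (8 : ℝ) = 2 ^ 3 := by norm_num
        _ ≤ H ^ 3 := pow_le_pow_left₀ (by norm_num) hH 3
    have h0 : 0 ≤ H ^ (a + b + 7) * ε * H ^ (a + 3) :=
      mul_nonneg hΔ0 (pow_nonneg (by linarith) _)
    nlinarith
  have h5 := add_le_pow hH (le_refl (H ^ (2 * a + b + 13))) (le_refl (H ^ (b + 2)))
    (m := 2 * a + b + 14) (by omega) (by omega)
  calc _ ≤ _ := abs_sub_le _ _ _
    _ ≤ H ^ (2 * a + b + 13) * ε + H ^ (b + 2) * ε := add_le_add (h1.trans h4) h2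
    _ = (H ^ (2 * a + b + 13) + H ^ (b + 2)) * ε := by ring
    _ ≤ _ := mul_le_mul_of_nonneg_right h5 hε

/-- Approximate attention of a perturbed input. -/
theorem nr_AAttC (hH : 2 ≤ H) (hε : 0 ≤ ε) (hc : (c : ℝ) ≤ H) {W : AttnWeights c}
    (hQ : EntriesLE W.WQ H) (hK : EntriesLE W.WK H) (hV : EntriesLE W.WV H)
    {A : Matrix ι (Fin c) ℝ → Matrix ι (Fin c) ℝ} (hA : IsAAttC W ε A)
    {X X' : Matrix ι (Fin c) ℝ} (hX : EntriesLE X (H ^ a)) (hN : Near X' X (H ^ b * ε))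
    (hs : H ^ (a + b + 9) * ε ≤ 1) (h : 2 * a + b + 15 ≤ m) :
    Near (A X') (attn W X) (H ^ m * ε) := by
  intro i l
  have h1 := nr_attn hH hε hc hQ hK hV hX hN hs i l
  have h2 := hA X' i l
  have h3 := add_le_pow hH (le_refl (H ^ 0)) (le_refl (H ^ (2 * a + b + 14)))
    (m := 2 * a + b + 15) (by omega) (by omega)
  refine nr_mono hH hε ?_ h
  calc _ ≤ _ := abs_sub_le _ (attn W X' i l) _
    _ ≤ ε + H ^ (2 * a + b + 14) * ε := add_le_add h2 h1
    _ = (H ^ 0 + H ^ (2 * a + b + 14)) * ε := by ring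
    _ ≤ _ := mul_le_mul_of_nonneg_right h3 hε

end Layers

/-! ### Propagation of errors through the scales -/

section Upsample

variable {c m m' : ℕ}

theorem abs_readClamped_le {X : Grid m c} {b : ℝ} (hb : 0 ≤ b) (hX : EntriesLE X b) (i j : ℤ)
    (l : Fin c) : |readClamped X i j l| ≤ b := by
  unfold readClamped
  dsimp only
  split_ifs
  · exact hX _ _
  · simpa using hb

theorem readClamped_sub (X X' : Grid m c) (i j : ℤ) (l : Fin c) :
    readClamped (X' - X) i j l = readClamped X' i j l - readClamped X i j l := by
  unfold readClamped
  dsimp only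
  split_ifs
  · rfl
  · simp

/-- Upsampling takes sixteen terms with kernel values in the unit interval. -/
theorem abs_upsample_le (W : ℝ → unitInterval) (r : ℕ) {X : Grid m c} {b : ℝ} (hb : 0 ≤ b)
    (hX : EntriesLE X b) : EntriesLE (upsample W r X : Grid m' c) (16 * b) := by
  intro p l
  have key : ∀ f : ℤ → ℝ, ∀ B : ℝ, (∀ s, |f s| ≤ B) →
      |∑ s ∈ Finset.Icc (-1 : ℤ) 2, f s| ≤ 4 * B := by
    intro f B hf
    refine (Finset.abs_sum_le_sum_abs _ _).trans ((Finset.sum_le_sum fun s _ => hf s).trans ?_)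
    rw [Finset.sum_const, show (Finset.Icc (-1 : ℤ) 2).card = 4 from rfl, nsmul_eq_mul]
    norm_num
  rw [show 16 * b = 4 * (4 * b) by ring]
  refine key _ _ fun s => key _ _ fun t => ?_
  rw [abs_mul]
  have h1 : |(W (s : ℝ) : ℝ) * (W (t : ℝ) : ℝ)| ≤ 1 := by
    rw [abs_of_nonneg (mul_nonneg (W _).2.1 (W _).2.1)]
    exact mul_le_one₀ (W _).2.2 (W _).2.1 (W _).2.2
  exact (mul_le_of_le_one_left (abs_nonneg _) h1).trans (abs_readClamped_le hb hX _ _ _)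

theorem near_upsample (W : ℝ → unitInterval) (r : ℕ) {X X' : Grid m c} {b : ℝ} (hb : 0 ≤ b)
    (hX : Near X' X b) :
    Near (upsample W r X' : Grid m' c) (upsample W r X) (16 * b) := by
  intro p l
  have h := abs_upsample_le (m' := m') W r (X := X' - X) hb hX p l
  convert h using 2
  simp only [upsample, readClamped_sub, mul_sub, Finset.sum_sub_distrib]

end Upsample

section Scale

variable {n a K c i : ℕ} {M : Model c} {I : Input n a K c} {A : AttnLayers n a K c} {H ε : ℝ}

theorem bd_transformer (hH : 2 ≤ H) (hc : (c : ℝ) ≤ H) (hM : (M.scale i).BoundedBy H)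
    {Z : Matrix (SeqIdx n a K i) (Fin c) ℝ} (hZ : EntriesLE Z (H ^ 1)) :
    EntriesLE (transformer M (exactLayers n a K M) i Z) (H ^ 10) := fun p =>
  bd_ffn hH hc (bd_attn hH hc hM.arV hZ le_rfl) hM.W₁ hM.b₁ hM.W₂ hM.b₂ le_rfl ⟨Fin.last i, p⟩

theorem nr_transformer (hH : 2 ≤ H) (hε : 0 ≤ ε) (hc : (c : ℝ) ≤ H)
    (hM : (M.scale i).BoundedBy H) (hA : IsAAttC (M.scale i).ar ε (A.ar i))
    {Z Z' : Matrix (SeqIdx n a K i) (Fin c) ℝ} (hZ : EntriesLE Z (H ^ 1))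
    (hN : Near Z' Z (H ^ 1 * ε)) (hs : H ^ 11 * ε ≤ 1) :
    Near (transformer M A i Z') (transformer M (exactLayers n a K M) i Z) (H ^ 23 * ε) := fun p =>
  nr_ffn hH hε hc _ _ (nr_AAttC hH hε hc hM.arQ hM.arK hM.arV hA hZ hN hs le_rfl) hM.W₁ hM.W₂
    le_rfl ⟨Fin.last i, p⟩

theorem nr_interpolate {Y Y' : Grid (side n a K i) c} {b : ℕ}
    (hN : Near Y' Y (H ^ b * ε)) : Near (interpolate I i Y') (interpolate I i Y) (H ^ b * ε) := by
  intro p l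
  have h : interpolate I i Y' p l - interpolate I i Y p l =
      (I.time i : ℝ) * (Y' p l - Y p l) := by
    simp only [interpolate]
    ring
  rw [h, abs_mul, abs_of_nonneg (I.time i).2.1]
  exact (mul_le_of_le_one_left (abs_nonneg _) (I.time i).2.2).trans (hN p l)

theorem bd_modulation (hH : 2 ≤ H) (hc : (c : ℝ) ≤ H) (hM : (M.scale i).BoundedBy H)
    {Y : Grid (side n a K i) c} (hY : EntriesLE Y (H ^ 10)) (b : Fin 6) :
    EntriesLE (modulation M I i Y b) (H ^ 14) := fun p l =>
  bd_mlp (a := 11) hH hc (fun s k => bd_add (b := 0) hH (hY s k)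
    (by rw [abs_of_nonneg (I.time i).2.1]; simpa using (I.time i).2.2) (by omega) (by omega))
    hM.modW hM.modB le_rfl p (b, l)

theorem nr_modulation (hH : 2 ≤ H) (hε : 0 ≤ ε) (hc : (c : ℝ) ≤ H)
    (hM : (M.scale i).BoundedBy H) {Y Y' : Grid (side n a K i) c}
    (hN : Near Y' Y (H ^ 23 * ε)) (b : Fin 6) :
    Near (modulation M I i Y' b) (modulation M I i Y b) (H ^ 25 * ε) := fun p l =>
  nr_mlp (a := 23) hH hε hc _ (fun s k => by
    rw [add_sub_add_right_eq_sub]; exact hN s k) hM.modW le_rfl p (b, l)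

/-- A modulated layer normalization. -/
theorem bd_modulated (hH : 2 ≤ H) (hc : (c : ℝ) ≤ H) (hM : (M.scale i).BoundedBy H)
    {Y : Grid (side n a K i) c} (hY : EntriesLE Y (H ^ 10)) (U : Grid (side n a K i) c)
    (b b' : Fin 6) : EntriesLE (fun p l => modulation M I i Y b p l * layerNorm U p l
      + modulation M I i Y b' p l) (H ^ 16) := fun p l =>
  bd_add (a := 15) hH (bd_mul (b := 1) hH (bd_modulation hH hc hM hY b p l)
    ((bd_layerNorm U p l).trans (by simpa using hc)) le_rfl)
    (bd_modulation hH hc hM hY b' p l) (by omega) (by omega)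

theorem nr_modulated (hH : 2 ≤ H) (hε : 0 ≤ ε) (hc : (c : ℝ) ≤ H)
    (hM : (M.scale i).BoundedBy H) {Y Y' U U' : Grid (side n a K i) c} {u m : ℕ}
    (hY : EntriesLE Y (H ^ 10)) (hN : Near Y' Y (H ^ 23 * ε))
    (hU : Near (layerNorm U') (layerNorm U) (H ^ u * ε)) (h1 : 27 < m) (h2 : u + 15 < m)
    (b b' : Fin 6) :
    Near (fun p l => modulation M I i Y' b p l * layerNorm U' p l + modulation M I i Y' b' p l)
      (fun p l => modulation M I i Y b p l * layerNorm U p l + modulation M I i Y b' p l)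
      (H ^ m * ε) := fun p l =>
  nr_add (a := m - 1) hH hε (nr_mul (u := 1) hH hε (nr_modulation hH hε hc hM hN b p l) (hU p l)
    ((bd_layerNorm U' p l).trans (by simpa using hc)) (bd_modulation hH hc hM hY b p l)
    (by omega) (by omega)) (nr_modulation hH hε hc hM hN b' p l) (by omega) (by omega)

theorem bd_flowMatch (hH : 2 ≤ H) (hc : (c : ℝ) ≤ H) (hM : (M.scale i).BoundedBy H)
    {Y : Grid (side n a K i) c} (hY : EntriesLE Y (H ^ 10)) (F : Grid (side n a K i) c) :
    EntriesLE (flowMatch M I A i Y F) (H ^ 33) := fun p l =>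
  bd_mul (a := 19) hH (bd_mlp hH hc (bd_modulated hH hc hM hY _ 5 3) hM.outW hM.outB le_rfl p l)
    (bd_modulation hH hc hM hY 1 p l) le_rfl

/-- The input of the attention layer of the flow-matching layer and the output of the scale. -/
theorem nr_flowMatch (hH : 2 ≤ H) (hε : 0 ≤ ε) (hc : (c : ℝ) ≤ H)
    (hM : (M.scale i).BoundedBy H) (hA : IsAAttC (M.scale i).fm ε (A.fm i))
    {Y Y' F F' : Grid (side n a K i) c} {L : ℝ} (hL : 0 < L) (hLH : L ≤ H)
    (hF : LNStable L (1 / L) F)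
    (hmid : LNStable L (1 / L) (flowMid M I (exactLayers n a K M) i Y F))
    (hY : EntriesLE Y (H ^ 10)) (hN : Near Y' Y (H ^ 23 * ε)) (hFN : Near F' F (H ^ 23 * ε))
    (hs : H ^ 104 * ε ≤ 1) :
    Near (flowAttnIn M I i Y' F') (flowAttnIn M I i Y F) (H ^ 40 * ε) ∧
      Near (flowMatch M I A i Y' F') (flowMatch M I (exactLayers n a K M) i Y F)
        (H ^ 138 * ε) := by
  have sm : ∀ b ≤ 104, H ^ b * ε ≤ 1 := fun b hb => small_mono hH hε hs hb
  have hmod' : ∀ b, EntriesLE (modulation M I i Y' b) (H ^ 15) := fun b p l =>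
    bd_of_nr hH (bd_modulation hH hc hM hY b p l) (nr_modulation hH hε hc hM hN b p l)
      (sm 25 (by omega)) (by omega)
  have hin : Near (flowAttnIn M I i Y' F') (flowAttnIn M I i Y F) (H ^ 40 * ε) :=
    nr_modulated hH hε hc hM hY hN (nr_layerNorm hH hε hL hLH hF hFN (sm 24 (by omega)))
      (by omega) (by omega) 4 2
  have hatt := nr_AAttC (m := 87) hH hε hc hM.fmQ hM.fmK hM.fmV hA
    (bd_modulated (I := I) hH hc hM hY F 4 2) hin (sm 65 (by omega)) (by omega)
  have hmidN : Near (flowMid M I A i Y' F') (flowMid M I (exactLayers n a K M) i Y F)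
      (H ^ 103 * ε) := fun p l =>
    nr_mul (v := 18) hH hε (hatt p l) (nr_modulation hH hε hc hM hN 0 p l) (hmod' 0 p l)
      (bd_attn hH hc hM.fmV (bd_modulated (I := I) hH hc hM hY F 4 2) le_rfl p l)
      (by omega) (by omega)
  refine ⟨hin, fun p l => ?_⟩
  exact nr_mul (a := 122) (v := 19) hH hε
    (nr_mlp hH hε hc _ (nr_modulated (m := 120) hH hε hc hM hY hN
      (nr_layerNorm hH hε hL hLH hmid hmidN hs) (by omega) (by omega) 5 3) hM.outW le_rfl p l)
    (nr_modulation hH hε hc hM hN 1 p l) (hmod' 1 p l)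
    (bd_mlp hH hc (bd_modulated hH hc hM hY _ 5 3) hM.outW hM.outB le_rfl p l)
    (by omega) (by omega)

end Scale

section Run

variable {n a K c : ℕ} {M : Model c} {I : Input n a K c} {A : AttnLayers n a K c} {N ε R : ℝ}

/-- The input of the attention layer inside the flow-matching layer of scale `i`. -/
noncomputable def fmSeq (M : Model c) (I : Input n a K c) (A : AttnLayers n a K c) (i : ℕ) :
    Grid (side n a K i) c :=
  flowAttnIn M I i (yHat M I A i) (interpolate I i (yHat M I A i))

theorem yTilde_eq (M : Model c) (I : Input n a K c) (A : AttnLayers n a K c) (i : ℕ) :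
    yTilde M I A i = flowMatch M I A i (yHat M I A i) (interpolate I i (yHat M I A i)) := by
  rw [yTilde]
  rfl

/-- Bounds for scale `i` of a run with the layers `A`: the inputs of both attention layers and the
output of the scale have size at most `N ^ k` in the exact run, and change by at most
`N ^ k * ε`. -/
structure RunBounds (M : Model c) (I : Input n a K c) (A : AttnLayers n a K c) (N ε : ℝ)
    (k i : ℕ) : Prop where
  z_le : EntriesLE (zSeq M I (exactLayers n a K M) i) (N ^ k)
  z_near : Near (zSeq M I A i) (zSeq M I (exactLayers n a K M) i) (N ^ k * ε)
  fm_le : EntriesLE (fmSeq M I (exactLayers n a K M) i) (N ^ k)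
  fm_near : Near (fmSeq M I A i) (fmSeq M I (exactLayers n a K M) i) (N ^ k * ε)
  y_le : EntriesLE (yTilde M I (exactLayers n a K M) i) (N ^ k)
  y_near : Near (yTilde M I A i) (yTilde M I (exactLayers n a K M) i) (N ^ k * ε)

theorem RunBounds.mono {k k' i : ℕ} (h : RunBounds M I A N ε k i) (hN : 2 ≤ N) (hε : 0 ≤ ε)
    (hk : k ≤ k') : RunBounds M I A N ε k' i where
  z_le p l := bd_mono hN (h.z_le p l) hk
  z_near p l := nr_mono hN hε (h.z_near p l) hk
  fm_le p l := bd_mono hN (h.fm_le p l) hk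
  fm_near p l := nr_mono hN hε (h.fm_near p l) hk
  y_le p l := bd_mono hN (h.y_le p l) hk
  y_near p l := nr_mono hN hε (h.y_near p l) hk

theorem ScaleParams.BoundedBy.mono {S : ScaleParams c} {B : ℝ} (h : S.BoundedBy R) (hR : R ≤ B) :
    S.BoundedBy B where
  arQ i j := (h.arQ i j).trans hR
  arK i j := (h.arK i j).trans hR
  arV i j := (h.arV i j).trans hR
  W₁ i j := (h.W₁ i j).trans hR
  b₁ i := (h.b₁ i).trans hR
  W₂ i j := (h.W₂ i j).trans hR
  b₂ i := (h.b₂ i).trans hR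
  fmQ i j := (h.fmQ i j).trans hR
  fmK i j := (h.fmK i j).trans hR
  fmV i j := (h.fmV i j).trans hR
  modW i j := (h.modW i j).trans hR
  modB i := (h.modB i).trans hR
  outW i j := (h.outW i j).trans hR
  outB i := (h.outB i).trans hR

/-- One scale: bounds for the input of the transformer give bounds for the whole scale. -/
theorem runBounds_of_zSeq {k q i : ℕ} (hN : 2 ≤ N) (hε : 0 ≤ ε) (hc : (c : ℝ) ≤ N) (hR : R ≤ N)
    (hM : Admissible M I R (N ^ q)) (hA : IsApproxLayers K M ε A) (hi : i < K)
    (hs : N ^ (200 * (k + q + 1)) * ε ≤ 1)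
    (hz : EntriesLE (zSeq M I (exactLayers n a K M) i) (N ^ k))
    (hzN : Near (zSeq M I A i) (zSeq M I (exactLayers n a K M) i) (N ^ k * ε)) :
    RunBounds M I A N ε (200 * (k + q + 1)) i := by
  -- `H` dominates the weights, the sequence and the stability factor `N ^ q` of the layer
  -- normalizations; one scale amplifies errors by less than `H ^ 200`
  set H := N ^ (k + q + 1) with hH
  have hNH : N ≤ H := by simpa using pow_mono hN (show 1 ≤ k + q + 1 by omega)
  have hH2 : 2 ≤ H := hN.trans hNH
  have hpow : N ^ (200 * (k + q + 1)) = H ^ 200 := by rw [hH, ← pow_mul, mul_comm]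
  rw [hpow] at hs
  have hz' : EntriesLE (zSeq M I (exactLayers n a K M) i) (H ^ 1) := fun p l => by
    rw [pow_one]; exact bd_mono hN (hz p l) (by omega)
  have hzN' : Near (zSeq M I A i) (zSeq M I (exactLayers n a K M) i) (H ^ 1 * ε) := fun p l => by
    rw [pow_one]; exact nr_mono hN hε (hzN p l) (by omega)
  have hB : (M.scale i).BoundedBy H := (hM.weights i hi).mono (hR.trans hNH)
  have hcH := hc.trans hNH
  have hY := bd_transformer hH2 hcH hB hz'
  have hYN := nr_transformer hH2 hε hcH hB (hA i hi).1 hz' hzN' (small_mono hH2 hε hs (by omega))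
  obtain ⟨h1, h2⟩ := nr_flowMatch hH2 hε hcH hB (hA i hi).2 (pow_pos (by linarith) q)
    (pow_mono hN (by omega)) (hM.ln_in i hi) (hM.ln_mid i hi) hY hYN
    (nr_interpolate hYN) (small_mono hH2 hε hs (by omega))
  constructor
  · exact fun p l => bd_mono hN (hz p l) (by omega)
  · exact fun p l => nr_mono hN hε (hzN p l) (by omega)
  · rw [hpow]
    exact fun p l => bd_mono hH2 (bd_modulated (I := I) hH2 hcH hB hY _ 4 2 p l) (by omega)
  · rw [hpow]
    exact fun p l => nr_mono hH2 hε (h1 p l) (by omega)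
  · rw [hpow, yTilde_eq]
    exact fun p l => bd_mono hH2 (bd_flowMatch hH2 hcH hB hY _ p l) (by omega)
  · rw [hpow, yTilde_eq, yTilde_eq]
    exact fun p l => nr_mono hH2 hε (h2 p l) (by omega)

/-- All scales: the tolerance of the attention layers is amplified by a fixed power of `N`. -/
theorem exists_runBounds (K q m : ℕ) : ∃ k : ℕ, ∀ {n a c : ℕ} {M : Model c} {I : Input n a K c}
    {A : AttnLayers n a K c} {N ε R : ℝ}, 2 ≤ N → 0 ≤ ε → (c : ℝ) ≤ N → R ≤ N →
    Admissible M I R (N ^ q) → IsApproxLayers K M ε A → N ^ k * ε ≤ 1 →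
    ∀ i < m, i < K → RunBounds M I A N ε k i := by
  induction m with
  | zero => exact ⟨0, fun _ _ _ _ _ _ _ i hi => absurd hi (Nat.not_lt_zero i)⟩
  | succ m ih =>
    obtain ⟨k, hk⟩ := ih
    refine ⟨200 * (k + 5 + q + 1), ?_⟩
    intro n a c M I A N ε R hN hε hc hR hM hA hs i hi hiK
    have hprev := fun j (hj : j < m) (hjK : j < K) =>
      hk hN hε hc hR hM hA (small_mono hN hε hs (by omega)) j hj hjK
    rcases Nat.lt_succ_iff_lt_or_eq.1 hi with h | rfl
    · exact (hprev i h hiK).mono hN hε (by omega)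
    have h16 : (16 : ℝ) ≤ N ^ 4 := by
      calc (16 : ℝ) = 2 ^ 4 := by norm_num
        _ ≤ N ^ 4 := pow_le_pow_left₀ (by norm_num) hN 4
    have hk0 : 0 ≤ N ^ k := pow_nonneg (by linarith) k
    have h16k : 16 * N ^ k ≤ N ^ (k + 5) := by
      refine le_trans ?_ (pow_mono hN (show k + 4 ≤ k + 5 by omega))
      rw [pow_add, mul_comm]
      exact mul_le_mul_of_nonneg_left h16 hk0
    refine runBounds_of_zSeq hN hε hc hR hM hA hiK hs ?_ ?_
    · rintro ⟨⟨_ | j, hj⟩, p⟩ l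
      · refine (hM.init p l).trans (hR.trans ?_)
        simpa using pow_mono hN (show 1 ≤ k + 5 by omega)
      · exact (abs_upsample_le M.kernel a hk0
          (hprev j (by omega) (by omega)).y_le p l).trans h16k
    · rintro ⟨⟨_ | j, hj⟩, p⟩ l
      · have h0 : |I.zInit p l - I.zInit p l| ≤ N ^ (k + 5) * ε := by
          rw [sub_self, abs_zero]
          exact mul_nonneg (pow_nonneg (by linarith) _) hε
        exact h0
      · refine (near_upsample M.kernel a (mul_nonneg hk0 hε)
          (hprev j (by omega) (by omega)).y_near p l).trans ?_
        rw [← mul_assoc]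
        exact mul_le_mul_of_nonneg_right h16k hε

/-- Layers that agree on the inputs they get in the run with `A` have the same run. -/
theorem yTilde_congr {A B : AttnLayers n a K c} {m : ℕ}
    (har : ∀ i < m, B.ar i (zSeq M I A i) = A.ar i (zSeq M I A i))
    (hfm : ∀ i < m, B.fm i (fmSeq M I A i) = A.fm i (fmSeq M I A i)) :
    ∀ i < m, yTilde M I B i = yTilde M I A i := by
  intro i
  induction i using Nat.strong_induction_on with
  | _ i ih =>
    intro hi
    have hz : zSeq M I B i = zSeq M I A i := by
      unfold zSeq
      congr 1
      funext j hj
      exact ih j hj (by omega)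
    have hy : yHat M I B i = yHat M I A i := by
      unfold yHat transformer
      rw [hz, har i hi]
    rw [yTilde_eq, yTilde_eq, hy]
    unfold flowMatch flowMid
    have := hfm i hi
    unfold fmSeq at this
    rw [this]

end Run

/-! ### Polynomial attention as approximate attention -/

/-- The tail of the exponential series, with the factor `(g! t!)⁻¹ ≥ ((g + t)!)⁻¹`. -/
theorem abs_exp_sub_truncExp_le {x B : ℝ} (hx : |x| ≤ B) (g : ℕ) :
    |truncExp g x - Real.exp x| ≤ B ^ g / g.factorial * Real.exp B := by
  have hB : 0 ≤ B := (abs_nonneg x).trans hx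
  have hsum : ∀ y : ℝ, HasSum (fun t : ℕ => y ^ t / t.factorial) (Real.exp y) := fun y => by
    rw [Real.exp_eq_exp_ℝ]; exact NormedSpace.expSeries_div_hasSum_exp y
  have h1 := (hasSum_nat_add_iff' (g + 1)).2 (hsum x)
  have h2 := ((hasSum_nat_add_iff' 1).2 (hsum B)).mul_left (B ^ g / g.factorial)
  have h3 := HasSum.norm_le_of_bounded h1 h2 fun t => by
    rw [Real.norm_eq_abs, abs_div, abs_pow, Nat.abs_cast, div_mul_div_comm, ← pow_add,
      show t + (g + 1) = g + (t + 1) by omega]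
    have hf : (g.factorial : ℝ) * (t + 1).factorial ≤ (g + (t + 1)).factorial := by
      exact_mod_cast Nat.le_of_dvd (Nat.factorial_pos _)
        (Nat.factorial_mul_factorial_dvd_factorial_add _ _)
    exact div_le_div₀ (pow_nonneg hB _) (pow_le_pow_left₀ (abs_nonneg x) hx _)
      (by positivity) hf
  rw [Real.norm_eq_abs, abs_sub_comm] at h3
  refine h3.trans (mul_le_mul_of_nonneg_left ?_ (by positivity))
  simp

section Guarded

variable {ι : Type*} [Fintype ι] [DecidableEq ι] {c : ℕ}

open Classical in
/-- Polynomial attention on inputs with scores at most `b` and entries at most `b'`, exact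
attention elsewhere. -/
noncomputable def guardedAttn (g : ℕ) (b b' : ℝ) (W : AttnWeights c) (X : Matrix ι (Fin c) ℝ) :
    Matrix ι (Fin c) ℝ :=
  if EntriesLE (scores W X) b ∧ EntriesLE X b' then polyAttn g W X else attn W X

theorem guardedAttn_of_le {g : ℕ} {b b' : ℝ} {W : AttnWeights c} {X : Matrix ι (Fin c) ℝ}
    (h : EntriesLE (scores W X) b) (h' : EntriesLE X b') :
    guardedAttn g b b' W X = polyAttn g W X := if_pos ⟨h, h'⟩

/-- On guarded inputs the values are at most `n ^ (E + 2)` and the relative error of the exponential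
is at most `n ^ (2 - (P₀ + E + 6))`. -/
theorem isAAttC_guardedAttn {n E P₀ g : ℕ} {B : ℝ} (hn : 2 ≤ (n : ℝ)) (hc : (c : ℝ) ≤ n)
    {W : AttnWeights c} (hV : EntriesLE W.WV n) (hB : Real.exp B ≤ n)
    (hg : DegOK n (P₀ + E + 6) B g) :
    IsAAttC (ι := ι) W (1 / (n : ℝ) ^ P₀) (guardedAttn g B ((n : ℝ) ^ E) W) := by
  intro X i l
  unfold guardedAttn
  split_ifs with h
  swap
  · rw [sub_self, abs_zero]; positivity
  obtain ⟨hS, hX⟩ := h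
  have hn0 : (0 : ℝ) < n := by linarith
  have hB0 : 0 ≤ B := (abs_nonneg _).trans (hS i i)
  set r := B ^ g / g.factorial with hr
  have hr0 : 0 ≤ r := by positivity
  have hrP : r * (n : ℝ) ^ (P₀ + E + 6) ≤ 1 := hg
  -- relative to `exp x ≥ exp (-B) ≥ 1 / n`, the error of the truncation is at most `r n²`
  have hrel : ∀ j, |truncExp g (scores W X i j) - Real.exp (scores W X i j)| ≤
      r * (n : ℝ) ^ 2 * Real.exp (scores W X i j) := fun j => by
    refine (abs_exp_sub_truncExp_le (hS i j) g).trans ?_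
    rw [mul_assoc]
    refine mul_le_mul_of_nonneg_left ?_ hr0
    have h1 : 1 ≤ (n : ℝ) * Real.exp (scores W X i j) := by
      calc (1 : ℝ) = Real.exp B * Real.exp (-B) := by rw [← Real.exp_add]; simp
        _ ≤ n * Real.exp (scores W X i j) := by
          refine mul_le_mul hB (Real.exp_le_exp.2 (abs_le.1 (hS i j)).1) (Real.exp_pos _).le hn0.le
    nlinarith
  have hY := bd_matMul hn hc hX hV (m := E + 2) le_rfl
  have hmul : ∀ m ≤ P₀ + E + 6, r * (n : ℝ) ^ m ≤ 1 := fun m hm =>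
    (mul_le_mul_of_nonneg_left (pow_mono hn hm) hr0).trans hrP
  have hρ : r * (n : ℝ) ^ 2 ≤ 1 / 2 := by
    have := hmul 3 (by omega)
    have h0 : 0 ≤ r * (n : ℝ) ^ 2 := by positivity
    rw [pow_succ, ← mul_assoc] at this
    nlinarith
  rw [polyAttn, attn_apply]
  refine (abs_weightedMean_sub_le i (fun j => Real.exp_pos _) hρ hrel (fun j => hY j l)).trans ?_
  rw [le_div_iff₀ (pow_pos hn0 _)]
  have h4 : (4 : ℝ) ≤ (n : ℝ) ^ 2 := by nlinarith
  calc 4 * (r * (n : ℝ) ^ 2) * (n : ℝ) ^ (E + 2) * (n : ℝ) ^ P₀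
      = 4 * (r * (n : ℝ) ^ (P₀ + E + 4)) := by ring
    _ ≤ (n : ℝ) ^ 2 * (r * (n : ℝ) ^ (P₀ + E + 4)) :=
      mul_le_mul_of_nonneg_right h4 (by positivity)
    _ = r * (n : ℝ) ^ (P₀ + E + 6) := by ring
    _ ≤ 1 := hrP

end Guarded

/-- The run with polynomial attention is a run with approximate attention layers, and close to the
exact run. The layers that witness this are the guarded ones: on the inputs that occur they
coincide with polynomial attention. -/
theorem exists_precision (K p q : ℕ) (hK : 1 ≤ K) : ∃ P : ℕ, ∀ {n a c g : ℕ} {M : Model c}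
    {I : Input n a K c} {R : ℝ}, 2 ≤ (n : ℝ) → (c : ℝ) ≤ n → R ≤ n → Real.exp (R ^ 2 + 1) ≤ n →
    Admissible M I R ((n : ℝ) ^ q) → DegOK n P (R ^ 2 + 1) g →
    ∃ A : AttnLayers n a K c, IsApproxLayers K M (1 / (n : ℝ) ^ p) A ∧
      output M I (polyLayers n a K g M) = output M I A ∧
      ∀ x l, |output M I (polyLayers n a K g M) x l - flowAR M I x l| ≤ 1 / (n : ℝ) ^ p := by
  obtain ⟨k, hk⟩ := exists_runBounds K q K
  -- The tolerance of the layers is `n ^ (-P₀)`. It is amplified by `n ^ k` in the run, and by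
  -- `n ^ (2 * k + 7)` in the scores. In the run the entries are at most `n ^ (k + 1)`.
  refine ⟨(2 * k + 7 + p) + (k + 1) + 6, ?_⟩
  intro n a c g M I R hn hc hR hexp hM hg
  set P₀ := 2 * k + 7 + p with hP₀
  set ε := 1 / (n : ℝ) ^ P₀ with hε
  have hn0 : (0 : ℝ) < n := by linarith
  have hε0 : 0 ≤ ε := by positivity
  have hpow : ∀ m b, m + b ≤ P₀ → (n : ℝ) ^ m * ε ≤ 1 / (n : ℝ) ^ b := fun m b h => by
    rw [hε, mul_one_div, div_le_div_iff₀ (by positivity) (by positivity), ← pow_add, one_mul]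
    exact pow_mono hn h
  have hle : ∀ m ≤ P₀, (n : ℝ) ^ m * ε ≤ 1 := fun m h => by simpa using hpow m 0 h
  have hW : ∀ i < K, (M.scale i).BoundedBy n := fun i hi => (hM.weights i hi).mono hR
  let A : AttnLayers n a K c :=
    { ar := fun i => guardedAttn g (R ^ 2 + 1) ((n : ℝ) ^ (k + 1)) (M.scale i).ar
      fm := fun i => guardedAttn g (R ^ 2 + 1) ((n : ℝ) ^ (k + 1)) (M.scale i).fm }
  have hA : IsApproxLayers K M ε A := fun i hi =>
    ⟨isAAttC_guardedAttn hn hc (hW i hi).arV hexp hg,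
      isAAttC_guardedAttn hn hc (hW i hi).fmV hexp hg⟩
  have hrun : ∀ i < K, RunBounds M I A n ε k i := fun i hi =>
    hk hn hε0 hc hR hM hA (hle k (by omega)) i hi hi
  have hsc : ∀ {x y : ℝ}, |y| ≤ R ^ 2 → |x - y| ≤ (n : ℝ) ^ (k + k + 7) * ε → |x| ≤ R ^ 2 + 1 :=
    fun {x y} h1 h2 => by
      have h3 := abs_sub_abs_le_abs_sub x y
      have h4 := hle (k + k + 7) (by omega)
      linarith
  have hout : output M I (polyLayers n a K g M) = output M I A := by
    refine yTilde_congr (fun i hi => ?_) (fun i hi => ?_) (K - 1) (Nat.sub_lt hK one_pos)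
    · refine (guardedAttn_of_le (fun x y => ?_) fun x y => ?_).symm
      · exact hsc (hM.scores_ar i hi x y) (nr_scores hn hε0 hc (hW i hi).arQ (hW i hi).arK
          (hrun i hi).z_le (hrun i hi).z_near (hle k (by omega)) x y)
      · exact bd_of_nr hn ((hrun i hi).z_le x y) ((hrun i hi).z_near x y) (hle k (by omega))
          (by omega)
    · refine (guardedAttn_of_le (fun x y => ?_) fun x y => ?_).symm
      · exact hsc (hM.scores_fm i hi x y) (nr_scores hn hε0 hc (hW i hi).fmQ (hW i hi).fmK
          (hrun i hi).fm_le (hrun i hi).fm_near (hle k (by omega)) x y)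
      · exact bd_of_nr hn ((hrun i hi).fm_le x y) ((hrun i hi).fm_near x y) (hle k (by omega))
          (by omega)
  refine ⟨A, fun i hi => ⟨fun X x l => ((hA i hi).1 X x l).trans ?_,
    fun X x l => ((hA i hi).2 X x l).trans ?_⟩, hout, fun x l => ?_⟩
  · simpa using hpow 0 p (by omega)
  · simpa using hpow 0 p (by omega)
  · rw [hout]
    exact ((hrun (K - 1) (Nat.sub_lt hK one_pos)).y_near x l).trans (hpow k p (by omega))

/-! ### The whole program -/

/-- The choice of the degree, the table of monomials, and the pipeline with polynomial
attention. -/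
def mainProg (a K P : ℕ) : Prog := .seq (.seq (degProg P) tableProg) (pipelineProg a K)

theorem Loaded.of_kept {n a K c : ℕ} {s t : Mem} {R : ℝ} {M : Model c} {I : Input n a K c}
    (h : Loaded s R M I) (hk : Kept s t) : Loaded t R M I where
  dimN := hk.dimN.trans h.dimN
  dimC := hk.dimC.trans h.dimC
  bound := by rw [hk.real _ (by simp)]; exact h.bound
  kernel := by rw [hk.real _ (by simp)]; exact h.kernel
  zInit := by rw [hk.real _ (by simp)]; exact h.zInit
  time := by rw [hk.real _ (by simp)]; exact h.time
  noise i hi := by rw [hk.real _ (by simp)]; exact h.noise i hi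
  weights i hi := by
    rw [show (fun w => t.real (.weight i w)) = fun w => s.real (.weight i w) from
      funext fun w => hk.real _ (by simp)]
    exact h.weights i hi

theorem offset_le (n a K i : ℕ) : offset n a K i ≤ i * n ^ 2 := by
  induction i with
  | zero => simp [offset]
  | succ i ih =>
    have h : side n a K i ≤ n := Nat.div_le_self _ _
    rw [offset, add_mul, one_mul, sq]
    rw [sq] at ih
    exact Nat.add_le_add ih (Nat.mul_le_mul h h)

/-- The running time, up to a factor of order `n ^ 2`. -/
def timeFactor (a K P n c g : ℕ) : ℕ :=
  (mainProg a K P).wt * (K + 2) * (Nat.size (n ^ 5) * ((g + 1) * ((table g c).length + 1) *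
    ((6 * c + 17) * (6 * c + 17))))

/-- Correctness and running time of the program, with `n ^ 5` as the bound for all numbers in
use. -/
theorem mainProg_spec {a K P n c : ℕ} (ha : 1 ≤ a) (hK : 1 ≤ K) (hn : a ^ K + K + 20 ≤ n)
    (hdvd : a ^ (K - 1) ∣ n) (hc : c ≤ n) {s : Mem} {R : ℝ} {M : Model c} {I : Input n a K c}
    (hm : (table (degree n P (R ^ 2 + 1)) c).length ≤ n) (hs : Loaded s R M I) :
    readOut _ _ ((mainProg a K P).exec s).1 =
        output M I (polyLayers n a K (degree n P (R ^ 2 + 1)) M) ∧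
      ((mainProg a K P).exec s).2 ≤ timeFactor a K P n c (degree n P (R ^ 2 + 1)) * n ^ 2 := by
  set g := degree n P (R ^ 2 + 1) with hg
  have hgn : g ≤ n := degree_le _ _ _
  have h20 : 20 ≤ n := by omega
  have hn1 : n ≤ n ^ 5 := Nat.le_self_pow (by norm_num) n
  have hn3 : n ^ 2 * n ≤ n ^ 3 := by rw [← pow_succ]
  have hn4 : n ^ 3 * n ≤ n ^ 4 := by rw [← pow_succ]
  have hn5 : n ^ 4 * n ≤ n ^ 5 := by rw [← pow_succ]
  have hn2 : n * n ≤ n ^ 2 := by rw [sq]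
  have hn2' : n ≤ n ^ 2 := Nat.le_self_pow (by norm_num) n
  have hp2 : 20 * n ≤ n ^ 2 := (Nat.mul_le_mul_right n h20).trans hn2
  have hp3 : 20 * n ^ 2 ≤ n ^ 3 := (by rw [mul_comm]; exact Nat.mul_le_mul_left _ h20 :
    20 * n ^ 2 ≤ n ^ 2 * n).trans hn3
  have hp4 : 20 * n ^ 3 ≤ n ^ 4 := (by rw [mul_comm]; exact Nat.mul_le_mul_left _ h20 :
    20 * n ^ 3 ≤ n ^ 3 * n).trans hn4
  have hp5 : 20 * n ^ 4 ≤ n ^ 5 := (by rw [mul_comm]; exact Nat.mul_le_mul_left _ h20 :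
    20 * n ^ 4 ≤ n ^ 4 * n).trans hn5
  have hV : 2 ≤ n ^ 5 := by omega
  have hL : (table g c).length * (g + 1) + 1 ≤ n ^ 5 := by
    refine (Nat.add_le_add_right (Nat.mul_le_mul hm (Nat.succ_le_succ hgn)) 1).trans ?_
    rw [Nat.succ_eq_add_one, mul_add, mul_one]
    omega
  have hoff : offset n a K K * (c + 1) ≤ n ^ 5 := by
    have h1 : offset n a K K ≤ n ^ 3 := (offset_le n a K K).trans
      ((Nat.mul_le_mul_right _ (by omega : K ≤ n)).trans (by rw [mul_comm]; exact hn3))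
    refine (Nat.mul_le_mul h1 (Nat.succ_le_succ hc)).trans ?_
    rw [Nat.succ_eq_add_one, mul_add, mul_one]
    omega
  let Γ : Ctx := ⟨n ^ 5, n, c, g, hV, hn1, hc.trans hn1, hm.trans hn1⟩
  have hΓ : Γ.Fits a K :=
    { one_le_a := ha
      offset_le := hoff
      pow_le := show a ^ K ≤ n ^ 5 by omega
      K_le := show K + 16 ≤ n ^ 5 by omega
      c_le := show 6 * c + 6 ≤ n ^ 5 by omega
      side_pos := fun j => Nat.div_pos (Nat.le_of_dvd (show 0 < n by omega)
        ((pow_dvd_pow a (by omega)).trans hdvd)) (pow_pos ha _) }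
  obtain ⟨k₁, d₁, c₁⟩ := degProg_spec (P := P) hV hn1 hs.dimN
  rw [hs.bound, ← hg] at d₁
  obtain ⟨k₂, r₂, c₂⟩ := tableProg_spec hV (by omega) (by omega) hL (k₁.dimC.trans hs.dimC) d₁
  have hkept := k₁.trans k₂
  have hE : Env Γ (tableProg.exec ((degProg P).exec s).1).1 :=
    ⟨hkept.dimN.trans hs.dimN, hkept.dimC.trans hs.dimC, r₂.len, r₂.par, r₂.var, r₂.inv, r₂.one⟩
  obtain ⟨o₃, c₃⟩ := pipelineProg_spec hΓ hK hE (hs.of_kept hkept)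
  refine ⟨o₃, ?_⟩
  have hcost : ((mainProg a K P).exec s).2 = ((degProg P).exec s).2 +
      (tableProg.exec ((degProg P).exec s).1).2 +
      ((pipelineProg a K).exec (tableProg.exec ((degProg P).exec s).1).1).2 := rfl
  have hwt : (degProg P).wt + tableProg.wt + (pipelineProg a K).wt ≤ (mainProg a K P).wt := by
    simp only [mainProg, Prog.wt]
    omega
  set S := Nat.size (n ^ 5)
  set m := (table g c).length
  set X := S * ((g + 1) * (m + 1) * ((6 * c + 17) * (6 * c + 17))) with hX
  have hN : ∀ r, r ≤ K * n ^ 2 + n → r + 1 ≤ (K + 2) * n ^ 2 := fun r hr => by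
    rw [add_mul]; omega
  have hD : Γ.D (offset n a K K) =
      S * ((m + 1) * ((6 * c + 17) * (6 * c + 17)) * (offset n a K K + 1)) := rfl
  have b₁ : S * (n + 1) ≤ X * ((K + 2) * n ^ 2) :=
    Nat.mul_le_mul (Nat.le_mul_of_pos_right _ (by positivity)) (hN n (by omega))
  have b₂ : S * (g + 1) * (m + 1) * (c + 1) ≤ X * ((K + 2) * n ^ 2) := by
    have h1 : c + 1 ≤ (6 * c + 17) * (6 * c + 17) :=
      (by omega : c + 1 ≤ 6 * c + 17).trans (Nat.le_mul_of_pos_right _ (by omega))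
    have h2 : S * ((g + 1) * (m + 1) * (c + 1)) ≤ X := by
      rw [hX]
      exact Nat.mul_le_mul_left _ (Nat.mul_le_mul_left _ h1)
    rw [mul_assoc, mul_assoc, ← mul_assoc (g + 1)]
    exact h2.trans (Nat.le_mul_of_pos_right _ (hN 0 (Nat.zero_le _)))
  have b₃ : Γ.D (offset n a K K) ≤ X * ((K + 2) * n ^ 2) := by
    calc Γ.D (offset n a K K) = S * (1 * (m + 1) * ((6 * c + 17) * (6 * c + 17))) *
          (offset n a K K + 1) := by rw [one_mul, mul_assoc S, hD]
      _ ≤ X * ((K + 2) * n ^ 2) := Nat.mul_le_mul (Nat.mul_le_mul_left _ (Nat.mul_le_mul_right _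
        (Nat.mul_le_mul_right _ (by omega)))) (hN _ ((offset_le n a K K).trans (by omega)))
  calc ((mainProg a K P).exec s).2 ≤ (degProg P).wt * (X * ((K + 2) * n ^ 2)) +
        tableProg.wt * (X * ((K + 2) * n ^ 2)) +
        (pipelineProg a K).wt * (X * ((K + 2) * n ^ 2)) := by
        rw [hcost]
        exact Nat.add_le_add (Nat.add_le_add (c₁.trans (Nat.mul_le_mul_left _ b₁))
          (c₂.trans (Nat.mul_le_mul_left _ b₂))) (c₃.trans (Nat.mul_le_mul_left _ b₃))
    _ = ((degProg P).wt + tableProg.wt + (pipelineProg a K).wt) * (X * ((K + 2) * n ^ 2)) := by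
        ring
    _ ≤ (mainProg a K P).wt * (X * ((K + 2) * n ^ 2)) := Nat.mul_le_mul_right _ hwt
    _ = timeFactor a K P n c g * n ^ 2 := by rw [timeFactor]; ring

/-! ### Growth of the running time -/

/-- `f n` is `n ^ o(1)`: it grows more slowly than every positive power of `n`. -/
def SubPoly (f : ℕ → ℕ) : Prop := ∀ η : ℝ, 0 < η → ∀ᶠ n : ℕ in atTop, (f n : ℝ) ≤ (n : ℝ) ^ η

theorem tendsto_log_cast : Tendsto (fun n : ℕ => Real.log n) atTop atTop :=
  Real.tendsto_log_atTop.comp tendsto_natCast_atTop_atTop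

theorem rpow_eq_exp {n : ℕ} (hn : 1 ≤ n) (η : ℝ) : (n : ℝ) ^ η = Real.exp (η * Real.log n) := by
  rw [Real.rpow_def_of_pos (by exact_mod_cast hn), mul_comm]

theorem SubPoly.of_le_log {f : ℕ → ℕ} {C : ℝ} (h : ∀ᶠ n : ℕ in atTop, (f n : ℝ) ≤ C * Real.log n) :
    SubPoly f := fun η hη => by
  have h1 : ∀ᶠ n : ℕ in atTop, ‖Real.log n‖ ≤ (|C| + 1)⁻¹ * ‖(n : ℝ) ^ η‖ :=
    tendsto_natCast_atTop_atTop.eventually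
      ((isLittleO_log_rpow_atTop hη).def (c := (|C| + 1)⁻¹) (by positivity))
  filter_upwards [h, h1, eventually_ge_atTop 1] with n hn h1 h2
  have h3 : (1 : ℝ) ≤ n := by exact_mod_cast h2
  have h0 := Real.log_nonneg h3
  rw [Real.norm_of_nonneg h0, Real.norm_of_nonneg (by positivity),
    inv_mul_eq_div, le_div_iff₀ (by positivity)] at h1
  have := mul_le_mul_of_nonneg_right (le_abs_self C) h0
  nlinarith

theorem SubPoly.const (k : ℕ) : SubPoly fun _ => k := by
  refine SubPoly.of_le_log (C := 1) ?_
  filter_upwards [tendsto_log_cast.eventually_ge_atTop (k : ℝ)] with n hn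
  rwa [one_mul]

theorem SubPoly.mul {f g : ℕ → ℕ} (hf : SubPoly f) (hg : SubPoly g) :
    SubPoly fun n => f n * g n := fun η hη => by
  filter_upwards [hf (η / 2) (by positivity), hg (η / 2) (by positivity), eventually_ge_atTop 1]
    with n h1 h2 h3
  have : (n : ℝ) ^ η = (n : ℝ) ^ (η / 2) * (n : ℝ) ^ (η / 2) := by
    rw [← Real.rpow_add (by exact_mod_cast h3), add_halves]
  rw [this, Nat.cast_mul]
  exact mul_le_mul h1 h2 (Nat.cast_nonneg _) (by positivity)

theorem SubPoly.add {f g : ℕ → ℕ} (hf : SubPoly f) (hg : SubPoly g) :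
    SubPoly fun n => f n + g n := fun η hη => by
  filter_upwards [hf (η / 2) (by positivity), hg (η / 2) (by positivity),
    SubPoly.const 2 (η / 2) (by positivity), eventually_ge_atTop 1] with n h1 h2 h4 h3
  have : (n : ℝ) ^ η = (n : ℝ) ^ (η / 2) * (n : ℝ) ^ (η / 2) := by
    rw [← Real.rpow_add (by exact_mod_cast h3), add_halves]
  rw [this, Nat.cast_add]
  push_cast at h4
  nlinarith

theorem subPoly_size (k : ℕ) : SubPoly fun n => Nat.size (n ^ k) := by
  refine SubPoly.of_le_log (C := k / Real.log 2 + 1) ?_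
  filter_upwards [tendsto_log_cast.eventually_ge_atTop 1, eventually_ge_atTop 1] with n h1 h2
  have hl2 : 0 < Real.log 2 := Real.log_pos (by norm_num)
  have h3 : 0 < Nat.size (n ^ k) := Nat.size_pos.2 (pow_pos h2 k)
  have h4 : 2 ^ (Nat.size (n ^ k) - 1) ≤ n ^ k := Nat.lt_size.1 (by omega)
  have h5 : Real.log ((2 : ℝ) ^ (Nat.size (n ^ k) - 1)) ≤ Real.log ((n : ℝ) ^ k) :=
    Real.log_le_log (by positivity) (by exact_mod_cast h4)
  rw [Real.log_pow, Real.log_pow, Nat.cast_sub h3, ← le_div_iff₀ hl2] at h5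
  push_cast at h5
  rw [add_mul, div_mul_eq_mul_div, one_mul]
  linarith

/-- The degree: `B ^ g / g! ≤ exp (B y) / y ^ g` for all `y > 0`, and `y` may be taken as large as
desired because `B = o(log n)`. -/
theorem eventually_degOK {R : ℕ → ℝ} (hR : R =o[atTop] fun n : ℕ => Real.sqrt (Real.log n))
    (P : ℕ) {δ : ℝ} (hδ : 0 < δ) :
    ∀ᶠ n : ℕ in atTop, DegOK n P (R n ^ 2 + 1) ⌊δ * Real.log n⌋₊ := by
  -- with `y = exp σ`, the power `y ^ g ≥ exp (σ (δ log n - 1))` exceeds `n ^ (P + 1)`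
  set σ : ℝ := (P + 2) / δ with hσ
  have hσ0 : 0 < σ := by positivity
  set y := Real.exp σ with hy
  have hy0 : 0 < y := Real.exp_pos _
  have hsmall : ∀ᶠ n : ℕ in atTop, R n ^ 2 ≤ (2 * y)⁻¹ * Real.log n := by
    have h := hR.def (c := Real.sqrt (2 * y)⁻¹) (by positivity)
    filter_upwards [h, tendsto_log_cast.eventually_ge_atTop 0] with n h1 h2
    rw [Real.norm_of_nonneg (Real.sqrt_nonneg _), Real.norm_eq_abs] at h1
    have h3 := pow_le_pow_left₀ (abs_nonneg _) h1 2
    rwa [sq_abs, mul_pow, Real.sq_sqrt (by positivity), Real.sq_sqrt h2] at h3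
  filter_upwards [hsmall, tendsto_log_cast.eventually_ge_atTop (2 * y),
    tendsto_log_cast.eventually_ge_atTop σ, eventually_ge_atTop 1] with n h1 h2 h3 h4
  have hn0 : (0 : ℝ) < n := by exact_mod_cast h4
  set l := Real.log n with hl
  set g := ⌊δ * l⌋₊ with hg
  have hBy : (R n ^ 2 + 1) * y ≤ l := by
    have h5 : R n ^ 2 * y ≤ l / 2 := by
      calc R n ^ 2 * y ≤ (2 * y)⁻¹ * l * y := mul_le_mul_of_nonneg_right h1 hy0.le
        _ = l / 2 := by field_simp
    linarith
  have hgl : δ * l - 1 ≤ g := (Nat.sub_one_lt_floor _).le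
  have h6 : ((R n ^ 2 + 1) * y) ^ g / g.factorial ≤ Real.exp l :=
    (Real.pow_div_factorial_le_exp _ (by positivity) g).trans (Real.exp_le_exp.2 hBy)
  have h7 : Real.exp l * (n : ℝ) ^ P ≤ y ^ g := by
    have hnP : (n : ℝ) ^ P = Real.exp (P * l) := by rw [Real.exp_nat_mul, hl, Real.exp_log hn0]
    rw [hy, ← Real.exp_nat_mul, hnP, ← Real.exp_add]
    refine Real.exp_le_exp.2 ?_
    have h8 : σ * (δ * l - 1) ≤ σ * g := mul_le_mul_of_nonneg_left hgl hσ0.le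
    have h9 : σ * (δ * l - 1) = (P + 2) * l - σ := by rw [hσ]; field_simp
    linarith
  rw [mul_pow, mul_div_right_comm] at h6
  have hy' : 0 < y ^ g := pow_pos hy0 g
  have h10 := mul_le_mul_of_nonneg_right h6 (pow_nonneg hn0.le P)
  have h11 : (R n ^ 2 + 1) ^ g / g.factorial * (n : ℝ) ^ P * y ^ g ≤ 1 * y ^ g := by
    rw [one_mul]
    refine le_trans (le_of_eq ?_) (h10.trans h7)
    ring
  exact le_of_mul_le_mul_right h11 hy'

theorem eventually_floor_lt (δ : ℝ) : ∀ᶠ n : ℕ in atTop, ⌊δ * Real.log n⌋₊ < n := by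
  have h := tendsto_natCast_atTop_atTop.eventually
    (Real.isLittleO_log_id_atTop.def (c := (|δ| + 1)⁻¹) (by positivity))
  filter_upwards [h, eventually_ge_atTop 1] with n h1 h2
  have h3 : (1 : ℝ) ≤ n := by exact_mod_cast h2
  have h0 := Real.log_nonneg h3
  rw [id, Real.norm_of_nonneg h0, Real.norm_of_nonneg (by positivity), inv_mul_eq_div,
    le_div_iff₀ (by positivity)] at h1
  rw [Nat.floor_lt' (by omega)]
  rcases h0.eq_or_lt with h | h
  · rw [← h]; linarith
  · have := mul_le_mul_of_nonneg_right (le_abs_self δ) h0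
    nlinarith

/-- The number of monomials of degree `g = o(log n)` in `d = O(log n)` variables is `n ^ o(1)`. -/
theorem subPoly_length {d g : ℕ → ℕ}
    (hd : (fun n : ℕ => (d n : ℝ)) =O[atTop] (fun n : ℕ => Real.log n))
    (hg : ∀ δ : ℝ, 0 < δ → ∀ᶠ n : ℕ in atTop, (g n : ℝ) ≤ δ * Real.log n) :
    SubPoly fun n => (table (g n) (d n)).length := fun η hη => by
  obtain ⟨C, hC, hd⟩ := hd.exists_pos
  -- the point at which the generating function is evaluated
  set x := 1 - Real.exp (-(η / (2 * C))) with hx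
  have hx1 : x < 1 := by rw [hx]; linarith [Real.exp_pos (-(η / (2 * C)))]
  have hx0 : 0 < x := by
    rw [hx, sub_pos, Real.exp_lt_one_iff]
    exact neg_lt_zero.2 (by positivity)
  set ℓ := Real.log x⁻¹ with hℓ
  have hℓ0 : 0 < ℓ := Real.log_pos ((one_lt_inv₀ hx0).2 hx1)
  filter_upwards [hd.bound, hg (η / (2 * ℓ)) (by positivity), eventually_ge_atTop 1]
    with n h1 h2 h3
  have h0 : 0 ≤ Real.log n := Real.log_nonneg (by exact_mod_cast h3)
  rw [Real.norm_of_nonneg (Nat.cast_nonneg _), Real.norm_of_nonneg h0] at h1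
  refine (length_table_le (g n) (d n) hx0 hx1).trans ?_
  have e1 : x⁻¹ = Real.exp ℓ := (Real.exp_log (by positivity)).symm
  have e2 : (1 - x)⁻¹ = Real.exp (η / (2 * C)) := by
    rw [hx, sub_sub_cancel, ← Real.exp_neg, neg_neg]
  rw [rpow_eq_exp h3, e1, e2, ← Real.exp_nat_mul, ← Real.exp_nat_mul, ← Real.exp_add]
  refine Real.exp_le_exp.2 ?_
  have h4 := mul_le_mul_of_nonneg_right h2 hℓ0.le
  have h5 := mul_le_mul_of_nonneg_right h1 (show 0 ≤ η / (2 * C) by positivity)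
  have e3 : η / (2 * ℓ) * Real.log n * ℓ = η / 2 * Real.log n := by field_simp
  have e4 : C * Real.log n * (η / (2 * C)) = η / 2 * Real.log n := by field_simp
  rw [e3] at h4
  rw [e4] at h5
  linarith

theorem subPoly_of_isBigO {d : ℕ → ℕ}
    (hd : (fun n : ℕ => (d n : ℝ)) =O[atTop] (fun n : ℕ => Real.log n)) : SubPoly d := by
  obtain ⟨C, hC⟩ := hd.bound
  refine SubPoly.of_le_log (C := C) ?_
  filter_upwards [hC, tendsto_log_cast.eventually_ge_atTop 0] with n h1 h2
  rwa [Real.norm_of_nonneg (Nat.cast_nonneg _), Real.norm_of_nonneg h2] at h1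

/-- A subpolynomial function as a power of `n` with exponent tending to zero. -/
theorem SubPoly.exists_exponent {f : ℕ → ℕ} (hf : SubPoly f) :
    ∃ τ : ℕ → ℝ, Tendsto τ atTop (𝓝 0) ∧
      ∀ᶠ n : ℕ in atTop, (f n : ℝ) * (n : ℝ) ^ 2 ≤ (n : ℝ) ^ (2 + τ n) := by
  refine ⟨fun n => Real.log (max 1 (f n : ℝ)) / Real.log n, ?_, ?_⟩
  · rw [Metric.tendsto_nhds]
    intro η hη
    filter_upwards [hf (η / 2) (by positivity), tendsto_log_cast.eventually_gt_atTop 0,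
      eventually_ge_atTop 1] with n h1 h2 h3
    have h4 : max 1 (f n : ℝ) ≤ (n : ℝ) ^ (η / 2) :=
      max_le (Real.one_le_rpow (by exact_mod_cast h3) (by positivity)) h1
    have h5 := Real.log_le_log (by positivity) h4
    rw [Real.log_rpow (by exact_mod_cast h3)] at h5
    have h6 : 0 ≤ Real.log (max 1 (f n : ℝ)) := Real.log_nonneg (le_max_left _ _)
    rw [Real.dist_0_eq_abs, abs_of_nonneg (by positivity)]
    exact ((div_le_iff₀ h2).2 h5).trans_lt (by linarith)
  · filter_upwards [tendsto_log_cast.eventually_gt_atTop 0, eventually_ge_atTop 1] with n h2 h3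
    rw [Real.rpow_add (by exact_mod_cast h3), rpow_eq_exp h3 (_ / _), div_mul_cancel₀ _ h2.ne',
      Real.exp_log (by positivity), mul_comm, Real.rpow_ofNat]
    exact mul_le_mul_of_nonneg_left (le_max_right _ _) (by positivity)

theorem subPoly_timeFactor {d g : ℕ → ℕ} (a K P : ℕ)
    (hd : (fun n : ℕ => (d n : ℝ)) =O[atTop] (fun n : ℕ => Real.log n))
    (hg : ∀ δ : ℝ, 0 < δ → ∀ᶠ n : ℕ in atTop, (g n : ℝ) ≤ δ * Real.log n) :
    SubPoly fun n => timeFactor a K P n (d n) (g n) := by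
  have h1 : SubPoly g := .of_le_log (hg 1 one_pos)
  have h2 : SubPoly fun n => 6 * d n + 17 :=
    ((SubPoly.const 6).mul (subPoly_of_isBigO hd)).add (.const 17)
  exact (SubPoly.const _).mul ((subPoly_size 5).mul (((h1.add (.const 1)).mul
    ((subPoly_length hd hg).add (.const 1))).mul (h2.mul h2)))

end FlowAR

theorem mainTheorem2 (K a : ℕ) (hK : 1 ≤ K) (ha : 1 ≤ a) (p q : ℕ) :
    ∃ P : FlowAR.Prog, ∀ (d : ℕ → ℕ) (R : ℕ → ℝ),
      (fun n : ℕ => (d n : ℝ)) =O[atTop] (fun n : ℕ => Real.log n) →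
      R =o[atTop] (fun n : ℕ => Real.sqrt (Real.log n)) →
      ∃ τ : ℕ → ℝ, Tendsto τ atTop (𝓝 0) ∧
        ∀ᶠ n : ℕ in atTop, a ^ (K - 1) ∣ n →
          ∀ (M : FlowAR.Model (d n)) (I : FlowAR.Input n a K (d n)) (s : FlowAR.Mem),
            FlowAR.Admissible M I (R n) ((n : ℝ) ^ q) →
            FlowAR.Loaded s (R n) M I →
            ((P.exec s).2 : ℝ) ≤ (n : ℝ) ^ (2 + τ n) ∧
            (∃ A : FlowAR.AttnLayers n a K (d n),
              FlowAR.IsApproxLayers K M (1 / (n : ℝ) ^ p) A ∧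
              FlowAR.readOut _ _ (P.exec s).1 = FlowAR.output M I A) ∧
            ∀ x l, |FlowAR.readOut _ _ (P.exec s).1 x l - FlowAR.flowAR M I x l|
              ≤ 1 / (n : ℝ) ^ p := by
  obtain ⟨P, hP⟩ := FlowAR.exists_precision K p q hK
  refine ⟨FlowAR.mainProg a K P, fun d R hd hR => ?_⟩
  set g : ℕ → ℕ := fun n => FlowAR.degree n P (R n ^ 2 + 1) with hg
  have hgδ : ∀ δ : ℝ, 0 < δ → ∀ᶠ n : ℕ in atTop, (g n : ℝ) ≤ δ * Real.log n := fun δ hδ => by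
    filter_upwards [FlowAR.eventually_degOK hR P hδ,
      FlowAR.tendsto_log_cast.eventually_ge_atTop 0] with n h1 h2
    exact (Nat.cast_le.2 (FlowAR.degree_le_of_degOK h1)).trans
      (Nat.floor_le (mul_nonneg hδ.le h2))
  obtain ⟨τ, hτ, hT⟩ := (FlowAR.subPoly_timeFactor a K P hd hgδ).exists_exponent
  refine ⟨τ, hτ, ?_⟩
  have hsq : ∀ᶠ n : ℕ in atTop, R n ^ 2 ≤ 1 / 2 * Real.log n := by
    filter_upwards [hR.def (c := Real.sqrt (1 / 2)) (by positivity),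
      FlowAR.tendsto_log_cast.eventually_ge_atTop 0] with n h1 h2
    rw [Real.norm_of_nonneg (Real.sqrt_nonneg _), Real.norm_eq_abs] at h1
    have h3 := pow_le_pow_left₀ (abs_nonneg _) h1 2
    rwa [sq_abs, mul_pow, Real.sq_sqrt (by norm_num), Real.sq_sqrt h2] at h3
  filter_upwards [hT, hsq, FlowAR.tendsto_log_cast.eventually_ge_atTop 2,
    FlowAR.eventually_degOK hR P one_pos, FlowAR.eventually_floor_lt 1,
    FlowAR.subPoly_of_isBigO hd 1 one_pos, FlowAR.subPoly_length hd hgδ 1 one_pos,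
    eventually_ge_atTop (a ^ K + K + 20)] with n hT hsq hlog hdeg hfl hc hm hn
    hdvd M I s hM hs
  rw [Real.rpow_one, Nat.cast_le] at hc hm
  have hn0 : (0 : ℝ) < n := by exact_mod_cast (by omega : 0 < n)
  have hB : R n ^ 2 + 1 ≤ Real.log n := by linarith
  have hexp : Real.exp (R n ^ 2 + 1) ≤ n := by
    rw [← Real.le_log_iff_exp_le hn0]; exact hB
  have hRn : R n ≤ n := by
    have := Real.add_one_le_exp (R n ^ 2 + 1)
    nlinarith [sq_nonneg (R n - 1)]
  obtain ⟨hout, hcost⟩ := FlowAR.mainProg_spec (P := P) ha hK hn hdvd hc hm hs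
  obtain ⟨A, hA, hAout, herr⟩ := hP (by exact_mod_cast (by omega : 2 ≤ n))
    (by exact_mod_cast hc) hRn hexp hM (FlowAR.degOK_degree hdeg hfl)
  refine ⟨le_trans (by exact_mod_cast hcost) hT, ⟨A, hA, hout.trans hAout⟩, ?_⟩
  rw [hout]
  exact herr
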